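/- Let $N\ge 1$ be an integer, $1<p<\infty$, and for $R>0$ let $B_R\subset\mathbb R^N$ be the open ball of radius $R$ centred at the origin. Let $g\in C([0,\infty))\cap C^1((0,\infty))$ be real-valued and suppose that - $(g_0)'$: the limit $\lim_{s\to0^+}g(s)/s^{p-1}$ exists and belongs to $(-\infty,1]$; - $(g_{\mathrm{eq}})$: $g(s)<s^{p-1}$ for $0<s<1$, $g(1)=1$, and $g(s)>s^{p-1}$ for $s>1$; - $(g_1)$: there is $C_1\in[0,\infty]$ with $\lim_{s\to1}\dfrac{g(s)-s^{p-1}}{|s-1|^{p-2}(s-1)}=C_1$. Consider the Neumann problem $$-\Delta_p u+u^{p-1}=g(u)\ \text{ in }B_R,\qquad u>0\ \text{ in }B_R,\qquad \partial_\nu u=0\ \text{ on }\partial B_R,\tag{P}$$ where $\Delta_p u=\operatorname{div}(|\nabla u|^{p-2}\nabla u)$ and $\nu$ is the outer unit normal; solutions are understood in the weak sense and of class $C^1(\overline{B_R})$. A radial function is written $u(x)=u(|x|)$, and its zeros are counted as zeros of a function of $r=|x|\in[0,R]$. Let $\lambda^{\mathrm{rad}}_1<\lambda^{\mathrm{rad}}_2<\dots$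 be the radial eigenvalues of $-\Delta_p$ in $B_R$ with Neumann boundary conditions, i.e. the numbers $\lambda$ for which $-\Delta_p\phi=\lambda|\phi|^{p-2}\phi$ in $B_R$, $\partial_\nu\phi=0$ on $\partial B_R$, has a radial solution $\phi\not\equiv0$ (in the same sense); they depend on $N$, $p$, $R$. Then: (i) For every $R>0$ and every integer $k\ge1$: if $C_1>\lambda^{\mathrm{rad}}_{k+1}$, then (P) has at least $k$ different non-constant radial solutions $u_1,\dots,u_k$, and $u_j-1$ has exactly $j$ zeros for each $j=1,\dots,k$. (ii) If $C_1=\infty$, then for every $R>0$ problem (P) has infinitely many different non-constant radial solutions $u_1,u_2,\dots$, and $u_j-1$ has exactly $j$ zeros for each $j\ge1$. (iii) If $C_1=0$, then for every integer $k\ge1$ there is $R_*(k)>0$ such that for every $R>R_*(k)$ problem (P) has at least $2k$ different non-constant radial solutions $u_1^\pm,\dots,u_k^\pm$, and $u_j^\pm-1$ has exactly $j$ zeros for each $j=1,\dots,k$. -/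

import Mathlib

open Set Filter Topology MeasureTheory

noncomputable section

/-- Let `B_R` be the open ball of radius `R` centred at the origin of `ℝ^N`. The function `u` is a
(weak) solution, of class `C¹` up to the boundary, of the Neumann problem
`-div (|∇u|^(p-2) ∇u) = F` in `B_R`, `∂_ν u = 0` on `∂B_R`, where `ν = x / R`.

The test functions are (the restrictions to the ball of) all smooth functions on `ℝ^N`; they are
not required to vanish on the boundary. For a `u` as in the first clause, `1 < p` and an `F` which
is continuous on the closed ball, both integrands are bounded and continuous on the ball. -/
structure IsNeumannSolution (N : ℕ) (p R : ℝ) (F u : EuclideanSpace ℝ (Fin N) → ℝ) : Prop where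
  contDiffOn : ContDiffOn ℝ 1 u (Metric.closedBall 0 R)
  weak : ∀ φ : EuclideanSpace ℝ (Fin N) → ℝ, ContDiff ℝ (⊤ : ℕ∞) φ →
    ∫ x in Metric.ball (0 : EuclideanSpace ℝ (Fin N)) R,
        inner ℝ (‖gradient u x‖ ^ (p - 2) • gradient u x) (gradient φ x) =
      ∫ x in Metric.ball (0 : EuclideanSpace ℝ (Fin N)) R, F x * φ x
  neumann : ∀ x ∈ Metric.sphere (0 : EuclideanSpace ℝ (Fin N)) R,
    fderivWithin ℝ u (Metric.closedBall 0 R) x (R⁻¹ • x) = 0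

/-- The radial function `x ↦ w |x|` on `ℝ^N` with profile `w`. -/
def radialFun (N : ℕ) (w : ℝ → ℝ) : EuclideanSpace ℝ (Fin N) → ℝ := fun x => w ‖x‖

/-- `w : [0, R] → ℝ` is the profile of a radial solution `u x = w |x|` of the problem
`-Δ_p u + u^(p-1) = g u` and `u > 0` in `B_R`, `∂_ν u = 0` on `∂B_R`
(values of `w` outside `[0, R]` are irrelevant). -/
structure IsRadialSolution (N : ℕ) (p R : ℝ) (g w : ℝ → ℝ) : Prop where
  pos : ∀ x ∈ Metric.ball (0 : EuclideanSpace ℝ (Fin N)) R, 0 < radialFun N w x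
  solves : IsNeumannSolution N p R
    (fun x => g (radialFun N w x) - radialFun N w x ^ (p - 1)) (radialFun N w)

/-- A radial solution which is not constant. -/
def IsNonconstantRadialSolution (N : ℕ) (p R : ℝ) (g w : ℝ → ℝ) : Prop :=
  IsRadialSolution N p R g w ∧ ∃ r ∈ Icc 0 R, ∃ s ∈ Icc 0 R, w r ≠ w s

/-- `w - 1`, as a function of the radius `r ∈ [0, R]`, has exactly `j` zeros. -/
def HasExactlyZeros (R : ℝ) (w : ℝ → ℝ) (j : ℕ) : Prop :=
  {r ∈ Icc 0 R | w r - 1 = 0}.encard = j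

/-- `μ` is a radial eigenvalue of the Neumann `p`-Laplacian in `B_R`: there is a radial function
`φ`, not identically zero in the ball, with `-Δ_p φ = μ |φ|^(p-2) φ` in `B_R` and `∂_ν φ = 0` on
`∂B_R`. -/
def IsRadialEigenvalue (N : ℕ) (p R μ : ℝ) : Prop :=
  ∃ w : ℝ → ℝ, (∃ x ∈ Metric.ball (0 : EuclideanSpace ℝ (Fin N)) R, radialFun N w x ≠ 0) ∧
    IsNeumannSolution N p R
      (fun x => μ * (|radialFun N w x| ^ (p - 2) * radialFun N w x)) (radialFun N w)

/-- The `k`-th radial eigenvalue (`k = 1, 2, …`), in increasing order, of the Neumann `p`-Laplacian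
in `B_R`: the least radial eigenvalue `μ` such that at least `k` radial eigenvalues are `≤ μ`. -/
def radialEigenvalue (N : ℕ) (p R : ℝ) (k : ℕ) : EReal :=
  sInf ((fun μ : ℝ => (μ : EReal)) '' {μ : ℝ | IsRadialEigenvalue N p R μ ∧
    (k : ℕ∞) ≤ {ν : ℝ | IsRadialEigenvalue N p R ν ∧ ν ≤ μ}.encard})

end

/-! Put N = n + 1, a = p - 1, u = 1 + w and f(s) = g(1 + s) - (1 + s)^a, continued by 0 to s ≤ -1.
On (-1, ∞) the function f has the sign of s. With φ(s) = |s|^(a-1) s, a radial solution is a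
solution of (r^n φ(w'))' + r^n f(w) = 0 whose flux v = r^n φ(w') vanishes at 0 and at R. The proof
shoots from w(0) = -α with 0 < α < 1.

The energy, a multiple of |v/r^n|^(1/a+1) plus F(w) with F' = f, does not increase along a solution.
Hence w ≥ -α, so u > 0; slopes are bounded uniformly in α; and w, v never vanish together. The
inverse of φ may fail to be Lipschitz at 0, but this only matters where v = 0, and there f(w) ≠ 0.
So each α has one global trajectory, and it depends continuously on α (`Restoring.unique`,
`Restoring.exists_trajectory`, `Restoring.exists_subseq_tendsto`).

Rotation is measured by zeros 0 = t_0 < ... < t_j of v (`CritChain`). Consecutive ones enclose a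
zero of w. If R is the earliest possible value of t_j, then no critical point has been skipped and w
has exactly j zeros on [0, R] (`Restoring.encard_zeros`). The condition t_j ≤ R is closed in α and
t_j < R is open. By connectedness there is a solution between a fast α, for which some t_j < R, and
a slow one, for which no chain has t_j ≤ R (`Restoring.exists_encard_zeros`).

Slow trajectories: since g(s)/s^a has a limit at 0, leaving -1 obeys a linear differential
inequality and takes arbitrarily long as α → 1. If C₁ = 0, trajectories with α → 0 are slow as well.

Fast trajectories: if C₁ > λ_{k+1}, Sturm comparison through Picone's identity with an eigenfunction
having at least k zeros makes every small trajectory fast. If C₁ = ∞, a direct estimate shows that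
small trajectories rotate arbitrarily often. If C₁ = 0, it suffices to find one α whose trajectory
has k critical points on the half line; any larger R then makes it fast, and it has slow
trajectories on both sides, whence two solutions for each j. For N ≤ p a small α works, because an
inward orbit would otherwise have a non-integrable slope. For N > p one starts so close to -1 that
the orbit is still near -1 when the friction n/r has become negligible, and then follows k half
turns with controlled loss of energy (`Restoring.exists_critChain`).

Polar coordinates translate between the weak problem and the ordinary differential equation in both
directions (`isNeumannSolution_of_radialSol`, `IsRadialEigenvalue.exists_radialEigen`). -/

/-- The signed power `sign s * |s| ^ a`. -/
noncomputable def spow (a s : ℝ) : ℝ := SignType.sign s * |s| ^ a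

/-! ### Odd powers and their inverses -/

section SignedPower

variable {a : ℝ}

lemma spow_of_pos {s : ℝ} (hs : 0 < s) : spow a s = s ^ a := by
  simp [spow, sign_pos hs, abs_of_pos hs]

@[simp] lemma spow_zero (a : ℝ) : spow a 0 = 0 := by simp [spow]

lemma spow_of_nonneg (ha : 0 < a) {s : ℝ} (hs : 0 ≤ s) : spow a s = s ^ a := by
  rcases hs.eq_or_lt with rfl | h
  · simp [Real.zero_rpow ha.ne']
  · exact spow_of_pos h

@[simp] lemma spow_neg (a s : ℝ) : spow a (-s) = -spow a s := by
  simp [spow, Left.sign_neg]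

lemma abs_spow (ha : 0 < a) (s : ℝ) : |spow a s| = |s| ^ a := by
  rcases lt_trichotomy s 0 with h | rfl | h
  · obtain ⟨t, rfl⟩ : ∃ t, s = -t := ⟨-s, by simp⟩
    have ht : 0 < t := by linarith
    rw [spow_neg, abs_neg, spow_of_pos ht, abs_neg, abs_of_pos ht,
      abs_of_pos (Real.rpow_pos_of_pos ht _)]
  · simp [Real.zero_rpow ha.ne']
  · rw [spow_of_pos h, abs_of_pos h, abs_of_pos (Real.rpow_pos_of_pos h _)]

lemma spow_pos {s : ℝ} (hs : 0 < s) : 0 < spow a s := by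
  rw [spow_of_pos hs]; exact Real.rpow_pos_of_pos hs _

lemma spow_neg_of_neg {s : ℝ} (hs : s < 0) : spow a s < 0 := by
  have := spow_pos (a := a) (neg_pos.2 hs)
  rw [spow_neg] at this; linarith

lemma spow_eq_zero_iff {s : ℝ} : spow a s = 0 ↔ s = 0 := by
  refine ⟨fun h => ?_, by rintro rfl; simp⟩
  rcases lt_trichotomy s 0 with h' | rfl | h'
  · exact absurd h (spow_neg_of_neg h').ne
  · rfl
  · exact absurd h (spow_pos h').ne'

lemma spow_mul (a s t : ℝ) : spow a (s * t) = spow a s * spow a t := by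
  simp only [spow, sign_mul, abs_mul, Real.mul_rpow (abs_nonneg s) (abs_nonneg t)]
  push_cast; ring

lemma spow_strictMono (ha : 0 < a) : StrictMono (spow a) := by
  intro s t hst
  rcases le_or_gt 0 s with hs | hs
  · rw [spow_of_nonneg ha hs, spow_of_pos (hs.trans_lt hst)]
    exact Real.rpow_lt_rpow hs hst ha
  · rcases le_or_gt t 0 with ht | ht
    · have : spow a (-t) < spow a (-s) := by
        rw [spow_of_nonneg ha (by linarith), spow_of_pos (by linarith)]
        exact Real.rpow_lt_rpow (by linarith) (by linarith) ha
      simpa using this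
    · exact (spow_neg_of_neg hs).trans (spow_pos ht)

lemma spow_mono (ha : 0 < a) : Monotone (spow a) := (spow_strictMono ha).monotone

lemma spow_inv_spow (ha : 0 < a) (s : ℝ) : spow a⁻¹ (spow a s) = s := by
  have key : ∀ t : ℝ, 0 < t → spow a⁻¹ (spow a t) = t := fun t ht => by
    rw [spow_of_pos ht, spow_of_pos (Real.rpow_pos_of_pos ht _), Real.rpow_rpow_inv ht.le ha.ne']
  rcases lt_trichotomy s 0 with h | rfl | h
  · have := key (-s) (by linarith)
    simpa using this
  · simp
  · exact key s h

lemma spow_spow_inv (ha : 0 < a) (s : ℝ) : spow a (spow a⁻¹ s) = s := by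
  simpa using spow_inv_spow (inv_pos.2 ha) s

lemma mul_spow_self (ha : 0 < a) (s : ℝ) : s * spow a s = |s| ^ (a + 1) := by
  have key : ∀ t : ℝ, 0 < t → t * spow a t = |t| ^ (a + 1) := fun t ht => by
    rw [spow_of_pos ht, abs_of_pos ht, Real.rpow_add_one ht.ne', mul_comm]
  rcases lt_trichotomy s 0 with h | rfl | h
  · have := key (-s) (by linarith)
    simpa using this
  · simp [Real.zero_rpow (by linarith : a + 1 ≠ 0)]
  · exact key s h

lemma abs_rpow_sub_one_mul (a s : ℝ) : |s| ^ (a - 1) * s = spow a s := by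
  have key : ∀ t : ℝ, 0 < t → |t| ^ (a - 1) * t = spow a t := fun t ht => by
    rw [spow_of_pos ht, abs_of_pos ht, Real.rpow_sub_one ht.ne', div_mul_cancel₀ _ ht.ne']
  rcases lt_trichotomy s 0 with h | rfl | h
  · have := key (-s) (by linarith)
    simpa using this
  · simp
  · exact key s h

lemma hasDerivAt_abs_rpow_add_one (ha : 0 < a) (s : ℝ) :
    HasDerivAt (fun x : ℝ => |x| ^ (a + 1)) ((a + 1) * spow a s) s := by
  convert hasDerivAt_abs_rpow s (p := a + 1) (by linarith) using 1
  rw [mul_assoc, ← abs_rpow_sub_one_mul]; ring_nf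

lemma continuous_spow (ha : 0 < a) : Continuous (spow a) := by
  have hs : Function.Surjective (spow a) := fun t => ⟨_, spow_spow_inv ha t⟩
  exact (spow_mono ha).continuous_of_surjective hs

/-- An odd power with exponent below 1 is not Lipschitz at 0; the two arguments are therefore kept
away from 0 and on the same side of it. -/
lemma exists_lipschitz_spow {c : ℝ} (hc : 0 < c) (C b : ℝ) :
    ∃ K : ℝ, 0 ≤ K ∧ ∀ x y : ℝ, c ≤ |x| → |x| ≤ C → c ≤ |y| → |y| ≤ C → 0 < x * y →
      |spow b x - spow b y| ≤ K * |x - y| := by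
  have hd : ContinuousOn (fun x : ℝ => b * x ^ (b - 1)) (Icc c C) := fun x hx =>
    ((Real.continuousAt_rpow_const _ _ (Or.inl (hc.trans_le hx.1).ne')).const_mul
      b).continuousWithinAt
  obtain ⟨K, hK⟩ := isCompact_Icc.exists_bound_of_continuousOn hd
  have hpos : ∀ x y : ℝ, c ≤ x → x ≤ C → c ≤ y → y ≤ C →
      |x ^ b - y ^ b| ≤ max K 0 * |x - y| := fun x y hx hx' hy hy' => by
    have := (convex_Icc c C).norm_image_sub_le_of_norm_hasDerivWithin_le
      (f := fun x : ℝ => x ^ b) (f' := fun x => b * x ^ (b - 1)) (C := max K 0)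
      (fun z hz => (Real.hasDerivAt_rpow_const (Or.inl (hc.trans_le hz.1).ne')).hasDerivWithinAt)
      (fun z hz => (hK z hz).trans (le_max_left _ _)) ⟨hy, hy'⟩ ⟨hx, hx'⟩
    simpa using this
  refine ⟨max K 0, le_max_right _ _, fun x y hx hx' hy hy' hxy => ?_⟩
  rcases pos_and_pos_or_neg_and_neg_of_mul_pos hxy with ⟨h1, h2⟩ | ⟨h1, h2⟩
  · rw [abs_of_pos h1] at hx hx'
    rw [abs_of_pos h2] at hy hy'
    rw [spow_of_pos h1, spow_of_pos h2]
    exact hpos x y hx hx' hy hy'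
  · rw [abs_of_neg h1] at hx hx'
    rw [abs_of_neg h2] at hy hy'
    have := hpos (-x) (-y) hx hx' hy hy'
    rw [← spow_of_pos (neg_pos.2 h1), ← spow_of_pos (neg_pos.2 h2), spow_neg, spow_neg] at this
    rw [abs_sub_comm, show spow b y - spow b x = -spow b x - -spow b y by ring, abs_sub_comm x,
      show y - x = -x - -y by ring]
    exact this

end SignedPower

/-! ### One-sided mean value inequalities -/

section MeanValue

variable {f f' : ℝ → ℝ} {a b C : ℝ}

lemma le_of_hasDerivAt_nonneg (hab : a ≤ b) (hf : ContinuousOn f (Icc a b))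
    (hd : ∀ x ∈ Ioo a b, HasDerivAt f (f' x) x) (h0 : ∀ x ∈ Ioo a b, 0 ≤ f' x) : f a ≤ f b := by
  rcases hab.eq_or_lt with rfl | hab
  · exact le_rfl
  obtain ⟨c, hc, h⟩ := exists_hasDerivAt_eq_slope f f' hab hf hd
  have := h0 c hc
  rw [h, div_nonneg_iff] at this
  rcases this with h | h <;> linarith

lemma lt_of_hasDerivAt_pos (hab : a < b) (hf : ContinuousOn f (Icc a b))
    (hd : ∀ x ∈ Ioo a b, HasDerivAt f (f' x) x) (h0 : ∀ x ∈ Ioo a b, 0 < f' x) : f a < f b := by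
  obtain ⟨c, hc, h⟩ := exists_hasDerivAt_eq_slope f f' hab hf hd
  have := h0 c hc
  rw [h, div_pos_iff] at this
  rcases this with h | h <;> linarith

lemma sub_le_of_hasDerivAt_le (hab : a ≤ b) (hf : ContinuousOn f (Icc a b))
    (hd : ∀ x ∈ Ioo a b, HasDerivAt f (f' x) x) (h0 : ∀ x ∈ Ioo a b, f' x ≤ C) :
    f b - f a ≤ C * (b - a) := by
  have := le_of_hasDerivAt_nonneg (f := fun x => C * x - f x) (f' := fun x => C * 1 - f' x) hab
    (by fun_prop) (fun x hx => ((hasDerivAt_id' x).const_mul C).sub (hd x hx))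
    (fun x hx => by linarith [h0 x hx])
  linarith

lemma le_sub_of_le_hasDerivAt (hab : a ≤ b) (hf : ContinuousOn f (Icc a b))
    (hd : ∀ x ∈ Ioo a b, HasDerivAt f (f' x) x) (h0 : ∀ x ∈ Ioo a b, C ≤ f' x) :
    C * (b - a) ≤ f b - f a := by
  have := sub_le_of_hasDerivAt_le (f := fun x => - f x) (f' := fun x => - f' x) (C := -C) hab
    hf.neg (fun x hx => (hd x hx).neg) (fun x hx => by linarith [h0 x hx])
  linarith

lemma abs_sub_le_of_abs_hasDerivAt_le (hab : a ≤ b) (hf : ContinuousOn f (Icc a b))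
    (hd : ∀ x ∈ Ioo a b, HasDerivAt f (f' x) x) (h0 : ∀ x ∈ Ioo a b, |f' x| ≤ C) :
    |f b - f a| ≤ C * (b - a) := by
  refine abs_le.2 ⟨?_, sub_le_of_hasDerivAt_le hab hf hd fun x hx => (abs_le.1 (h0 x hx)).2⟩
  have := le_sub_of_le_hasDerivAt (C := -C) hab hf hd fun x hx => (abs_le.1 (h0 x hx)).1
  linarith

end MeanValue

/-! ### The potential of the nonlinearity -/

/-- The primitive of `f` vanishing at the origin. -/
noncomputable def potential (f : ℝ → ℝ) (s : ℝ) : ℝ := ∫ t in (0 : ℝ)..s, f t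

section Potential

variable {f : ℝ → ℝ} {I : Set ℝ}

@[simp] lemma potential_zero (f : ℝ → ℝ) : potential f 0 = 0 := by simp [potential]

lemma hasDerivAt_potential (hf : Continuous f) (s : ℝ) : HasDerivAt (potential f) (f s) s :=
  hf.integral_hasStrictDerivAt 0 s |>.hasDerivAt

lemma continuous_potential (hf : Continuous f) : Continuous (potential f) :=
  continuous_iff_continuousAt.2 fun s => (hasDerivAt_potential hf s).continuousAt

lemma potential_neg (f : ℝ → ℝ) (s : ℝ) : potential (fun t => -f (-t)) (-s) = potential f s := by
  simp only [potential, intervalIntegral.integral_neg]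
  rw [intervalIntegral.integral_comp_neg, neg_zero, neg_neg, intervalIntegral.integral_symm,
    neg_neg]

lemma potential_lt_of_nonneg (hf : Continuous f) [I.OrdConnected] (h0 : (0 : ℝ) ∈ I)
    (hI : ∀ s ∈ I, s ≠ 0 → 0 < s * f s) {s t : ℝ} (hs : 0 ≤ s) (hst : s < t) (ht : t ∈ I) :
    potential f s < potential f t :=
  lt_of_hasDerivAt_pos hst (continuous_potential hf).continuousOn
    (fun x _ => hasDerivAt_potential hf x) fun x hx => by
      have hx0 : 0 < x := hs.trans_lt hx.1
      exact pos_of_mul_pos_right (hI x (OrdConnected.out ‹_› h0 ht ⟨hx0.le, hx.2.le⟩) hx0.ne') hx0.le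

lemma potential_lt_of_nonpos (hf : Continuous f) [I.OrdConnected] (h0 : (0 : ℝ) ∈ I)
    (hI : ∀ s ∈ I, s ≠ 0 → 0 < s * f s) {s t : ℝ} (hs : s ≤ 0) (hst : t < s) (ht : t ∈ I) :
    potential f s < potential f t := by
  have := lt_of_hasDerivAt_pos (f := fun x => - potential f x) (f' := fun x => - f x) hst
    (continuous_potential hf).neg.continuousOn
    (fun x _ => (hasDerivAt_potential hf x).neg) fun x hx => by
      have hx0 : x < 0 := hx.2.trans_le hs
      have := hI x (OrdConnected.out ‹_› ht h0 ⟨hx.1.le, hx0.le⟩) hx0.ne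
      nlinarith
  linarith

lemma potential_pos (hf : Continuous f) [I.OrdConnected] (h0 : (0 : ℝ) ∈ I)
    (hI : ∀ s ∈ I, s ≠ 0 → 0 < s * f s) {s : ℝ} (hs : s ∈ I) (hs0 : s ≠ 0) :
    0 < potential f s := by
  rcases hs0.lt_or_gt with h | h
  · simpa using potential_lt_of_nonpos hf h0 hI le_rfl h hs
  · simpa using potential_lt_of_nonneg hf h0 hI le_rfl h hs

end Potential

/-! ### The radial equation as a first-order system, and its energy -/

/-- The pair `(w, v)` solves `(r ^ n φ(w'))' + r ^ n f(w) = 0` on `[0, R]`, where `φ = spow a`,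
`v = r ^ n φ(w')` and `v 0 = 0`. -/
structure RadialSol (n : ℕ) (a : ℝ) (f : ℝ → ℝ) (R : ℝ) (w v : ℝ → ℝ) : Prop where
  cont_w : ContinuousOn w (Icc 0 R)
  cont_v : ContinuousOn v (Icc 0 R)
  v_zero : v 0 = 0
  deriv_w : ∀ r ∈ Ioo 0 R, HasDerivAt w (spow a⁻¹ (v r / r ^ n)) r
  deriv_v : ∀ r ∈ Ioo 0 R, HasDerivAt v (-(r ^ n * f (w r))) r

/-- The mechanical energy along a solution. -/
noncomputable def energy (n : ℕ) (a : ℝ) (f w v : ℝ → ℝ) (r : ℝ) : ℝ :=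
  (a⁻¹ + 1)⁻¹ * |v r / r ^ n| ^ (a⁻¹ + 1) + potential f (w r)

namespace RadialSol

variable {n : ℕ} {a R : ℝ} {f w v : ℝ → ℝ}

lemma mono (h : RadialSol n a f R w v) {R' : ℝ} (hR : R' ≤ R) : RadialSol n a f R' w v where
  cont_w := h.cont_w.mono (Icc_subset_Icc_right hR)
  cont_v := h.cont_v.mono (Icc_subset_Icc_right hR)
  v_zero := h.v_zero
  deriv_w r hr := h.deriv_w r ⟨hr.1, hr.2.trans_le hR⟩
  deriv_v r hr := h.deriv_v r ⟨hr.1, hr.2.trans_le hR⟩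

lemma neg (h : RadialSol n a f R w v) :
    RadialSol n a (fun s => -f (-s)) R (fun r => -w r) (fun r => -v r) where
  cont_w := h.cont_w.neg
  cont_v := h.cont_v.neg
  v_zero := by simp [h.v_zero]
  deriv_w r hr := by
    exact (h.deriv_w r hr).neg.congr_deriv (by rw [neg_div, spow_neg])
  deriv_v r hr := by
    exact (h.deriv_v r hr).neg.congr_deriv (by simp)

lemma congr_f (h : RadialSol n a f R w v) {g : ℝ → ℝ} (hg : ∀ r ∈ Icc 0 R, g (w r) = f (w r)) :
    RadialSol n a g R w v :=
  { h with deriv_v := fun r hr => by rw [hg r (Ioo_subset_Icc_self hr)]; exact h.deriv_v r hr }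

lemma abs_v_le (h : RadialSol n a f R w v) {K : ℝ} {r : ℝ} (hr : r ∈ Icc 0 R)
    (hK : ∀ t ∈ Ioo 0 r, |f (w t)| ≤ K) : |v r| ≤ K * r ^ (n + 1) := by
  have := abs_sub_le_of_abs_hasDerivAt_le (f := v) (C := r ^ n * K) hr.1
    (h.cont_v.mono (Icc_subset_Icc_right hr.2))
    (fun x hx => h.deriv_v x ⟨hx.1, hx.2.trans_le hr.2⟩) (fun x hx => by
      rw [abs_neg, abs_mul, abs_pow, abs_of_pos hx.1]
      have h1 := hK x hx
      have h2 := pow_le_pow_left₀ hx.1.le hx.2.le n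
      have h3 := abs_nonneg (f (w x))
      have h4 := pow_nonneg hx.1.le n
      exact mul_le_mul h2 h1 h3 (h4.trans h2))
  rw [h.v_zero, sub_zero, sub_zero] at this
  calc _ ≤ _ := this
    _ = _ := by ring

lemma abs_flux_le (h : RadialSol n a f R w v) {K : ℝ} {r : ℝ} (hr : r ∈ Icc 0 R)
    (hK : ∀ t ∈ Ioo 0 r, |f (w t)| ≤ K) : |v r / r ^ n| ≤ K * r := by
  rcases hr.1.eq_or_lt with rfl | h0
  · simp [h.v_zero]
  rw [abs_div, abs_pow, abs_of_pos h0, div_le_iff₀ (pow_pos h0 n)]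
  calc _ ≤ _ := h.abs_v_le hr hK
    _ = _ := by ring

lemma exists_bound (h : RadialSol n a f R w v) (hf : Continuous f) :
    ∃ K, 0 ≤ K ∧ ∀ r ∈ Icc 0 R, |f (w r)| ≤ K := by
  obtain ⟨K, hK⟩ := isCompact_Icc.exists_bound_of_continuousOn (hf.comp_continuousOn h.cont_w)
  exact ⟨max K 0, le_max_right _ _, fun r hr => (hK r hr).trans (le_max_left _ _)⟩

/-- At r = 0 the quotient has the value 0 because v 0 = 0. This is also its limit, by the bound |v /
r^n| ≤ K r. -/
lemma continuousOn_flux (h : RadialSol n a f R w v) (hf : Continuous f) :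
    ContinuousOn (fun r => v r / r ^ n) (Icc 0 R) := by
  intro r hr
  rcases hr.1.eq_or_lt with rfl | h0
  · obtain ⟨K, -, hK⟩ := h.exists_bound hf
    have h1 : Tendsto (fun r : ℝ => K * r) (𝓝[Icc 0 R] 0) (𝓝 0) := by
      have : Tendsto (fun r : ℝ => K * r) (𝓝 0) (𝓝 (K * 0)) := by
        exact (continuous_const.mul continuous_id).tendsto 0
      rw [mul_zero] at this
      exact this.mono_left nhdsWithin_le_nhds
    have h2 : Tendsto (fun r => v r / r ^ n) (𝓝[Icc 0 R] 0) (𝓝 0) :=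
      squeeze_zero_norm' (by
        filter_upwards [self_mem_nhdsWithin] with r hr
        exact h.abs_flux_le hr fun t ht => hK t ⟨ht.1.le, ht.2.le.trans hr.2⟩) h1
    simpa [ContinuousWithinAt, h.v_zero] using h2
  · exact (h.cont_v r hr).div (by fun_prop) (pow_pos h0 n).ne'

lemma hasDerivAt_flux (h : RadialSol n a f R w v) {r : ℝ} (hr : r ∈ Ioo 0 R) :
    HasDerivAt (fun r => v r / r ^ n) (-f (w r) - n * (v r / r ^ n) / r) r := by
  have hp := (pow_pos hr.1 n).ne'
  have h1 := (h.deriv_v r hr).div (hasDerivAt_pow n r) hp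
  refine h1.congr_deriv ?_
  have hr0 := hr.1.ne'
  rcases n with _ | m
  · simp
  · rw [Nat.add_sub_cancel]
    field_simp
    ring

/-- The terms containing f(w) cancel. What remains is the friction produced by the weight r^n, and
it has a sign. -/
lemma hasDerivAt_energy (h : RadialSol n a f R w v) (ha : 0 < a) (hf : Continuous f) {r : ℝ}
    (hr : r ∈ Ioo 0 R) :
    HasDerivAt (energy n a f w v) (-(n / r * |v r / r ^ n| ^ (a⁻¹ + 1))) r := by
  have hb : 0 < a⁻¹ := inv_pos.2 ha
  have h1 := ((hasDerivAt_abs_rpow_add_one hb (v r / r ^ n)).comp r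
    (h.hasDerivAt_flux hr)).const_mul (a⁻¹ + 1)⁻¹
  have h2 := (hasDerivAt_potential hf (w r)).comp r (h.deriv_w r hr)
  refine (h1.add h2).congr_deriv ?_
  rw [← mul_spow_self hb]
  have : a⁻¹ + 1 ≠ 0 := by positivity
  field_simp
  ring

lemma continuousOn_energy (h : RadialSol n a f R w v) (ha : 0 < a) (hf : Continuous f) :
    ContinuousOn (energy n a f w v) (Icc 0 R) := by
  have hb : 0 < a⁻¹ + 1 := by positivity
  exact (continuousOn_const.mul ((h.continuousOn_flux hf).abs.rpow_const fun _ _ =>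
    Or.inr hb.le)).add ((continuous_potential hf).comp_continuousOn h.cont_w)

lemma energy_zero (h : RadialSol n a f R w v) (ha : 0 < a) :
    energy n a f w v 0 = potential f (w 0) := by
  have hb : a⁻¹ + 1 ≠ 0 := by positivity
  simp [energy, h.v_zero, Real.zero_rpow hb]

lemma energy_anti (h : RadialSol n a f R w v) (ha : 0 < a) (hf : Continuous f) {r s : ℝ}
    (hr : 0 ≤ r) (hrs : r ≤ s) (hs : s ≤ R) : energy n a f w v s ≤ energy n a f w v r := by
  have := le_of_hasDerivAt_nonneg (f := fun x => - energy n a f w v x) hrs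
    ((h.continuousOn_energy ha hf).mono (Icc_subset_Icc hr hs)).neg
    (fun x hx => (h.hasDerivAt_energy ha hf ⟨hr.trans_lt hx.1, hx.2.trans_le hs⟩).neg)
    (fun x hx => by
      have := hr.trans_lt hx.1
      rw [neg_neg]; positivity)
  linarith

lemma potential_le_energy (ha : 0 < a) (r : ℝ) : potential f (w r) ≤ energy n a f w v r := by
  have : 0 ≤ (a⁻¹ + 1)⁻¹ * |v r / r ^ n| ^ (a⁻¹ + 1) := by positivity
  unfold energy; linarith

lemma potential_le_potential_zero (h : RadialSol n a f R w v) (ha : 0 < a) (hf : Continuous f)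
    {r : ℝ} (hr : r ∈ Icc 0 R) : potential f (w r) ≤ potential f (w 0) := by
  rw [← h.energy_zero ha]
  exact (potential_le_energy ha r).trans (h.energy_anti ha hf le_rfl hr.1 hr.2)

/-- If both vanish at r, the energy E is zero there. Friction removes energy at a rate of at most n
(a⁻¹ + 1) E / r, so r^m E is nondecreasing once m ≥ n (a⁻¹ + 1). Zero energy then spreads backwards
to the origin, against w 0 ≠ 0. No Lipschitz condition on f is needed. -/
lemma w_ne_zero_or_v_ne_zero (h : RadialSol n a f R w v) (ha : 0 < a) (hf : Continuous f)
    {I : Set ℝ} [I.OrdConnected] (h0 : (0 : ℝ) ∈ I) (hI : ∀ s ∈ I, s ≠ 0 → 0 < s * f s)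
    (hw : ∀ r ∈ Icc 0 R, w r ∈ I) (hw0 : w 0 ≠ 0) {r : ℝ} (hr : r ∈ Ioc 0 R) (hwr : w r = 0) :
    v r ≠ 0 := by
  intro hvr
  have hb : a⁻¹ + 1 ≠ 0 := by positivity
  have hE : energy n a f w v r = 0 := by simp [energy, hwr, hvr, Real.zero_rpow hb]
  obtain ⟨m, hm⟩ := exists_nat_ge (n * (a⁻¹ + 1))
  have hF : ∀ t ∈ Icc 0 R, 0 ≤ potential f (w t) := fun t ht => by
    rcases eq_or_ne (w t) 0 with h' | h'
    · simp [h']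
    · exact (potential_pos hf h0 hI (hw t ht) h').le
  have key : ∀ s ∈ Ioc 0 r, w s = 0 := by
    intro s hs
    have h1 := le_of_hasDerivAt_nonneg (f := fun x => x ^ m * energy n a f w v x) hs.2
      ((continuous_pow m).continuousOn.mul ((h.continuousOn_energy ha hf).mono
        (Icc_subset_Icc hs.1.le hr.2)))
      (fun x hx => (hasDerivAt_pow m x).mul
        (h.hasDerivAt_energy ha hf ⟨hs.1.trans hx.1, hx.2.trans_le hr.2⟩))
      (fun x hx => by
        have hx0 := hs.1.trans hx.1
        have hA : 0 ≤ |v x / x ^ n| ^ (a⁻¹ + 1) := by positivity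
        have hE : (a⁻¹ + 1)⁻¹ * |v x / x ^ n| ^ (a⁻¹ + 1) ≤ energy n a f w v x := by
          have := hF x ⟨hx0.le, hx.2.le.trans hr.2⟩
          unfold energy; linarith
        have e1 : (m : ℝ) * x ^ (m - 1) = m * x ^ m / x := by
          rcases m with _ | k
          · simp
          · rw [Nat.add_sub_cancel, pow_succ]; field_simp
        have e2 : n * |v x / x ^ n| ^ (a⁻¹ + 1) ≤ m * energy n a f w v x := by
          calc _ = n * (a⁻¹ + 1) * ((a⁻¹ + 1)⁻¹ * |v x / x ^ n| ^ (a⁻¹ + 1)) := by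
                field_simp
            _ ≤ m * energy n a f w v x := by gcongr
        have e3 : 0 ≤ x ^ m / x := by positivity
        have e4 : ↑m * x ^ (m - 1) * energy n a f w v x +
            x ^ m * -(↑n / x * |v x / x ^ n| ^ (a⁻¹ + 1)) =
            x ^ m / x * (m * energy n a f w v x - n * |v x / x ^ n| ^ (a⁻¹ + 1)) := by
          rw [e1]; ring
        rw [e4]
        exact mul_nonneg e3 (by linarith))
    simp only [hE, mul_zero] at h1
    have h2 : energy n a f w v s ≤ 0 := nonpos_of_mul_nonpos_right h1 (pow_pos hs.1 m)
    by_contra hne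
    have h3 := potential_pos hf h0 hI (hw s ⟨hs.1.le, hs.2.trans hr.2⟩) hne
    have := potential_le_energy (n := n) (f := f) (w := w) (v := v) ha s
    linarith
  refine hw0 ?_
  have hc : ContinuousWithinAt w (Ioc 0 r) 0 :=
    (h.cont_w 0 ⟨le_rfl, hr.1.le.trans hr.2⟩).mono fun x hx => ⟨hx.1.le, hx.2.trans hr.2⟩
  have : (𝓝[Ioc 0 r] (0 : ℝ)).NeBot := by
    rw [nhdsWithin_Ioc_eq_nhdsGT hr.1]; infer_instance
  exact tendsto_nhds_unique hc (tendsto_const_nhds.congr' (by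
    filter_upwards [self_mem_nhdsWithin] with s hs using (key s hs).symm))

lemma exists_v_eq_zero (h : RadialSol n a f R w v) {s t : ℝ} (hs : 0 ≤ s) (hst : s < t)
    (ht : t ≤ R) (hw : w s = w t) : ∃ c ∈ Ioo s t, v c = 0 := by
  obtain ⟨c, hc, hc'⟩ := exists_hasDerivAt_eq_zero hst (h.cont_w.mono (Icc_subset_Icc hs ht)) hw
    fun x hx => h.deriv_w x ⟨hs.trans_lt hx.1, hx.2.trans_le ht⟩
  refine ⟨c, hc, ?_⟩
  rw [spow_eq_zero_iff, div_eq_zero_iff] at hc'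
  exact hc'.resolve_right (pow_pos (hs.trans_lt hc.1) n).ne'

lemma exists_f_eq_zero (h : RadialSol n a f R w v) {s t : ℝ} (hs : 0 ≤ s) (hst : s < t)
    (ht : t ≤ R) (hv : v s = v t) : ∃ c ∈ Ioo s t, f (w c) = 0 := by
  obtain ⟨c, hc, hc'⟩ := exists_hasDerivAt_eq_zero hst (h.cont_v.mono (Icc_subset_Icc hs ht)) hv
    fun x hx => h.deriv_v x ⟨hs.trans_lt hx.1, hx.2.trans_le ht⟩
  refine ⟨c, hc, ?_⟩
  rw [neg_eq_zero, mul_eq_zero] at hc'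
  exact hc'.resolve_left (pow_pos (hs.trans_lt hc.1) n).ne'

end RadialSol

/-! ### Uniqueness for the initial value problem -/

namespace RadialSol

variable {n : ℕ} {a R : ℝ} {f w v w₁ v₁ w₂ v₂ : ℝ → ℝ}

lemma mul_pow_sub_le_v_sub (h : RadialSol n a f R w v) {r s c : ℝ} (hr : 0 ≤ r) (hrs : r ≤ s)
    (hs : s ≤ R) (hc : ∀ t ∈ Ioo r s, c ≤ -f (w t)) :
    c * ((s ^ (n + 1) - r ^ (n + 1)) / (n + 1)) ≤ v s - v r := by
  have := le_of_hasDerivAt_nonneg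
    (f := fun x => v x - c * (x ^ (n + 1) / (n + 1))) hrs
    ((h.cont_v.mono (Icc_subset_Icc hr hs)).sub (by fun_prop))
    (fun x hx => (h.deriv_v x ⟨hr.trans_lt hx.1, hx.2.trans_le hs⟩).sub
      (((hasDerivAt_pow (n + 1) x).div_const _).const_mul c))
    (fun x hx => by
      have h1 : 0 ≤ x ^ n := pow_nonneg (hr.trans hx.1.le) n
      have h2 : (((n + 1 : ℕ) : ℝ) * x ^ (n + 1 - 1)) / ((n : ℝ) + 1) = x ^ n := by
        rw [Nat.add_sub_cancel]; push_cast; field_simp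
      rw [h2]
      nlinarith [hc x hx, mul_le_mul_of_nonneg_left (hc x hx) h1])
  have e : c * ((s ^ (n + 1) - r ^ (n + 1)) / (n + 1)) =
    c * (s ^ (n + 1) / (n + 1)) - c * (r ^ (n + 1) / (n + 1)) := by ring
  rw [e]; linarith

lemma v_sub_le_mul_pow_sub (h : RadialSol n a f R w v) {r s c : ℝ} (hr : 0 ≤ r) (hrs : r ≤ s)
    (hs : s ≤ R) (hc : ∀ t ∈ Ioo r s, -f (w t) ≤ c) :
    v s - v r ≤ c * ((s ^ (n + 1) - r ^ (n + 1)) / (n + 1)) := by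
  have := h.neg.mul_pow_sub_le_v_sub (c := -c) hr hrs hs
    (fun t ht => by have := hc t ht; simp only [neg_neg]; linarith)
  linarith

lemma abs_v_sub_v_le (h₁ : RadialSol n a f R w₁ v₁) (h₂ : RadialSol n a f R w₂ v₂) {r s K : ℝ}
    (hr : 0 ≤ r) (hrs : r ≤ s) (hs : s ≤ R) (hv : v₁ r = v₂ r)
    (hK : ∀ t ∈ Ioo r s, |f (w₁ t) - f (w₂ t)| ≤ K) :
    |v₁ s - v₂ s| ≤ K * ((s ^ (n + 1) - r ^ (n + 1)) / (n + 1)) := by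
  have key : ∀ {w₁ v₁ w₂ v₂ : ℝ → ℝ}, RadialSol n a f R w₁ v₁ → RadialSol n a f R w₂ v₂ →
      v₁ r = v₂ r → (∀ t ∈ Ioo r s, |f (w₁ t) - f (w₂ t)| ≤ K) →
      v₁ s - v₂ s ≤ K * ((s ^ (n + 1) - r ^ (n + 1)) / (n + 1)) := by
    intro w₁ v₁ w₂ v₂ h₁ h₂ hv hK
    have := le_of_hasDerivAt_nonneg
      (f := fun x => K * (x ^ (n + 1) / (n + 1)) - (v₁ x - v₂ x)) hrs
      (ContinuousOn.sub (by fun_prop) ((h₁.cont_v.mono (Icc_subset_Icc hr hs)).sub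
        (h₂.cont_v.mono (Icc_subset_Icc hr hs))))
      (fun x hx => (((hasDerivAt_pow (n + 1) x).div_const _).const_mul K).sub
        ((h₁.deriv_v x ⟨hr.trans_lt hx.1, hx.2.trans_le hs⟩).sub
          (h₂.deriv_v x ⟨hr.trans_lt hx.1, hx.2.trans_le hs⟩)))
      (fun x hx => by
        have h1 : 0 ≤ x ^ n := pow_nonneg (hr.trans hx.1.le) n
        have h2 : (((n + 1 : ℕ) : ℝ) * x ^ (n + 1 - 1)) / ((n : ℝ) + 1) = x ^ n := by
          rw [Nat.add_sub_cancel]; push_cast; field_simp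
        rw [h2]
        have h3 := (abs_le.1 (hK x hx)).1
        nlinarith [mul_le_mul_of_nonneg_left h3 h1])
    have e : K * ((s ^ (n + 1) - r ^ (n + 1)) / (n + 1)) =
      K * (s ^ (n + 1) / (n + 1)) - K * (r ^ (n + 1) / (n + 1)) := by ring
    rw [e]
    have hv' : v₁ r - v₂ r = 0 := by linarith
    linarith
  refine abs_le.2 ⟨?_, key h₁ h₂ hv hK⟩
  have := key h₂ h₁ hv.symm fun t ht => by rw [abs_sub_comm]; exact hK t ht
  linarith

lemma pow_succ_sub_div_le {r s : ℝ} (hr : 0 ≤ r) (hrs : r ≤ s) (n : ℕ) :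
    (s ^ (n + 1) - r ^ (n + 1)) / (n + 1) ≤ s ^ n * (s - r) := by
  have := sub_le_of_hasDerivAt_le (f := fun x : ℝ => x ^ (n + 1) / (n + 1)) (C := s ^ n) hrs
    (by fun_prop) (fun x hx => (hasDerivAt_pow (n + 1) x).div_const _) (fun x hx => by
      rw [Nat.add_sub_cancel]; push_cast
      rw [mul_div_assoc, mul_div_left_comm, div_self (by positivity), mul_one]
      exact pow_le_pow_left₀ (hr.trans hx.1.le) hx.2.le n)
  rw [sub_div]; exact this

lemma exists_nhds_Icc {P : ℝ → Prop} {r₀ R : ℝ} (h : r₀ < R)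
    (hP : ∀ᶠ r in 𝓝[≥] r₀, P r) :
    ∃ δ > 0, r₀ + δ ≤ R ∧ ∀ r ∈ Icc r₀ (r₀ + δ), P r := by
  obtain ⟨u, hu, hu'⟩ := mem_nhdsGE_iff_exists_Icc_subset.1 hP
  have hu0 : r₀ < u := hu
  refine ⟨min (u - r₀) (R - r₀), lt_min (by linarith) (by linarith), ?_, fun r hr => hu' ?_⟩
  · linarith [min_le_right (u - r₀) (R - r₀)]
  · exact ⟨hr.1, by linarith [hr.2, min_le_left (u - r₀) (R - r₀)]⟩

lemma nhdsGE_le_nhdsWithin_Icc {r₀ R : ℝ} (h0 : 0 ≤ r₀) (h : r₀ < R) :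
    𝓝[≥] r₀ ≤ 𝓝[Icc 0 R] r₀ := by
  rw [← nhdsWithin_Icc_eq_nhdsGE h]
  exact nhdsWithin_mono _ (Icc_subset_Icc_left h0)

/-- Near a point with nonzero flux z both fluxes have the sign of z and size between |z|/2 and 2|z|,
where the inverse power is Lipschitz. The difference of the slopes is thus linear in the uniform
distance E of the profiles, with B independent of the length δ'. -/
lemma exists_deriv_bound_of_v_ne_zero (h₁ : RadialSol n a f R w₁ v₁)
    (h₂ : RadialSol n a f R w₂ v₂) {L : ℝ} (hL : 0 ≤ L)
    (hf : ∀ r ∈ Icc 0 R, |f (w₁ r) - f (w₂ r)| ≤ L * |w₁ r - w₂ r|)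
    {r₀ : ℝ} (hr₀ : 0 ≤ r₀) (hr₀R : r₀ < R) (hv : v₁ r₀ = v₂ r₀) (hv0 : v₁ r₀ ≠ 0) :
    ∃ δ > 0, ∃ B ≥ 0, r₀ + δ ≤ R ∧ ∀ E ≥ 0, ∀ δ' ≤ δ,
      (∀ t ∈ Icc r₀ (r₀ + δ'), |w₁ t - w₂ t| ≤ E) → ∀ r ∈ Ioo r₀ (r₀ + δ'),
        |spow a⁻¹ (v₁ r / r ^ n) - spow a⁻¹ (v₂ r / r ^ n)| ≤ B * E := by
  have hpos : 0 < r₀ := hr₀.lt_of_ne (by rintro rfl; exact hv0 h₁.v_zero)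
  set z := v₁ r₀ / r₀ ^ n with hz
  have hz0 : z ≠ 0 := div_ne_zero hv0 (pow_pos hpos n).ne'
  have hev : ∀ {w v : ℝ → ℝ}, RadialSol n a f R w v → v r₀ = v₁ r₀ → ∀ᶠ r in 𝓝[≥] r₀,
      |z| / 2 ≤ |v r / r ^ n| ∧ |v r / r ^ n| ≤ 2 * |z| ∧ 0 < z * (v r / r ^ n) := by
    intro w v h hvr
    have hc : Tendsto (fun r => v r / r ^ n) (𝓝[≥] r₀) (𝓝 z) := by
      have : ContinuousWithinAt (fun r => v r / r ^ n) (Icc 0 R) r₀ :=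
        (h.cont_v r₀ ⟨hr₀, hr₀R.le⟩).div (by fun_prop) (pow_pos hpos n).ne'
      have h' := this.mono_left (nhdsGE_le_nhdsWithin_Icc hr₀ hr₀R)
      simpa [hvr, hz] using h'
    have hzp := abs_pos.2 hz0
    have := hc.abs
    filter_upwards [this.eventually (eventually_ge_nhds (by linarith : |z| / 2 < |z|)),
      this.eventually (eventually_le_nhds (by linarith : |z| < 2 * |z|)),
      (hc.const_mul z).eventually (eventually_gt_nhds (mul_self_pos.2 hz0))] with r h1 h2 h3
    exact ⟨h1, h2, h3⟩
  obtain ⟨δ, hδ, hδR, hP⟩ := exists_nhds_Icc hr₀R ((hev h₁ rfl).and (hev h₂ hv.symm))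
  obtain ⟨K, hK0, hK⟩ := exists_lipschitz_spow (by positivity : 0 < |z| / 2) (2 * |z|) a⁻¹
  refine ⟨δ, hδ, K * (L * R ), by have := hr₀.trans hr₀R.le; positivity, hδR,
    fun E hE δ' hδ' hw r hr => ?_⟩
  have hrδ : r ∈ Icc r₀ (r₀ + δ) := ⟨hr.1.le, by linarith [hr.2]⟩
  obtain ⟨⟨p1, p2, p3⟩, q1, q2, q3⟩ := hP r hrδ
  have hrpos : 0 < r := hpos.trans hr.1
  have hsign : 0 < v₁ r / r ^ n * (v₂ r / r ^ n) := by
    have := mul_pos p3 q3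
    have hz2 : 0 < z * z := mul_self_pos.2 hz0
    refine pos_of_mul_pos_right (a := z * z) ?_ hz2.le
    nlinarith
  refine (hK _ _ p1 p2 q1 q2 hsign).trans ?_
  rw [mul_assoc]
  refine mul_le_mul_of_nonneg_left ?_ hK0
  have h3 := h₁.abs_v_sub_v_le h₂ (K := L * E) hr₀ hr.1.le (by linarith [hr.2]) hv fun t ht => by
    refine (hf t ⟨(hr₀.trans_lt ht.1).le, by linarith [hr.2, ht.2]⟩).trans ?_
    exact mul_le_mul_of_nonneg_left (hw t ⟨ht.1.le, by linarith [hr.2, ht.2]⟩) hL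
  rw [← sub_div, abs_div, abs_pow, abs_of_pos hrpos, div_le_iff₀ (pow_pos hrpos n)]
  have h4 := pow_succ_sub_div_le hr₀ hr.1.le n
  have hLE : 0 ≤ L * E := mul_nonneg hL hE
  calc |v₁ r - v₂ r| ≤ _ := h3
    _ ≤ L * E * (r ^ n * (r - r₀)) := mul_le_mul_of_nonneg_left h4 hLE
    _ ≤ L * E * (r ^ n * R) := by
      refine mul_le_mul_of_nonneg_left (mul_le_mul_of_nonneg_left ?_ (pow_pos hrpos n).le) hLE
      linarith [hr.2]
    _ = _ := by ring

/-- The degenerate case: the flux vanishes at r₀, and the inverse power may be non-Lipschitz there.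
Since f ≠ 0, both v grow like the integral ω of t^n over [r₀, r], and the quotients v / ω stay in a
compact subset of (0, ∞). By homogeneity the bad factor ω / r^n separates. -/
lemma exists_deriv_bound_of_neg (ha : 0 < a) (hfc : Continuous f) (h₁ : RadialSol n a f R w₁ v₁)
    (h₂ : RadialSol n a f R w₂ v₂) {L : ℝ} (hL : 0 ≤ L)
    (hf : ∀ r ∈ Icc 0 R, |f (w₁ r) - f (w₂ r)| ≤ L * |w₁ r - w₂ r|)
    {r₀ : ℝ} (hr₀ : 0 ≤ r₀) (hr₀R : r₀ < R) (hw : w₁ r₀ = w₂ r₀) (hv : v₁ r₀ = v₂ r₀)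
    (hv0 : v₁ r₀ = 0) (hf0 : f (w₁ r₀) < 0) :
    ∃ δ > 0, ∃ B ≥ 0, r₀ + δ ≤ R ∧ ∀ E ≥ 0, ∀ δ' ≤ δ,
      (∀ t ∈ Icc r₀ (r₀ + δ'), |w₁ t - w₂ t| ≤ E) → ∀ r ∈ Ioo r₀ (r₀ + δ'),
        |spow a⁻¹ (v₁ r / r ^ n) - spow a⁻¹ (v₂ r / r ^ n)| ≤ B * E := by
  set y := -f (w₁ r₀) with hy
  have hy0 : 0 < y := by linarith
  have hev : ∀ {w v : ℝ → ℝ}, RadialSol n a f R w v → w r₀ = w₁ r₀ → ∀ᶠ r in 𝓝[≥] r₀,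
      y / 2 ≤ -f (w r) ∧ -f (w r) ≤ 2 * y := by
    intro w v h hwr
    have hc : Tendsto (fun r => -f (w r)) (𝓝[≥] r₀) (𝓝 y) := by
      have : ContinuousWithinAt (fun r => -f (w r)) (Icc 0 R) r₀ :=
        ((hfc.continuousAt.comp_continuousWithinAt (h.cont_w r₀ ⟨hr₀, hr₀R.le⟩))).neg
      have h' := this.mono_left (nhdsGE_le_nhdsWithin_Icc hr₀ hr₀R)
      simpa [hwr, hy] using h'
    filter_upwards [hc.eventually (eventually_ge_nhds (by linarith : y / 2 < y)),
      hc.eventually (eventually_le_nhds (by linarith : y < 2 * y))] with r h1 h2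
    exact ⟨h1, h2⟩
  obtain ⟨δ, hδ, hδR, hP⟩ := exists_nhds_Icc hr₀R ((hev h₁ rfl).and (hev h₂ hw.symm))
  obtain ⟨K, hK0, hK⟩ := exists_lipschitz_spow (by positivity : 0 < y / 2) (2 * y) a⁻¹
  refine ⟨δ, hδ, spow a⁻¹ R * (K * L), ?_, hδR, fun E hE δ' hδ' hw r hr => ?_⟩
  · have := spow_pos (a := a⁻¹) (hr₀.trans_lt hr₀R)
    positivity
  have hrpos : 0 < r := hr₀.trans_lt hr.1
  have hrn := pow_pos hrpos n
  set ω := (r ^ (n + 1) - r₀ ^ (n + 1)) / ((n : ℝ) + 1) with hω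
  have hω0 : 0 < ω := by
    have := pow_lt_pow_left₀ hr.1 hr₀ (Nat.succ_ne_zero n)
    exact div_pos (sub_pos.2 this) (by positivity)
  have hmem : ∀ t ∈ Ioo r₀ r, t ∈ Icc r₀ (r₀ + δ) := fun t ht =>
    ⟨ht.1.le, by linarith [hr.2, ht.2]⟩
  have hrR : r ≤ R := by linarith [hr.2]
  have bd : ∀ {v : ℝ → ℝ}, v r₀ = 0 → y / 2 * ω ≤ v r - v r₀ → v r - v r₀ ≤ 2 * y * ω →
      0 < v r / ω ∧ y / 2 ≤ |v r / ω| ∧ |v r / ω| ≤ 2 * y := by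
    intro v hv0 h1 h2
    rw [hv0, sub_zero] at h1 h2
    have hp : 0 < v r / ω := div_pos (lt_of_lt_of_le (by positivity) h1) hω0
    rw [abs_of_pos hp]
    exact ⟨hp, (le_div_iff₀ hω0).2 h1, (div_le_iff₀ hω0).2 h2⟩
  obtain ⟨p0, p1, p2⟩ := bd hv0
    (h₁.mul_pow_sub_le_v_sub hr₀ hr.1.le hrR fun t ht => (hP t (hmem t ht)).1.1)
    (h₁.v_sub_le_mul_pow_sub hr₀ hr.1.le hrR fun t ht => (hP t (hmem t ht)).1.2)
  obtain ⟨q0, q1, q2⟩ := bd (hv ▸ hv0)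
    (h₂.mul_pow_sub_le_v_sub hr₀ hr.1.le hrR fun t ht => (hP t (hmem t ht)).2.1)
    (h₂.v_sub_le_mul_pow_sub hr₀ hr.1.le hrR fun t ht => (hP t (hmem t ht)).2.2)
  have e : ∀ x : ℝ, x / r ^ n = ω / r ^ n * (x / ω) := fun x => by field_simp
  rw [e (v₁ r), e (v₂ r), spow_mul, spow_mul, ← mul_sub, abs_mul]
  have hωR : ω / r ^ n ≤ R := by
    rw [div_le_iff₀ hrn]
    refine (pow_succ_sub_div_le hr₀ hr.1.le n).trans ?_
    rw [mul_comm]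
    exact mul_le_mul_of_nonneg_right (by linarith) hrn.le
  rw [abs_of_pos (spow_pos (div_pos hω0 hrn)), mul_assoc]
  refine mul_le_mul (spow_mono (inv_pos.2 ha) hωR) ?_ (abs_nonneg _)
    (spow_pos (hr₀.trans_lt hr₀R)).le
  refine (hK _ _ p1 p2 q1 q2 (mul_pos p0 q0)).trans ?_
  rw [mul_assoc]
  refine mul_le_mul_of_nonneg_left ?_ hK0
  rw [← sub_div, abs_div, abs_of_pos hω0, div_le_iff₀ hω0]
  refine h₁.abs_v_sub_v_le h₂ (K := L * E) hr₀ hr.1.le hrR hv fun t ht => ?_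
  refine (hf t ⟨(hr₀.trans_lt ht.1).le, by linarith [hr.2, ht.2]⟩).trans ?_
  exact mul_le_mul_of_nonneg_left (hw t ⟨ht.1.le, by linarith [hr.2, ht.2]⟩) hL

lemma exists_eqOn_Icc (ha : 0 < a) (hfc : Continuous f) (h₁ : RadialSol n a f R w₁ v₁)
    (h₂ : RadialSol n a f R w₂ v₂) {L : ℝ} (hL : 0 ≤ L)
    (hf : ∀ r ∈ Icc 0 R, |f (w₁ r) - f (w₂ r)| ≤ L * |w₁ r - w₂ r|)
    {r₀ : ℝ} (hr₀ : 0 ≤ r₀) (hr₀R : r₀ < R) (hw : w₁ r₀ = w₂ r₀) (hv : v₁ r₀ = v₂ r₀)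
    (hnd : v₁ r₀ = 0 → f (w₁ r₀) ≠ 0) :
    ∃ δ > 0, r₀ + δ ≤ R ∧ ∀ t ∈ Icc r₀ (r₀ + δ), w₁ t = w₂ t := by
  obtain ⟨δ, hδ, B, hB, hδR, H⟩ : ∃ δ > 0, ∃ B ≥ 0, r₀ + δ ≤ R ∧ ∀ E ≥ 0, ∀ δ' ≤ δ,
      (∀ t ∈ Icc r₀ (r₀ + δ'), |w₁ t - w₂ t| ≤ E) → ∀ r ∈ Ioo r₀ (r₀ + δ'),
        |spow a⁻¹ (v₁ r / r ^ n) - spow a⁻¹ (v₂ r / r ^ n)| ≤ B * E := by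
    rcases eq_or_ne (v₁ r₀) 0 with hv0 | hv0
    · rcases (hnd hv0).lt_or_gt with hneg | hpos
      · exact h₁.exists_deriv_bound_of_neg ha hfc h₂ hL hf hr₀ hr₀R hw hv hv0 hneg
      · obtain ⟨δ, hδ, B, hB, hδR, H⟩ := exists_deriv_bound_of_neg ha (f := fun s => -f (-s))
          (by fun_prop) h₁.neg h₂.neg hL
          (fun r hr => by
            have e1 : -f (- -w₁ r) - -f (- -w₂ r) = -(f (w₁ r) - f (w₂ r)) := by
              rw [neg_neg, neg_neg]; ring
            have e2 : -w₁ r - -w₂ r = -(w₁ r - w₂ r) := by ring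
            rw [e1, e2, abs_neg, abs_neg]; exact hf r hr)
          hr₀ hr₀R (by simp [hw]) (by simp [hv]) (by simp [hv0]) (by simpa using hpos)
        refine ⟨δ, hδ, B, hB, hδR, fun E hE δ' hδ' hw r hr => ?_⟩
        have := H E hE δ' hδ' (fun t ht => by
          have e2 : -w₁ t - -w₂ t = -(w₁ t - w₂ t) := by ring
          rw [e2, abs_neg]; exact hw t ht) r hr
        rw [neg_div, neg_div, spow_neg, spow_neg, ← abs_neg] at this
        convert this using 2; ring
    · exact h₁.exists_deriv_bound_of_v_ne_zero h₂ hL hf hr₀ hr₀R hv hv0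
  -- With B δ' ≤ 1/2, integrating the slope bound shows that the maximum of |w₁ - w₂| is at most
  -- half of itself.
  set δ' := min δ (2 * (B + 1))⁻¹ with hδ'
  have hδ'0 : 0 < δ' := lt_min hδ (by positivity)
  have hδ'1 : δ' ≤ δ := min_le_left _ _
  have hδ'2 : B * δ' ≤ 1 / 2 := by
    have : B * δ' ≤ B * (2 * (B + 1))⁻¹ := mul_le_mul_of_nonneg_left (min_le_right _ _) hB
    refine this.trans ?_
    rw [← div_eq_mul_inv, div_le_iff₀ (by positivity)]; linarith
  have hsub : Icc r₀ (r₀ + δ') ⊆ Icc 0 R := Icc_subset_Icc hr₀ (by linarith)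
  have hcont : ContinuousOn (fun t => |w₁ t - w₂ t|) (Icc r₀ (r₀ + δ')) :=
    ((h₁.cont_w.mono hsub).sub (h₂.cont_w.mono hsub)).abs
  obtain ⟨s, hs, hmax⟩ := isCompact_Icc.exists_isMaxOn ⟨r₀, le_rfl, by linarith⟩ hcont
  have hmax' : ∀ t ∈ Icc r₀ (r₀ + δ'), |w₁ t - w₂ t| ≤ |w₁ s - w₂ s| := fun t ht => hmax ht
  refine ⟨δ', hδ'0, by linarith, fun t ht => ?_⟩
  have h3 := abs_sub_le_of_abs_hasDerivAt_le (f := fun t => w₁ t - w₂ t)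
    (C := B * |w₁ s - w₂ s|) hs.1
    (((h₁.cont_w.mono hsub).sub (h₂.cont_w.mono hsub)).mono (Icc_subset_Icc_right hs.2))
    (fun x hx => (h₁.deriv_w x ⟨hr₀.trans_lt hx.1, by linarith [hx.2, hs.2]⟩).sub
      (h₂.deriv_w x ⟨hr₀.trans_lt hx.1, by linarith [hx.2, hs.2]⟩))
    (fun x hx => H _ (abs_nonneg _) δ' hδ'1 hmax' x ⟨hx.1, hx.2.trans_le hs.2⟩)
  have hw0 : w₁ r₀ - w₂ r₀ = 0 := by linarith
  simp only [hw0, sub_zero] at h3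
  have h4 : B * |w₁ s - w₂ s| * (s - r₀) ≤ 1 / 2 * |w₁ s - w₂ s| := by
    calc _ ≤ B * |w₁ s - w₂ s| * δ' := by
          refine mul_le_mul_of_nonneg_left (by linarith [hs.2]) (by positivity)
      _ = B * δ' * |w₁ s - w₂ s| := by ring
      _ ≤ _ := mul_le_mul_of_nonneg_right hδ'2 (abs_nonneg _)
  have h5 := hmax' t ht
  have h6 : |w₁ t - w₂ t| ≤ 0 := by linarith
  exact sub_eq_zero.1 (abs_eq_zero.1 (le_antisymm h6 (abs_nonneg _)))

lemma v_eq_of_w_eq (h₁ : RadialSol n a f R w₁ v₁) (h₂ : RadialSol n a f R w₂ v₂) {r : ℝ}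
    (hr : r ∈ Icc 0 R) (hw : ∀ t ∈ Ioo 0 r, w₁ t = w₂ t) : v₁ r = v₂ r := by
  have := h₁.abs_v_sub_v_le h₂ (K := 0) le_rfl hr.1 hr.2 (h₁.v_zero.trans h₂.v_zero.symm)
    fun t ht => by simp [hw t ht]
  rw [zero_mul] at this
  exact sub_eq_zero.1 (abs_eq_zero.1 (le_antisymm this (abs_nonneg _)))

/-- The Lipschitz bound is required only along the two solutions, since f need not be Lipschitz near
-1. The set of agreement is closed and extends to the right from each of its points by the local
result. -/
theorem eqOn (ha : 0 < a) (hfc : Continuous f) (h₁ : RadialSol n a f R w₁ v₁)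
    (h₂ : RadialSol n a f R w₂ v₂) {L : ℝ} (hL : 0 ≤ L)
    (hf : ∀ r ∈ Icc 0 R, |f (w₁ r) - f (w₂ r)| ≤ L * |w₁ r - w₂ r|) (hw : w₁ 0 = w₂ 0)
    (hnd : ∀ r ∈ Icc 0 R, v₁ r = 0 → f (w₁ r) ≠ 0) :
    EqOn w₁ w₂ (Icc 0 R) ∧ EqOn v₁ v₂ (Icc 0 R) := by
  suffices hE : EqOn w₁ w₂ (Icc 0 R) from
    ⟨hE, fun r hr => h₁.v_eq_of_w_eq h₂ hr fun t ht => hE ⟨ht.1.le, ht.2.le.trans hr.2⟩⟩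
  have hcl : IsClosed ({r | w₁ r = w₂ r} ∩ Icc 0 R) := by
    have hcont := h₁.cont_w.sub h₂.cont_w
    have := hcont.preimage_isClosed_of_isClosed isClosed_Icc (isClosed_singleton (x := (0 : ℝ)))
    convert this using 1
    ext r; simp [sub_eq_zero, and_comm]
  refine hcl.Icc_subset_of_forall_mem_nhdsGT_of_Icc_subset hw fun t ht hsub => ?_
  obtain ⟨δ, hδ, -, H⟩ := h₁.exists_eqOn_Icc ha hfc h₂ hL hf ht.1 ht.2 (hsub ⟨ht.1, le_rfl⟩)
    (h₁.v_eq_of_w_eq h₂ ⟨ht.1, ht.2.le⟩ fun s hs => hsub ⟨hs.1.le, hs.2.le⟩)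
    (hnd t ⟨ht.1, ht.2.le⟩)
  exact mem_of_superset (Icc_mem_nhdsGT (by linarith : t < t + δ)) H

end RadialSol

/-! ### Compactness of approximate solutions -/

section Compactness

variable {n : ℕ} {a R K d : ℝ} {f : ℝ → ℝ}

lemma abs_div_pow_le_of_hasDerivAt {u g : ℝ → ℝ} (hu : ContinuousOn u (Icc 0 R)) (h0 : u 0 = 0)
    (hd : ∀ r ∈ Ioo 0 R, HasDerivAt u (r ^ n * g r) r) (hg : ∀ r ∈ Ioo 0 R, |g r| ≤ K) {r : ℝ}
    (hr : r ∈ Icc 0 R) : |u r| ≤ K * r ^ (n + 1) ∧ |u r / r ^ n| ≤ K * r := by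
  have h1 : |u r| ≤ K * r ^ (n + 1) := by
    have := abs_sub_le_of_abs_hasDerivAt_le (f := u) (C := r ^ n * K) hr.1
      (hu.mono (Icc_subset_Icc_right hr.2))
      (fun x hx => hd x ⟨hx.1, hx.2.trans_le hr.2⟩) (fun x hx => by
        rw [abs_mul, abs_pow, abs_of_pos hx.1]
        have h1 := hg x ⟨hx.1, hx.2.trans_le hr.2⟩
        have h2 := pow_le_pow_left₀ hx.1.le hx.2.le n
        have h4 := pow_nonneg hx.1.le n
        exact mul_le_mul h2 h1 (abs_nonneg _) (h4.trans h2))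
    rw [h0, sub_zero, sub_zero] at this
    calc _ ≤ _ := this
      _ = _ := by ring
  refine ⟨h1, ?_⟩
  rcases hr.1.eq_or_lt with rfl | h0'
  · simp [h0]
  rw [abs_div, abs_pow, abs_of_pos h0', div_le_iff₀ (pow_pos h0' n)]
  calc _ ≤ _ := h1
    _ = _ := by ring

/-- Compactness of approximate solutions, where the equation for `v k` contains `f ∘ y k` with
`y k` uniformly close to `w k`. -/
theorem exists_subseq_tendsto_radialSol (ha : 0 < a) (hf : Continuous f) (hR : 0 < R)
    {w v y : ℕ → ℝ → ℝ} (hw : ∀ k, ContinuousOn (w k) (Icc 0 R))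
    (hv : ∀ k, ContinuousOn (v k) (Icc 0 R)) (hv0 : ∀ k, v k 0 = 0)
    (dw : ∀ k, ∀ r ∈ Ioo 0 R, HasDerivAt (w k) (spow a⁻¹ (v k r / r ^ n)) r)
    (dv : ∀ k, ∀ r ∈ Ioo 0 R, HasDerivAt (v k) (-(r ^ n * f (y k r))) r)
    (hK : ∀ k, ∀ r ∈ Icc 0 R, |f (y k r)| ≤ K)
    (hy : ∀ ε > 0, ∀ᶠ k in atTop, ∀ r ∈ Icc 0 R, |y k r - w k r| ≤ ε)
    (hd : Tendsto (fun k => w k 0) atTop (𝓝 d)) :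
    ∃ φ : ℕ → ℕ, StrictMono φ ∧ ∃ W V : ℝ → ℝ, RadialSol n a f R W V ∧ W 0 = d ∧
      TendstoUniformlyOn (fun k => w (φ k)) W atTop (Icc 0 R) ∧
      TendstoUniformlyOn (fun k => v (φ k)) V atTop (Icc 0 R) := by
  have hb : 0 < a⁻¹ := inv_pos.2 ha
  have hK0 : 0 ≤ K := (abs_nonneg _).trans (hK 0 0 ⟨le_rfl, hR.le⟩)
  have hz : ∀ k, ∀ r ∈ Icc 0 R, |v k r / r ^ n| ≤ K * R := fun k r hr =>
    (abs_div_pow_le_of_hasDerivAt (g := fun r => - f (y k r)) (hv k) (hv0 k)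
      (fun r hr => (dv k r hr).congr_deriv (by ring))
      (fun r hr => by rw [abs_neg]; exact hK k r (Ioo_subset_Icc_self hr)) hr).2.trans
      (mul_le_mul_of_nonneg_left hr.2 hK0)
  have hLip : ∀ k, ∀ s ∈ Icc 0 R, ∀ r ∈ Icc 0 R, |w k r - w k s| ≤ (K * R) ^ a⁻¹ * |r - s| := by
    intro k
    have key : ∀ s ∈ Icc 0 R, ∀ r ∈ Icc 0 R, s ≤ r →
        |w k r - w k s| ≤ (K * R) ^ a⁻¹ * |r - s| := fun s hs r hr hsr => by
      rw [abs_of_nonneg (sub_nonneg.2 hsr)]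
      refine abs_sub_le_of_abs_hasDerivAt_le hsr ((hw k).mono (Icc_subset_Icc hs.1 hr.2))
        (fun x hx => dw k x ⟨hs.1.trans_lt hx.1, hx.2.trans_le hr.2⟩) fun x hx => ?_
      rw [abs_spow hb]
      exact Real.rpow_le_rpow (abs_nonneg _)
        (hz k x ⟨hs.1.trans hx.1.le, hx.2.le.trans hr.2⟩) hb.le
    intro s hs r hr
    rcases le_total s r with h | h
    · exact key s hs r hr h
    · rw [abs_sub_comm, abs_sub_comm r]; exact key r hr s hs h
  set C := (K * R) ^ a⁻¹ with hC
  have hC0 : 0 ≤ C := by positivity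
  obtain ⟨M, hM⟩ : ∃ M, ∀ k, |w k 0| ≤ M := by
    obtain ⟨M, hM⟩ := hd.abs.bddAbove_range
    exact ⟨M, fun k => hM ⟨k, rfl⟩⟩
  -- The flux bound K R makes all profiles Lipschitz with the same constant, so Arzelà–Ascoli
  -- applies. The limit flux is then defined by integrating the equation.
  let G : ℕ → BoundedContinuousFunction (Icc 0 R) ℝ := fun k =>
    BoundedContinuousFunction.mkOfCompact ⟨(Icc 0 R).domRestrict (w k), (hw k).domRestrict⟩
  have hG : ∀ k x, G k x = w k x := fun k x => rfl
  have hcomp : IsCompact (closure (range G)) := by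
    refine BoundedContinuousFunction.arzela_ascoli (Icc (-(M + C * R)) (M + C * R)) isCompact_Icc
      _ ?_ ?_
    · rintro _ x ⟨k, rfl⟩
      rw [hG]
      refine abs_le.1 ?_
      have h1 := hLip k 0 ⟨le_rfl, hR.le⟩ x x.2
      rw [sub_zero, abs_of_nonneg x.2.1] at h1
      have h2 := mul_le_mul_of_nonneg_left x.2.2 hC0
      have h3 := abs_sub_abs_le_abs_sub (w k x) (w k 0)
      linarith [hM k]
    · refine UniformEquicontinuous.equicontinuous ?_
      rw [Metric.uniformEquicontinuous_iff]
      intro ε hε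
      refine ⟨ε / (C + 1), by positivity, ?_⟩
      rintro x y hxy ⟨_, k, rfl⟩
      rw [hG, hG, Real.dist_eq]
      refine (hLip k y y.2 x x.2).trans_lt ?_
      rw [Subtype.dist_eq, Real.dist_eq, lt_div_iff₀ (by positivity)] at hxy
      nlinarith [abs_nonneg ((x : ℝ) - y)]
  obtain ⟨g, -, φ, hφ, hg⟩ := hcomp.tendsto_subseq fun k => subset_closure (mem_range_self k)
  refine ⟨φ, hφ, IccExtend hR.le g, fun r => ∫ t in (0 : ℝ)..r, -(t ^ n * f (IccExtend hR.le g t)),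
    ?_⟩
  set W := IccExtend hR.le g with hW
  have hWc : Continuous W := g.continuous.Icc_extend'
  set V := fun r => ∫ t in (0 : ℝ)..r, -(t ^ n * f (W t)) with hV
  have hVd : ∀ r, HasDerivAt V (-(r ^ n * f (W r))) r := fun r =>
    (Continuous.integral_hasStrictDerivAt (by fun_prop) 0 r).hasDerivAt
  have hVc : Continuous V := continuous_iff_continuousAt.2 fun r => (hVd r).continuousAt
  have hV0 : V 0 = 0 := by simp [hV]
  have hwW : TendstoUniformlyOn (fun k => w (φ k)) W atTop (Icc 0 R) := by
    have h1 := BoundedContinuousFunction.tendsto_iff_tendstoUniformly.1 hg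
    rw [Metric.tendstoUniformly_iff] at h1
    rw [Metric.tendstoUniformlyOn_iff]
    intro ε hε
    filter_upwards [h1 ε hε] with k hk r hr
    have := hk ⟨r, hr⟩
    simpa [hW, IccExtend_of_mem hR.le g hr, hG] using this
  have hyW : TendstoUniformlyOn (fun k => y (φ k)) W atTop (Icc 0 R) := by
    rw [Metric.tendstoUniformlyOn_iff] at hwW ⊢
    intro ε hε
    filter_upwards [hwW (ε / 2) (half_pos hε),
      hφ.tendsto_atTop.eventually (hy (ε / 3) (by positivity))] with k h1 h2 r hr
    have e1 := h1 r hr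
    have e2 := h2 r hr
    rw [Real.dist_eq] at e1 ⊢
    have := abs_sub_le (W r) (w (φ k) r) (y (φ k) r)
    rw [abs_sub_comm (w (φ k) r)] at this
    linarith
  have hfy : ∀ ε > 0, ∀ᶠ k in atTop, ∀ r ∈ Icc 0 R, |f (y (φ k) r) - f (W r)| ≤ ε := by
    obtain ⟨B, hB⟩ := isCompact_Icc.exists_bound_of_continuousOn (hWc.continuousOn (s := Icc 0 R))
    have huc : UniformContinuousOn f (Icc (-(B + 1)) (B + 1)) :=
      isCompact_Icc.uniformContinuousOn_of_continuous hf.continuousOn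
    rw [Metric.uniformContinuousOn_iff] at huc
    rw [Metric.tendstoUniformlyOn_iff] at hyW
    intro ε hε
    obtain ⟨δ, hδ, H⟩ := huc ε hε
    filter_upwards [hyW (min δ 1) (lt_min hδ one_pos)] with k hk r hr
    have h1 := hk r hr
    have h2 := hB r hr
    rw [Real.norm_eq_abs] at h2
    have h3 : |W r - y (φ k) r| < 1 := (Real.dist_eq _ _ ▸ h1).trans_le (min_le_right _ _)
    have h4 := abs_le.1 h2
    have h5 := abs_lt.1 h3
    have := H (y (φ k) r) ⟨by linarith, by linarith⟩ (W r) ⟨by linarith, by linarith⟩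
      (by rw [dist_comm]; exact h1.trans_le (min_le_left _ _))
    exact this.le
  -- The weighted bound by r^(n+1) keeps v / r^n uniformly convergent up to the singular point r =
  -- 0.
  have hvV : ∀ ε > 0, ∀ᶠ k in atTop, ∀ r ∈ Icc 0 R, |v (φ k) r - V r| ≤ ε * r ^ (n + 1) ∧
      |v (φ k) r / r ^ n - V r / r ^ n| ≤ ε * r := by
    intro ε hε
    filter_upwards [hfy ε hε] with k hk r hr
    have := abs_div_pow_le_of_hasDerivAt (n := n) (u := fun r => v (φ k) r - V r) (K := ε)
      (g := fun r => -(f (y (φ k) r) - f (W r))) ((hv (φ k)).sub hVc.continuousOn)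
      (by simp [hv0, hV0])
      (fun r hr => ((dv (φ k) r hr).sub (hVd r)).congr_deriv (by ring))
      (fun r hr => by rw [abs_neg]; exact hk r (Ioo_subset_Icc_self hr)) hr
    rwa [sub_div] at this
  have hvV' : TendstoUniformlyOn (fun k => v (φ k)) V atTop (Icc 0 R) := by
    rw [Metric.tendstoUniformlyOn_iff]
    intro ε hε
    have hp : 0 < R ^ (n + 1) + 1 := by positivity
    filter_upwards [hvV (ε / (R ^ (n + 1) + 1)) (by positivity)] with k hk r hr
    rw [dist_comm, Real.dist_eq]
    refine (hk r hr).1.trans_lt ?_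
    rw [div_mul_eq_mul_div, div_lt_iff₀ hp]
    have := pow_le_pow_left₀ hr.1 hr.2 (n + 1)
    nlinarith
  have hzV : TendstoUniformlyOn (fun k r => v (φ k) r / r ^ n) (fun r => V r / r ^ n) atTop
      (Icc 0 R) := by
    rw [Metric.tendstoUniformlyOn_iff]
    intro ε hε
    filter_upwards [hvV (ε / (R + 1)) (by positivity)] with k hk r hr
    rw [dist_comm, Real.dist_eq]
    refine (hk r hr).2.trans_lt ?_
    rw [div_mul_eq_mul_div, div_lt_iff₀ (by positivity)]
    nlinarith [hr.2]
  have hzb : ∀ r ∈ Icc 0 R, |V r / r ^ n| ≤ K * R := fun r hr =>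
    le_of_tendsto (hzV.tendsto_at hr).abs (Eventually.of_forall fun k => hz (φ k) r hr)
  have hder : TendstoUniformlyOn (fun k r => spow a⁻¹ (v (φ k) r / r ^ n))
      (fun r => spow a⁻¹ (V r / r ^ n)) atTop (Ioo 0 R) := by
    have huc : UniformContinuousOn (spow a⁻¹) (Icc (-(K * R)) (K * R)) :=
      isCompact_Icc.uniformContinuousOn_of_continuous (continuous_spow hb).continuousOn
    rw [Metric.uniformContinuousOn_iff] at huc
    rw [Metric.tendstoUniformlyOn_iff] at hzV ⊢
    intro ε hε
    obtain ⟨δ, hδ, H⟩ := huc ε hε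
    filter_upwards [hzV δ hδ] with k hk r hr
    have hr' := Ioo_subset_Icc_self hr
    exact H _ (abs_le.1 (hzb r hr')) _ (abs_le.1 (hz _ r hr')) (hk r hr')
  refine ⟨⟨hWc.continuousOn, hVc.continuousOn, hV0, fun r hr => ?_, fun r _ => hVd r⟩, ?_, hwW,
    hvV'⟩
  · exact hasDerivAt_of_tendstoUniformlyOn isOpen_Ioo hder
      (Eventually.of_forall fun k r hr => dw (φ k) r hr)
      (fun r hr => hwW.tendsto_at (Ioo_subset_Icc_self hr)) hr
  · exact tendsto_nhds_unique (hwW.tendsto_at ⟨le_rfl, hR.le⟩) (hd.comp hφ.tendsto_atTop)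

end Compactness

/-! ### Existence by equations with delay -/

section Existence

variable {n : ℕ} {a K : ℝ} {f : ℝ → ℝ}

/-- `v` obtained from the delayed profile `U (· - h)`. -/
noncomputable def delayedFlux (n : ℕ) (f : ℝ → ℝ) (h : ℝ) (U : ℝ → ℝ) (r : ℝ) : ℝ :=
  ∫ t in (0 : ℝ)..r, -(t ^ n * f (U (t - h)))

/-- One step of the iteration with delay `h` and initial value `d`. -/
noncomputable def delayedStep (n : ℕ) (a : ℝ) (f : ℝ → ℝ) (h d : ℝ) (U : ℝ → ℝ) (r : ℝ) : ℝ :=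
  d + ∫ s in (0 : ℝ)..(max r 0), spow a⁻¹ (delayedFlux n f h U s / s ^ n)

lemma hasDerivAt_delayedFlux (hf : Continuous f) {U : ℝ → ℝ} (hU : Continuous U) (h r : ℝ) :
    HasDerivAt (delayedFlux n f h U) (-(r ^ n * f (U (r - h)))) r :=
  (Continuous.integral_hasStrictDerivAt (by fun_prop) 0 r).hasDerivAt

lemma continuous_delayedFlux_div (hf : Continuous f) (hK : ∀ s, |f s| ≤ K) {U : ℝ → ℝ}
    (hU : Continuous U) (h : ℝ) : Continuous fun r => delayedFlux n f h U (max r 0) / (max r 0) ^ n := by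
  have hc : ContinuousOn (fun r => delayedFlux n f h U r / r ^ n) (Ici 0) := by
    intro r hr
    rcases (show (0 : ℝ) ≤ r from hr).eq_or_lt with rfl | h0
    · have h0 : delayedFlux n f h U 0 = 0 := by simp [delayedFlux]
      have h1 : Tendsto (fun r : ℝ => K * r) (𝓝[Ici 0] 0) (𝓝 0) := by
        have : Tendsto (fun r : ℝ => K * r) (𝓝 0) (𝓝 (K * 0)) :=
          (continuous_const.mul continuous_id).tendsto 0
        rw [mul_zero] at this
        exact this.mono_left nhdsWithin_le_nhds
      have h2 : Tendsto (fun r => delayedFlux n f h U r / r ^ n) (𝓝[Ici 0] 0) (𝓝 0) :=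
        squeeze_zero_norm' (by
          filter_upwards [self_mem_nhdsWithin] with r hr
          exact (abs_div_pow_le_of_hasDerivAt (R := r) (g := fun t => -f (U (t - h)))
            (fun x _ => (hasDerivAt_delayedFlux hf hU h x).continuousAt.continuousWithinAt) h0
            (fun x _ => (hasDerivAt_delayedFlux hf hU h x).congr_deriv (by ring))
            (fun x _ => by rw [abs_neg]; exact hK _) ⟨hr, le_rfl⟩).2) h1
      simpa [ContinuousWithinAt, h0] using h2
    · exact ((hasDerivAt_delayedFlux hf hU h r).continuousAt.div (continuous_pow n).continuousAt
        (pow_pos h0 n).ne').continuousWithinAt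
  exact hc.comp_continuous (by fun_prop) fun r => mem_Ici.2 (le_max_right _ _)

lemma delayedStep_eq (n : ℕ) (a : ℝ) (f : ℝ → ℝ) (h d : ℝ) (U : ℝ → ℝ) (r : ℝ) :
    delayedStep n a f h d U r = d + ∫ s in (0 : ℝ)..(max r 0),
      spow a⁻¹ (delayedFlux n f h U (max s 0) / (max s 0) ^ n) := by
  unfold delayedStep
  congr 1
  refine intervalIntegral.integral_congr fun s hs => ?_
  rw [uIcc_of_le (le_max_right _ _)] at hs
  simp only [max_eq_left hs.1]

lemma continuous_delayedStep (ha : 0 < a) (hf : Continuous f) (hK : ∀ s, |f s| ≤ K) {U : ℝ → ℝ}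
    (hU : Continuous U) (h d : ℝ) : Continuous (delayedStep n a f h d U) := by
  have h1 := (continuous_spow (inv_pos.2 ha)).comp (continuous_delayedFlux_div (n := n) hf hK hU h)
  have h2 : Continuous fun x => ∫ s in (0 : ℝ)..x,
      spow a⁻¹ (delayedFlux n f h U (max s 0) / (max s 0) ^ n) :=
    continuous_iff_continuousAt.2 fun x => (h1.integral_hasStrictDerivAt 0 x).hasDerivAt.continuousAt
  have h3 : Continuous fun r : ℝ => max r 0 := by fun_prop
  have h4 := (h2.comp h3).const_add d
  convert h4 using 1
  exact funext fun r => delayedStep_eq n a f h d U r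

lemma hasDerivAt_delayedStep (ha : 0 < a) (hf : Continuous f) (hK : ∀ s, |f s| ≤ K) {U : ℝ → ℝ}
    (hU : Continuous U) (h d : ℝ) {r : ℝ} (hr : 0 < r) :
    HasDerivAt (delayedStep n a f h d U) (spow a⁻¹ (delayedFlux n f h U r / r ^ n)) r := by
  have h1 := (continuous_spow (inv_pos.2 ha)).comp (continuous_delayedFlux_div (n := n) hf hK hU h)
  have h2 := ((h1.integral_hasStrictDerivAt 0 r).hasDerivAt.const_add d)
  simp only [Function.comp_apply, max_eq_left hr.le] at h2
  refine h2.congr_of_eventuallyEq ?_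
  filter_upwards [lt_mem_nhds hr] with x hx
  rw [delayedStep_eq, max_eq_left hx.le]

lemma delayedStep_congr {n : ℕ} {a h d c : ℝ} {f U U' : ℝ → ℝ} (hc : 0 ≤ c + h)
    (hU : ∀ r ≤ c, U r = U' r) {r : ℝ} (hr : r ≤ c + h) :
    delayedStep n a f h d U r = delayedStep n a f h d U' r := by
  unfold delayedStep delayedFlux
  congr 1
  refine intervalIntegral.integral_congr fun s hs => ?_
  rw [uIcc_of_le (le_max_right _ _)] at hs
  have hs' : s ≤ c + h := hs.2.trans (max_le hr hc)
  congr 2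
  refine intervalIntegral.integral_congr fun t ht => ?_
  rw [uIcc_of_le hs.1] at ht
  simp only [hU (t - h) (by linarith [ht.2])]

/-- A step reads its input only up to time r - h, so each iteration settles the profile on one more
interval of length h. The m-th iterate therefore solves the delayed equation on [0, m h]. -/
lemma iterate_delayedStep_succ (n : ℕ) (a : ℝ) (f : ℝ → ℝ) {h : ℝ} (hh : 0 < h) (d : ℝ) (m : ℕ) :
    ∀ r ≤ m * h, (delayedStep n a f h d)^[m + 1] (fun _ => d) r =
      (delayedStep n a f h d)^[m] (fun _ => d) r := by
  induction m with
  | zero =>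
    intro r hr
    have : max r 0 = 0 := max_eq_right (by simpa using hr)
    simp [delayedStep, this]
  | succ m ih =>
    intro r hr
    have hr' : r ≤ m * h + h := by push_cast at hr; linarith
    have h0 : 0 ≤ m * h + h := by positivity
    have e1 := Function.iterate_succ_apply' (delayedStep n a f h d) (m + 1) (fun _ => d)
    have e2 := Function.iterate_succ_apply' (delayedStep n a f h d) m (fun _ => d)
    exact ((congrFun e1 r).trans (delayedStep_congr h0 ih hr')).trans (congrFun e2 r).symm

/-- A Peano theorem for merely continuous f: the delays 1/(k + 1) tend to zero and compactness
yields a limit. The boundedness of f supplies the uniform bounds. -/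
theorem exists_radialSol_of_bounded (ha : 0 < a) (hf : Continuous f) (hK : ∀ s, |f s| ≤ K)
    {R : ℝ} (hR : 0 < R) (d : ℝ) : ∃ w v : ℝ → ℝ, RadialSol n a f R w v ∧ w 0 = d := by
  have hb : 0 < a⁻¹ := inv_pos.2 ha
  have hK0 : 0 ≤ K := (abs_nonneg _).trans (hK 0)
  let U : ℕ → ℕ → ℝ → ℝ := fun k m => (delayedStep n a f (1 / (k + 1)) d)^[m] (fun _ => d)
  have hUc : ∀ k m, Continuous (U k m) := fun k m => by
    induction m with
    | zero => exact continuous_const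
    | succ m ih =>
      simp only [U, Function.iterate_succ_apply']
      exact continuous_delayedStep ha hf hK ih _ _
  have hU : ∀ k m, U k (m + 1) = delayedStep n a f (1 / (k + 1)) d (U k m) := fun k m => by
    simp only [U, Function.iterate_succ_apply']
  have hm : ∀ k : ℕ, ∃ m : ℕ, R ≤ m * (1 / ((k : ℝ) + 1)) := fun k => by
    obtain ⟨m, hm⟩ := exists_nat_ge (R * (k + 1))
    exact ⟨m, by rw [mul_one_div, le_div_iff₀ (by positivity)]; exact hm⟩
  choose m hm using hm
  have hv0 : ∀ k : ℕ, delayedFlux n f (1 / ((k : ℝ) + 1)) (U k (m k)) 0 = 0 := fun k => by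
    simp [delayedFlux]
  have hw0 : ∀ k, U k (m k + 1) 0 = d := fun k => by rw [hU]; simp [delayedStep]
  obtain ⟨φ, -, W, V, h, hW, -⟩ := exists_subseq_tendsto_radialSol (n := n) (K := K) (d := d) ha hf
    hR (w := fun k => U k (m k + 1))
    (v := fun k => delayedFlux n f (1 / ((k : ℝ) + 1)) (U k (m k)))
    (y := fun k r => U k (m k) (r - 1 / ((k : ℝ) + 1)))
    (fun k => (hUc k _).continuousOn)
    (fun k x _ => (hasDerivAt_delayedFlux hf (hUc k _) _ x).continuousAt.continuousWithinAt)
    hv0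
    (fun k r hr => by
      rw [hU]; exact hasDerivAt_delayedStep ha hf hK (hUc k _) _ _ hr.1)
    (fun k r hr => hasDerivAt_delayedFlux hf (hUc k _) _ r)
    (fun k r _ => hK _)
    (fun ε hε => by
      have hlim : Tendsto (fun k : ℕ => (K * R) ^ a⁻¹ * (1 / ((k : ℝ) + 1))) atTop (𝓝 0) := by
        simpa using (tendsto_one_div_add_atTop_nhds_zero_nat (𝕜 := ℝ)).const_mul ((K * R) ^ a⁻¹)
      filter_upwards [hlim.eventually (ge_mem_nhds hε)] with k hk r hr
      refine le_trans ?_ hk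
      set η : ℝ := 1 / ((k : ℝ) + 1) with hη
      have hη0 : 0 < η := by positivity
      -- The iteration has settled up to time m k * η ≥ R. For r < η both sides are the initial
      -- value d.
      have e1 : U k (m k) (r - η) = U k (m k + 1) (max (r - η) 0) := by
        have h1 : U k (m k) (r - η) = U k (m k + 1) (r - η) :=
          (iterate_delayedStep_succ n a f hη0 d (m k) (r - η) (by linarith [hm k, hr.2])).symm
        rw [h1, hU]; simp [delayedStep]
      have hs : max (r - η) 0 ∈ Icc 0 r := ⟨le_max_right _ _, max_le (by linarith) hr.1⟩
      rw [e1, abs_sub_comm]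
      refine (abs_sub_le_of_abs_hasDerivAt_le (C := (K * R) ^ a⁻¹) hs.2 (hUc k _).continuousOn
        (fun x hx => by
          rw [hU]; exact hasDerivAt_delayedStep ha hf hK (hUc k _) _ _ (hs.1.trans_lt hx.1))
        (fun x hx => ?_)).trans ?_
      · rw [abs_spow hb]
        refine Real.rpow_le_rpow (abs_nonneg _) ?_ hb.le
        have hx0 : 0 < x := hs.1.trans_lt hx.1
        refine (abs_div_pow_le_of_hasDerivAt (R := x) (g := fun t => -f (U k (m k) (t - η)))
            (fun x _ => (hasDerivAt_delayedFlux hf (hUc k _) η x).continuousAt.continuousWithinAt)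
            (hv0 k)
            (fun x _ => (hasDerivAt_delayedFlux hf (hUc k _) η x).congr_deriv (by ring))
            (fun x _ => by rw [abs_neg]; exact hK _) ⟨hx0.le, le_rfl⟩).2.trans ?_
        exact mul_le_mul_of_nonneg_left (hx.2.le.trans hr.2) hK0
      · refine mul_le_mul_of_nonneg_left ?_ (by positivity)
        linarith [le_max_left (r - η) 0])
    (by simp only [hw0]; exact tendsto_const_nhds)
  exact ⟨W, V, h, hW⟩

end Existence

/-! ### Restoring nonlinearities and global trajectories -/

/-- Nonlinearities `f` on `(-1, ∞)`, extended by zero, with the sign of the identity. -/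
structure Restoring (f : ℝ → ℝ) : Prop where
  cont : Continuous f
  neg : ∀ s, -1 < s → s < 0 → f s < 0
  pos : ∀ s, 0 < s → 0 < f s
  zero_left : ∀ s ≤ -1, f s = 0
  lip : ∀ b c, -1 < b → ∃ L ≥ 0, ∀ x ∈ Icc b c, ∀ y ∈ Icc b c, |f x - f y| ≤ L * |x - y|

namespace RadialSol

variable {n : ℕ} {a R : ℝ} {f w v w' v' : ℝ → ℝ}

lemma congr (h : RadialSol n a f R w v) (hR : 0 ≤ R) (hw : EqOn w' w (Icc 0 R))
    (hv : EqOn v' v (Icc 0 R)) : RadialSol n a f R w' v' where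
  cont_w := h.cont_w.congr hw
  cont_v := h.cont_v.congr hv
  v_zero := (hv ⟨le_rfl, hR⟩).trans h.v_zero
  deriv_w r hr := by
    rw [hv (Ioo_subset_Icc_self hr)]
    refine (h.deriv_w r hr).congr_of_eventuallyEq ?_
    filter_upwards [Ioo_mem_nhds hr.1 hr.2] with x hx using hw (Ioo_subset_Icc_self hx)
  deriv_v r hr := by
    rw [hw (Ioo_subset_Icc_self hr)]
    refine (h.deriv_v r hr).congr_of_eventuallyEq ?_
    filter_upwards [Ioo_mem_nhds hr.1 hr.2] with x hx using hv (Ioo_subset_Icc_self hx)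

lemma abs_flux_le_of_energy_le (ha : 0 < a) {r E : ℝ} (h0 : 0 ≤ potential f (w r))
    (hE : energy n a f w v r ≤ E) : |v r / r ^ n| ≤ ((a⁻¹ + 1) * E) ^ (a⁻¹ + 1)⁻¹ := by
  have hb : 0 < a⁻¹ + 1 := by positivity
  have h1 : |v r / r ^ n| ^ (a⁻¹ + 1) ≤ (a⁻¹ + 1) * E := by
    unfold energy at hE
    have : (a⁻¹ + 1)⁻¹ * |v r / r ^ n| ^ (a⁻¹ + 1) ≤ E := by linarith
    rwa [inv_mul_le_iff₀ hb] at this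
  calc |v r / r ^ n| = (|v r / r ^ n| ^ (a⁻¹ + 1)) ^ (a⁻¹ + 1)⁻¹ :=
        (Real.rpow_rpow_inv (abs_nonneg _) hb.ne').symm
    _ ≤ _ := Real.rpow_le_rpow (by positivity) h1 (by positivity)

end RadialSol

namespace Restoring

variable {n : ℕ} {a R α : ℝ} {f w v w₁ v₁ w₂ v₂ : ℝ → ℝ}

lemma sign (hf : Restoring f) : ∀ s ∈ Ioi (-1 : ℝ), s ≠ 0 → 0 < s * f s := by
  intro s hs hs0
  rcases hs0.lt_or_gt with h | h
  · exact mul_pos_of_neg_of_neg h (hf.neg s hs h)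
  · exact mul_pos h (hf.pos s h)

lemma eq_zero (hf : Restoring f) {s : ℝ} (hs : -1 < s) (h : f s = 0) : s = 0 := by
  by_contra hs0
  have := hf.sign s hs hs0
  simp [h] at this

lemma zero_mem : (0 : ℝ) ∈ Ioi (-1 : ℝ) := by simp

/-- Cutting off at height M makes f bounded, as it already vanishes on the left of -1. -/
lemma min_const (hf : Restoring f) {M : ℝ} (hM : 0 < M) : Restoring fun s => f (min s M) where
  cont := hf.cont.comp (continuous_id.min continuous_const)
  neg s h1 h2 := by rw [min_eq_left (by linarith)]; exact hf.neg s h1 h2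
  pos s hs := hf.pos _ (lt_min hs hM)
  zero_left s hs := by rw [min_eq_left (by linarith)]; exact hf.zero_left s hs
  lip b c hb := by
    obtain ⟨L, hL, H⟩ := hf.lip (min b M) c (lt_min hb (by linarith))
    refine ⟨L, hL, fun x hx y hy => (H _ ⟨min_le_min_right _ hx.1, (min_le_left _ _).trans hx.2⟩ _
      ⟨min_le_min_right _ hy.1, (min_le_left _ _).trans hy.2⟩).trans ?_⟩
    refine mul_le_mul_of_nonneg_left ?_ hL
    have := abs_min_sub_min_le_max x M y M
    simpa using this

lemma exists_bound_le (hf : Restoring f) (M : ℝ) : ∃ K, ∀ s ≤ M, |f s| ≤ K := by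
  obtain ⟨K, hK⟩ := (isCompact_Icc (a := (-1 : ℝ)) (b := M)).exists_bound_of_continuousOn
    hf.cont.continuousOn
  refine ⟨max K 0, fun s hs => ?_⟩
  rcases le_total s (-1) with h | h
  · simp [hf.zero_left s h]
  · exact (hK s ⟨h, hs⟩).trans (le_max_left _ _)

lemma potential_nonneg (hf : Restoring f) {s : ℝ} (hs : -1 < s) : 0 ≤ potential f s := by
  rcases eq_or_ne s 0 with rfl | h
  · simp
  · exact (potential_pos hf.cont zero_mem hf.sign hs h).le

lemma potential_le_neg_one (hf : Restoring f) (hα : α ∈ Ioo (0 : ℝ) 1) :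
    potential f (-α) ≤ potential f (-1) := by
  have := le_of_hasDerivAt_nonneg (f := fun x => - potential f x) (f' := fun x => - f x)
    (by linarith [hα.2] : (-1 : ℝ) ≤ -α)
    (continuous_potential hf.cont).neg.continuousOn
    (fun x _ => (hasDerivAt_potential hf.cont x).neg) fun x hx => by
      linarith [hf.neg x hx.1 (hx.2.trans (neg_neg_of_pos hα.1))]
  linarith

/-- An energy barrier: F(w) never exceeds F(-α), while F is larger than F(-α) on (-1, -α). -/
lemma neg_le_of_radialSol (hf : Restoring f) (ha : 0 < a) (h : RadialSol n a f R w v)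
    (hα : α ∈ Ioo (0 : ℝ) 1) (h0 : w 0 = -α) {r : ℝ} (hr : r ∈ Icc 0 R) : -α ≤ w r := by
  by_contra! hlt
  -- F is only known to be strictly decreasing inside (-1, 0). The profile could jump below -1 at r,
  -- so an intermediate value in (-1, -α) is used instead of w r.
  have hm : max (w r) (-(1 + α) / 2) < -α := max_lt hlt (by linarith [hα.2])
  obtain ⟨s, hs, hs'⟩ : max (w r) (-(1 + α) / 2) ∈ w '' Icc 0 r :=
    intermediate_value_Icc' hr.1 (h.cont_w.mono (Icc_subset_Icc_right hr.2))
      ⟨le_max_left _ _, h0 ▸ hm.le⟩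
  have h1 := h.potential_le_potential_zero ha hf.cont (r := s) ⟨hs.1, hs.2.trans hr.2⟩
  have h2 := potential_lt_of_nonpos hf.cont zero_mem hf.sign (s := -α) (t := w s)
    (by linarith [hα.1]) (hs' ▸ hm)
    (by rw [hs']; exact mem_Ioi.2 (lt_max_of_lt_right (by linarith [hα.2])))
  rw [h0] at h1
  linarith

lemma neg_one_lt (hf : Restoring f) (ha : 0 < a) (h : RadialSol n a f R w v)
    (hα : α ∈ Ioo (0 : ℝ) 1) (h0 : w 0 = -α) {r : ℝ} (hr : r ∈ Icc 0 R) : -1 < w r :=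
  (neg_lt_neg hα.2).trans_le (hf.neg_le_of_radialSol ha h hα h0 hr)

/-- A bound for the slope of all solutions starting in `(-1, 0)`. -/
noncomputable def speed (a : ℝ) (f : ℝ → ℝ) : ℝ :=
  (((a⁻¹ + 1) * potential f (-1)) ^ (a⁻¹ + 1)⁻¹) ^ a⁻¹

lemma abs_flux_le (hf : Restoring f) (ha : 0 < a) (h : RadialSol n a f R w v)
    (hα : α ∈ Ioo (0 : ℝ) 1) (h0 : w 0 = -α) {r : ℝ} (hr : r ∈ Icc 0 R) :
    |v r / r ^ n| ≤ ((a⁻¹ + 1) * potential f (-1)) ^ (a⁻¹ + 1)⁻¹ := by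
  refine RadialSol.abs_flux_le_of_energy_le ha
    (hf.potential_nonneg (hf.neg_one_lt ha h hα h0 hr)) ?_
  refine (h.energy_anti ha hf.cont le_rfl hr.1 hr.2).trans ?_
  rw [h.energy_zero ha, h0]
  exact hf.potential_le_neg_one hα

lemma abs_slope_le (hf : Restoring f) (ha : 0 < a) (h : RadialSol n a f R w v)
    (hα : α ∈ Ioo (0 : ℝ) 1) (h0 : w 0 = -α) {r : ℝ} (hr : r ∈ Icc 0 R) :
    |spow a⁻¹ (v r / r ^ n)| ≤ speed a f := by
  have hb : 0 < a⁻¹ := inv_pos.2 ha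
  rw [abs_spow hb]
  exact Real.rpow_le_rpow (abs_nonneg _) (hf.abs_flux_le ha h hα h0 hr) hb.le

lemma le_speed_mul (hf : Restoring f) (ha : 0 < a) (h : RadialSol n a f R w v)
    (hα : α ∈ Ioo (0 : ℝ) 1) (h0 : w 0 = -α) {r : ℝ} (hr : r ∈ Icc 0 R) :
    w r ≤ speed a f * R := by
  have h1 := sub_le_of_hasDerivAt_le hr.1 (h.cont_w.mono (Icc_subset_Icc_right hr.2))
    (fun x hx => h.deriv_w x ⟨hx.1, hx.2.trans_le hr.2⟩) (C := speed a f) (fun x hx =>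
      (le_abs_self _).trans (hf.abs_slope_le ha h hα h0 ⟨hx.1.le, hx.2.le.trans hr.2⟩))
  have hs : 0 ≤ speed a f :=
    (abs_nonneg _).trans (hf.abs_slope_le ha h hα h0 ⟨le_rfl, hr.1.trans hr.2⟩)
  have := mul_le_mul_of_nonneg_left hr.2 hs
  rw [h0] at h1
  linarith [hα.1]

lemma ne_zero_of_v_eq_zero (hf : Restoring f) (ha : 0 < a) (h : RadialSol n a f R w v)
    (hα : α ∈ Ioo (0 : ℝ) 1) (h0 : w 0 = -α) {r : ℝ} (hr : r ∈ Icc 0 R) (hv : v r = 0) :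
    w r ≠ 0 := by
  have hw0 : w 0 ≠ 0 := by rw [h0]; exact neg_ne_zero.2 hα.1.ne'
  intro hwr
  rcases hr.1.eq_or_lt with rfl | hr0
  · exact hw0 hwr
  · exact h.w_ne_zero_or_v_ne_zero ha hf.cont zero_mem hf.sign
      (fun r hr => hf.neg_one_lt ha h hα h0 hr) hw0 ⟨hr0, hr.2⟩ hwr hv

lemma unique (hf : Restoring f) (ha : 0 < a) (h₁ : RadialSol n a f R w₁ v₁)
    (h₂ : RadialSol n a f R w₂ v₂) (hα : α ∈ Ioo (0 : ℝ) 1) (h01 : w₁ 0 = -α) (h02 : w₂ 0 = -α) :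
    EqOn w₁ w₂ (Icc 0 R) ∧ EqOn v₁ v₂ (Icc 0 R) := by
  obtain ⟨L, hL, H⟩ := hf.lip (-α) (speed a f * R) (by linarith [hα.2])
  refine h₁.eqOn ha hf.cont h₂ hL (fun r hr => H _ ⟨hf.neg_le_of_radialSol ha h₁ hα h01 hr,
    hf.le_speed_mul ha h₁ hα h01 hr⟩ _ ⟨hf.neg_le_of_radialSol ha h₂ hα h02 hr,
    hf.le_speed_mul ha h₂ hα h02 hr⟩) (h01.trans h02.symm) fun r hr hv hfr => ?_
  exact hf.ne_zero_of_v_eq_zero ha h₁ hα h01 hr hv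
    (hf.eq_zero (hf.neg_one_lt ha h₁ hα h01 hr) hfr)

lemma exists_radialSol (hf : Restoring f) (ha : 0 < a) (hR : 0 < R) (hα : α ∈ Ioo (0 : ℝ) 1) :
    ∃ w v : ℝ → ℝ, RadialSol n a f R w v ∧ w 0 = -α := by
  set M := max (speed a f * R) 1 with hM
  have hM0 : 0 < M := lt_max_of_lt_right one_pos
  have hg := hf.min_const hM0
  obtain ⟨K, hK⟩ := hf.exists_bound_le M
  obtain ⟨w, v, h, h0⟩ := exists_radialSol_of_bounded (n := n) ha hg.cont
    (fun s => hK _ (min_le_right _ _)) hR (-α)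
  -- The a priori bound `speed a f * R` sees f only through its values on [-1, 0], which the
  -- truncation leaves unchanged. So the truncated solution never reaches the truncated range.
  have hp : potential (fun s => f (min s M)) (-1) = potential f (-1) := by
    unfold potential
    refine intervalIntegral.integral_congr fun s hs => ?_
    rw [uIcc_of_ge (by norm_num)] at hs
    rw [min_eq_left (by linarith [hs.2])]
  refine ⟨w, v, h.congr_f fun r hr => ?_, h0⟩
  have h1 := hg.le_speed_mul ha h hα h0 hr
  rw [speed, hp] at h1
  have h2 : w r ≤ M := h1.trans (le_max_left _ _)
  simp only [min_eq_left h2]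

end Restoring

/-- A solution on `[0, ∞)` of the initial value problem with `w 0 = -α`. -/
structure Trajectory (n : ℕ) (a : ℝ) (f : ℝ → ℝ) (α : ℝ) (w v : ℝ → ℝ) : Prop where
  radialSol : ∀ R, RadialSol n a f R w v
  w_zero : w 0 = -α

namespace Restoring

variable {n : ℕ} {a R α : ℝ} {f : ℝ → ℝ}

lemma exists_trajectory (hf : Restoring f) (ha : 0 < a) (hα : α ∈ Ioo (0 : ℝ) 1) :
    ∃ w v : ℝ → ℝ, Trajectory n a f α w v := by
  have hex : ∀ k : ℕ, ∃ w v : ℝ → ℝ, RadialSol n a f (k + 1) w v ∧ w 0 = -α := fun k =>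
    hf.exists_radialSol ha (by positivity) hα
  choose W V hs h0 using hex
  have hE : ∀ k l : ℕ, k ≤ l → EqOn (W k) (W l) (Icc 0 (k + 1)) ∧
      EqOn (V k) (V l) (Icc 0 (k + 1)) := fun k l hkl =>
    hf.unique ha (hs k) ((hs l).mono (by gcongr)) hα (h0 k) (h0 l)
  -- The value at r is taken from the solution with index ⌈r⌉₊. By uniqueness it agrees with that of
  -- every larger index.
  have key : ∀ K : ℕ, ∀ r ∈ Icc (0 : ℝ) K, W ⌈r⌉₊ r = W K r ∧ V ⌈r⌉₊ r = V K r := fun K r hr => by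
    have h1 : ⌈r⌉₊ ≤ K := Nat.ceil_le.2 hr.2
    have h2 : r ∈ Icc (0 : ℝ) (⌈r⌉₊ + 1) := ⟨hr.1, (Nat.le_ceil r).trans (by linarith)⟩
    exact ⟨(hE _ _ h1).1 h2, (hE _ _ h1).2 h2⟩
  refine ⟨fun r => W ⌈r⌉₊ r, fun r => V ⌈r⌉₊ r, fun R => ?_, by simpa using h0 0⟩
  obtain ⟨K, hK⟩ := exists_nat_ge R
  refine RadialSol.mono (R := K) ?_ hK
  exact ((hs K).mono (by linarith)).congr (by positivity) (fun r hr => (key K r hr).1)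
    fun r hr => (key K r hr).2

/-- Sequential continuity of trajectories in the initial value. -/
lemma exists_subseq_tendsto (hf : Restoring f) (ha : 0 < a) (hR : 0 < R) {A : ℕ → ℝ}
    {W V : ℕ → ℝ → ℝ} (hA : ∀ k, A k ∈ Ioo (0 : ℝ) 1)
    (hW : ∀ k, Trajectory n a f (A k) (W k) (V k)) (hα : α ∈ Ioo (0 : ℝ) 1)
    (hlim : Tendsto A atTop (𝓝 α)) {w v : ℝ → ℝ} (hw : Trajectory n a f α w v) :
    ∃ φ : ℕ → ℕ, StrictMono φ ∧ TendstoUniformlyOn (fun k => W (φ k)) w atTop (Icc 0 R) ∧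
      TendstoUniformlyOn (fun k => V (φ k)) v atTop (Icc 0 R) := by
  obtain ⟨K, hK⟩ := hf.exists_bound_le (speed a f * R)
  have hs := fun k => (hW k).radialSol R
  obtain ⟨φ, hφ, w', v', h', h0', hu, hu'⟩ := exists_subseq_tendsto_radialSol (d := -α) (K := K) ha
    hf.cont hR (y := W) (fun k => (hs k).cont_w) (fun k => (hs k).cont_v) (fun k => (hs k).v_zero)
    (fun k => (hs k).deriv_w) (fun k => (hs k).deriv_v)
    (fun k r hr => hK _ (hf.le_speed_mul ha (hs k) (hA k) (hW k).w_zero hr))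
    (fun ε hε => Eventually.of_forall fun k r _ => by simpa using hε.le)
    (by simp only [(hW _).w_zero]; exact hlim.neg)
  obtain ⟨e1, e2⟩ := hf.unique ha h' (hw.radialSol R) hα h0' hw.w_zero
  exact ⟨φ, hφ, hu.congr_right e1, hu'.congr_right e2⟩

end Restoring

/-! ### Counting critical points, and the shooting argument -/

/-- `t 0 = 0 < t 1 < ⋯ < t j` are zeros of `v`. -/
structure CritChain (v : ℝ → ℝ) (j : ℕ) (t : ℕ → ℝ) : Prop where
  zero : t 0 = 0
  lt_succ : ∀ i < j, t i < t (i + 1)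
  v_eq : ∀ i ≤ j, v (t i) = 0

namespace CritChain

variable {v : ℝ → ℝ} {j : ℕ} {t : ℕ → ℝ}

lemma mono (h : CritChain v j t) {i k : ℕ} (hik : i ≤ k) (hk : k ≤ j) : t i ≤ t k := by
  induction k, hik using Nat.le_induction with
  | base => exact le_rfl
  | succ k _ ih => exact (ih (by omega)).trans (h.lt_succ k (by omega)).le

lemma lt (h : CritChain v j t) {i k : ℕ} (hik : i < k) (hk : k ≤ j) : t i < t k :=
  (h.lt_succ i (by omega)).trans_le (h.mono (Nat.succ_le_of_lt hik) hk)

lemma nonneg (h : CritChain v j t) {i : ℕ} (hi : i ≤ j) : 0 ≤ t i :=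
  h.zero ▸ h.mono (Nat.zero_le i) hi

lemma insert (h : CritChain v j t) {i : ℕ} (hi : i < j) {y : ℝ} (hy : y ∈ Ioo (t i) (t (i + 1)))
    (hv : v y = 0) :
    CritChain v (j + 1) (fun m => if m ≤ i then t m else if m = i + 1 then y else t (m - 1)) where
  zero := by simp [h.zero]
  lt_succ m hm := by
    rcases lt_trichotomy m i with h1 | h1 | h1
    · simp [h1.le, show m + 1 ≤ i by omega, h.lt_succ m (by omega)]
    · subst h1; simp [hy.1]
    · rcases (Nat.succ_le_of_lt h1).eq_or_lt with h2 | h2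
      · subst h2; simp [hy.2]
      · have h3 : ¬ m ≤ i := by omega
        have h4 : m ≠ i + 1 := by omega
        have h5 : ¬ m + 1 ≤ i := by omega
        have h6 : m + 1 ≠ i + 1 := by omega
        simp only [h3, h4, h5, h6, if_false, Nat.add_sub_cancel]
        have := h.lt_succ (m - 1) (by omega)
        rwa [Nat.sub_add_cancel (by omega)] at this
  v_eq m hm := by
    split_ifs with h1 h2
    · exact h.v_eq m (by omega)
    · exact hv
    · exact h.v_eq _ (by omega)

lemma exists_mem_Ico (h : CritChain v j t) {x : ℝ} (hx : 0 ≤ x) (hxj : x < t j) :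
    ∃ i < j, t i ≤ x ∧ x < t (i + 1) := by
  have hex : ∃ k, x < t k := ⟨j, hxj⟩
  obtain ⟨k, hk, hmin⟩ : ∃ k, x < t k ∧ ∀ m < k, ¬ x < t m := by
    classical
    exact ⟨Nat.find hex, Nat.find_spec hex, fun m hm => Nat.find_min hex hm⟩
  have hk0 : k ≠ 0 := by rintro rfl; rw [h.zero] at hk; linarith
  have hkj : k ≤ j := by by_contra hc; exact hmin j (by omega) hxj
  exact ⟨k - 1, by omega, not_lt.1 (hmin (k - 1) (by omega)), by
    rwa [Nat.sub_add_cancel (by omega)]⟩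

end CritChain

namespace Restoring

variable {n : ℕ} {a R α : ℝ} {f w v : ℝ → ℝ}

/-- When the `j`-th critical point is exactly `R`, the solution has exactly `j` zeros. -/
lemma encard_zeros (hf : Restoring f) (ha : 0 < a) (h : Trajectory n a f α w v)
    (hα : α ∈ Ioo (0 : ℝ) 1) {j : ℕ} {t : ℕ → ℝ} (ht : CritChain v j t) (htR : t j ≤ R)
    (hmax : ∀ t, CritChain v j t → R ≤ t j) :
    v R = 0 ∧ {r ∈ Icc 0 R | w r = 0}.encard = j := by
  have hR : t j = R := le_antisymm htR (hmax t ht)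
  have hs := h.radialSol R
  have hmem : ∀ i ≤ j, t i ∈ Icc 0 R := fun i hi => ⟨ht.nonneg hi, (ht.mono hi le_rfl).trans htR⟩
  refine ⟨hR ▸ ht.v_eq j le_rfl, ?_⟩
  have hne : ∀ i ≤ j, w (t i) ≠ 0 := fun i hi =>
    hf.ne_zero_of_v_eq_zero ha hs hα h.w_zero (hmem i hi) (ht.v_eq i hi)
  have hex : ∀ i, ∃ c, i < j → c ∈ Ioo (t i) (t (i + 1)) ∧ w c = 0 := fun i => by
    by_cases hi : i < j
    · obtain ⟨c, hc, hc'⟩ := hs.exists_f_eq_zero (hmem i hi.le).1 (ht.lt_succ i hi)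
        (hmem (i + 1) hi).2 (by rw [ht.v_eq i hi.le, ht.v_eq (i + 1) hi])
      exact ⟨c, fun _ => ⟨hc, hf.eq_zero (hf.neg_one_lt ha hs hα h.w_zero
        ⟨(hmem i hi.le).1.trans hc.1.le, hc.2.le.trans (hmem (i + 1) hi).2⟩) hc'⟩⟩
    · exact ⟨0, fun hi' => absurd hi' hi⟩
  choose c hc using hex
  have himg : {r ∈ Icc 0 R | w r = 0} = c '' (Finset.range j : Set ℕ) := by
    ext x
    constructor
    · rintro ⟨hx, hwx⟩
      have hxR : x < t j := by
        rw [hR]; exact hx.2.lt_of_ne fun e => hne j le_rfl (by rw [hR, ← e, hwx])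
      obtain ⟨i, hi, h1, h2⟩ := ht.exists_mem_Ico hx.1 hxR
      have h1' : t i < x := h1.lt_of_ne fun e => hne i hi.le (by rw [e, hwx])
      refine ⟨i, by simpa using hi, ?_⟩
      obtain ⟨hci, hwc⟩ := hc i hi
      by_contra hne'
      obtain ⟨y, hy, hvy⟩ : ∃ y ∈ Ioo (t i) (t (i + 1)), v y = 0 := by
        rcases lt_or_gt_of_ne hne' with hlt | hlt
        · obtain ⟨y, hy, hvy⟩ := hs.exists_v_eq_zero ((hmem i hi.le).1.trans hci.1.le) hlt hx.2
            (hwc.trans hwx.symm)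
          exact ⟨y, ⟨hci.1.trans hy.1, hy.2.trans h2⟩, hvy⟩
        · obtain ⟨y, hy, hvy⟩ := hs.exists_v_eq_zero hx.1 hlt
            (hci.2.le.trans (hmem (i + 1) hi).2) (hwx.trans hwc.symm)
          exact ⟨y, ⟨h1'.trans hy.1, hy.2.trans hci.2⟩, hvy⟩
      -- Two zeros of w between neighbouring critical points would give an additional critical
      -- point. The enlarged chain still ends at R, now with index j + 1, so its j-th entry lies
      -- before R, against minimality.
      have hins := ht.insert hi hy hvy
      set t' := fun m => if m ≤ i then t m else if m = i + 1 then y else t (m - 1) with ht'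
      have hj := hmax t' ⟨hins.zero, fun i hi => hins.lt_succ i (by omega),
        fun i hi => hins.v_eq i (by omega)⟩
      have hj' := hins.lt_succ j (by omega)
      have e : t' (j + 1) = R := by
        simp only [ht']
        rw [if_neg (by omega), if_neg (by omega), Nat.add_sub_cancel, hR]
      rw [e] at hj'
      linarith
    · rintro ⟨i, hi, rfl⟩
      have hi' : i < j := by simpa using hi
      obtain ⟨hci, hwc⟩ := hc i hi'
      exact ⟨⟨(hmem i hi'.le).1.trans hci.1.le, hci.2.le.trans (hmem (i + 1) hi').2⟩, hwc⟩
  have hinj : InjOn c (Finset.range j : Set ℕ) := by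
    have key : ∀ i k, i < k → k < j → c i < c k := fun i k hik hk =>
      (hc i (hik.trans hk)).1.2.trans_le ((ht.mono hik hk.le).trans (hc k hk).1.1.le)
    intro i hi k hk e
    have hi' : i < j := by simpa using hi
    have hk' : k < j := by simpa using hk
    rcases lt_trichotomy i k with hlt | heq | hlt
    · exact absurd e (key i k hlt hk').ne
    · exact heq
    · exact absurd e (key k i hlt hi').ne'
  rw [himg, hinj.encard_image, encard_coe_eq_coe_finsetCard, Finset.card_range]

variable {W V : ℝ → ℝ → ℝ}

/-- The closed half of the shooting argument: limits of critical points are critical points. Two of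
them cannot merge, because the zero of w squeezed between them would become a common zero of w and
v. -/
lemma exists_critChain_of_tendsto (hf : Restoring f) (ha : 0 < a) (hR : 0 < R)
    (hW : ∀ α ∈ Ioo (0 : ℝ) 1, Trajectory n a f α (W α) (V α)) {A : ℕ → ℝ}
    (hA : ∀ k, A k ∈ Ioo (0 : ℝ) 1) (hα : α ∈ Ioo (0 : ℝ) 1) (hlim : Tendsto A atTop (𝓝 α))
    {j : ℕ} (hch : ∀ k, ∃ t, CritChain (V (A k)) j t ∧ t j ≤ R) :
    ∃ t, CritChain (V α) j t ∧ t j ≤ R := by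
  obtain ⟨φ, hφ, hu, hu'⟩ := hf.exists_subseq_tendsto ha hR hA (fun k => hW _ (hA k)) hα hlim
    (hW α hα)
  have hs := (hW α hα).radialSol R
  have h0 := (hW α hα).w_zero
  choose t ht htR using hch
  have hmem : ∀ k, ∀ i ≤ j, t k i ∈ Icc 0 R := fun k i hi =>
    ⟨(ht k).nonneg hi, ((ht k).mono hi le_rfl).trans (htR k)⟩
  -- Indices above j are replaced by j, so that the whole sequence lies in a product of compact
  -- intervals.
  obtain ⟨τ, hτ, ψ, hψ, hlimτ⟩ := (isCompact_univ_pi (fun _ : ℕ => isCompact_Icc (a := (0 : ℝ))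
    (b := R))).tendsto_subseq (x := fun k i => t (φ k) (min i j))
    (fun k i _ => hmem _ _ (min_le_right _ _))
  have hτmem : ∀ i, τ i ∈ Icc 0 R := fun i => hτ i (mem_univ i)
  have hτlim : ∀ i ≤ j, Tendsto (fun k => t (φ (ψ k)) i) atTop (𝓝 (τ i)) := fun i hi => by
    have := (tendsto_pi_nhds.1 hlimτ) i
    simpa [min_eq_left hi] using this
  have hcv : ∀ {G : ℕ → ℝ → ℝ} {g : ℝ → ℝ} {x : ℕ → ℝ} {y : ℝ},
      TendstoUniformlyOn (fun k => G (φ k)) g atTop (Icc 0 R) → ContinuousOn g (Icc 0 R) →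
      (∀ k, x k ∈ Icc 0 R) → y ∈ Icc 0 R → Tendsto x atTop (𝓝 y) →
      Tendsto (fun k => G (φ (ψ k)) (x k)) atTop (𝓝 (g y)) := by
    intro G g x y hG hg hx hy hxy
    rw [Metric.tendsto_atTop]
    intro ε hε
    have h1 : ∀ᶠ k in atTop, ∀ r ∈ Icc 0 R, dist (g r) (G (φ (ψ k)) r) < ε / 2 :=
      hψ.tendsto_atTop.eventually (Metric.tendstoUniformlyOn_iff.1 hG (ε / 2) (half_pos hε))
    have h2 : Tendsto (fun k => g (x k)) atTop (𝓝 (g y)) :=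
      (hg y hy).tendsto.comp (tendsto_nhdsWithin_iff.2 ⟨hxy, Eventually.of_forall hx⟩)
    have h3 := Metric.tendsto_nhds.1 h2 (ε / 2) (half_pos hε)
    refine eventually_atTop.1 ?_
    filter_upwards [h1, h3] with k h1 h3
    have := dist_triangle (G (φ (ψ k)) (x k)) (g (x k)) (g y)
    have h4 := h1 (x k) (hx k)
    rw [dist_comm] at h4
    linarith
  have hvτ : ∀ i ≤ j, V α (τ i) = 0 := fun i hi => by
    have := hcv (G := fun k => V (A k)) hu' hs.cont_v (fun k => hmem (φ (ψ k)) i hi) (hτmem i)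
      (hτlim i hi)
    refine tendsto_nhds_unique this (tendsto_const_nhds.congr fun k => ?_)
    exact ((ht (φ (ψ k))).v_eq i hi).symm
  refine ⟨τ, ⟨?_, fun i hi => ?_, hvτ⟩, (hτmem j).2⟩
  · refine tendsto_nhds_unique (hτlim 0 (Nat.zero_le _)) (tendsto_const_nhds.congr fun k => ?_)
    exact ((ht _).zero).symm
  have hle : τ i ≤ τ (i + 1) := le_of_tendsto_of_tendsto' (hτlim i hi.le) (hτlim (i + 1) hi)
    fun k => ((ht _).lt_succ i hi).le
  refine hle.lt_of_ne fun heq => ?_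
  have hc : ∀ k, ∃ c ∈ Ioo (t k i) (t k (i + 1)), W (A k) c = 0 := fun k => by
    have hsk := (hW _ (hA k)).radialSol R
    obtain ⟨c, hc, hc'⟩ := hsk.exists_f_eq_zero (hmem k i hi.le).1 ((ht k).lt_succ i hi)
      (hmem k (i + 1) hi).2 (by rw [(ht k).v_eq i hi.le, (ht k).v_eq (i + 1) hi])
    exact ⟨c, hc, hf.eq_zero (hf.neg_one_lt ha hsk (hA k) (hW _ (hA k)).w_zero
        ⟨(hmem k i hi.le).1.trans hc.1.le, hc.2.le.trans (hmem k (i + 1) hi).2⟩) hc'⟩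
  choose c hc hwc using hc
  have hclim : Tendsto (fun k => c (φ (ψ k))) atTop (𝓝 (τ i)) :=
    tendsto_of_tendsto_of_tendsto_of_le_of_le (hτlim i hi.le) (heq ▸ hτlim (i + 1) hi)
      (fun k => (hc _).1.le) (fun k => (hc _).2.le)
  have hw0 : W α (τ i) = 0 := by
    have := hcv (G := fun k => W (A k)) hu hs.cont_w
      (fun k => ⟨(hmem (φ (ψ k)) i hi.le).1.trans (hc _).1.le,
        (hc _).2.le.trans (hmem (φ (ψ k)) (i + 1) hi).2⟩) (hτmem i) hclim
    refine tendsto_nhds_unique this (tendsto_const_nhds.congr fun k => ?_)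
    exact (hwc _).symm
  exact hf.ne_zero_of_v_eq_zero ha hs hα h0 (hτmem i) (hvτ i hi.le) hw0

/-- Critical points are transversal: v' = -t^n f(w) is nonzero at a positive zero of v because w ≠ 0
there. -/
lemma eventually_mul_neg_of_v_eq_zero (hf : Restoring f) (ha : 0 < a)
    (h : Trajectory n a f α w v) (hα : α ∈ Ioo (0 : ℝ) 1) {t : ℝ} (ht : 0 < t) (hv : v t = 0) :
    ∀ᶠ ε in 𝓝[>] (0 : ℝ), v (t - ε) * v (t + ε) < 0 := by
  have hs := h.radialSol (t + 1)
  have htR : t ∈ Icc 0 (t + 1) := ⟨ht.le, by linarith⟩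
  have hd := hs.deriv_v t ⟨ht, by linarith⟩
  have hne : -(t ^ n * f (w t)) ≠ 0 := by
    refine neg_ne_zero.2 (mul_ne_zero (pow_pos ht n).ne' fun h' => ?_)
    exact hf.ne_zero_of_v_eq_zero ha hs hα h.w_zero htR hv
      (hf.eq_zero (hf.neg_one_lt ha hs hα h.w_zero htR) h')
  set c := -(t ^ n * f (w t)) with hc
  have hlo := hasDerivAt_iff_tendsto_slope_zero.1 hd
  have hpos : Tendsto (fun ε : ℝ => c * (ε⁻¹ • (v (t + ε) - v t))) (𝓝[>] 0) (𝓝 (c * c)) :=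
    (hlo.mono_left (nhdsWithin_mono _ fun x hx => ne_of_gt hx)).const_mul c
  have hneg : Tendsto (fun ε : ℝ => c * ((-ε)⁻¹ • (v (t + -ε) - v t))) (𝓝[>] 0) (𝓝 (c * c)) := by
    refine (hlo.comp (f := fun ε : ℝ => -ε) ?_).const_mul c
    refine tendsto_nhdsWithin_iff.2 ⟨?_, ?_⟩
    · have : Tendsto (fun ε : ℝ => -ε) (𝓝 0) (𝓝 (-0)) := continuous_neg.tendsto 0
      rw [neg_zero] at this
      exact this.mono_left nhdsWithin_le_nhds
    · filter_upwards [self_mem_nhdsWithin] with ε hε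
      exact neg_ne_zero.2 (ne_of_gt hε)
  have hcc : 0 < c * c := mul_self_pos.2 hne
  filter_upwards [hpos.eventually (lt_mem_nhds hcc), hneg.eventually (lt_mem_nhds hcc),
    self_mem_nhdsWithin] with ε h1 h2 hε
  have hε0 : 0 < ε := hε
  rw [hv, sub_zero, smul_eq_mul] at h1 h2
  rw [sub_eq_add_neg]
  have h3 : 0 < c * v (t + ε) := by
    have := mul_pos h1 hε0
    have e : c * (ε⁻¹ * v (t + ε)) * ε = c * v (t + ε) := by field_simp
    rwa [e] at this
  have h4 : c * v (t + -ε) < 0 := by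
    have := mul_pos h2 hε0
    have e : c * ((-ε)⁻¹ * v (t + -ε)) * ε = -(c * v (t + -ε)) := by
      rw [inv_neg]; field_simp
    rw [e] at this; linarith
  have h5 : c * c * (v (t + -ε) * v (t + ε)) < 0 := by nlinarith
  by_contra! h6
  exact absurd h5 (not_lt.2 (mul_nonneg hcc.le h6))

/-- The open half: the sign changes of v at t_1, ..., t_j survive small uniform perturbations and
produce nearby zeros. The entry t_0 = 0 needs no sign change, since every flux vanishes at 0. -/
lemma exists_critChain_lt_of_tendsto (hf : Restoring f) (ha : 0 < a) (hR : 0 < R)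
    (hW : ∀ α ∈ Ioo (0 : ℝ) 1, Trajectory n a f α (W α) (V α)) {A : ℕ → ℝ}
    (hA : ∀ k, A k ∈ Ioo (0 : ℝ) 1) (hα : α ∈ Ioo (0 : ℝ) 1) (hlim : Tendsto A atTop (𝓝 α))
    {j : ℕ} {t : ℕ → ℝ} (ht : CritChain (V α) j t) (htR : t j < R) :
    ∃ k, ∃ t, CritChain (V (A k)) j t ∧ t j < R := by
  obtain ⟨φ, hφ, -, hu'⟩ := hf.exists_subseq_tendsto ha hR hA (fun k => hW _ (hA k)) hα hlim
    (hW α hα)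
  have hpos : ∀ i, 1 ≤ i → i ≤ j → 0 < t i := fun i h1 hi => ht.zero ▸ ht.lt h1 hi
  have hev : ∀ᶠ ε in 𝓝[>] (0 : ℝ), (∀ i ∈ Finset.range (j + 1), 1 ≤ i →
      V α (t i - ε) * V α (t i + ε) < 0) ∧ (∀ i ∈ Finset.range j, t i + ε < t (i + 1) - ε) ∧
      t j + ε < R := by
    refine ((Finset.eventually_all _).2 fun i hi => ?_).and
      (((Finset.eventually_all _).2 fun i hi => ?_).and ?_)
    · rcases Nat.eq_zero_or_pos i with rfl | h1
      · exact Eventually.of_forall fun ε h => absurd h (by norm_num)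
      · have hi' : i ≤ j := by simpa [Nat.lt_succ_iff] using hi
        filter_upwards [hf.eventually_mul_neg_of_v_eq_zero ha (hW α hα) hα (hpos i h1 hi')
          (ht.v_eq i hi')] with ε h _ using h
    · have := ht.lt_succ i (by simpa using hi)
      filter_upwards [Ioo_mem_nhdsGT (show 0 < (t (i + 1) - t i) / 2 by linarith)] with ε hε
      linarith [hε.2]
    · filter_upwards [Ioo_mem_nhdsGT (show 0 < R - t j by linarith)] with ε hε
      linarith [hε.2]
  obtain ⟨ε, ⟨h1, h2, h3⟩, hε⟩ := (hev.and self_mem_nhdsWithin).exists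
  have hε0 : 0 < ε := hε
  have hloc : ∀ i, 1 ≤ i → i ≤ j → 0 ≤ t i - ε ∧ t i + ε ≤ R := fun i hi hij => by
    refine ⟨?_, ?_⟩
    · have := h2 (i - 1) (Finset.mem_range.2 (by omega))
      rw [Nat.sub_add_cancel hi] at this
      linarith [ht.nonneg (i := i - 1) (by omega)]
    · linarith [ht.mono hij le_rfl]
  have hk : ∀ᶠ k in atTop, ∀ i ∈ Finset.range (j + 1), 1 ≤ i →
      V (A (φ k)) (t i - ε) * V (A (φ k)) (t i + ε) < 0 := by
    refine (Finset.eventually_all _).2 fun i hi => ?_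
    rcases Nat.eq_zero_or_pos i with rfl | hi1
    · exact Eventually.of_forall fun ε h => absurd h (by norm_num)
    · have hi' : i ≤ j := by simpa [Nat.lt_succ_iff] using hi
      obtain ⟨hl, hr⟩ := hloc i hi1 hi'
      have := (hu'.tendsto_at (x := t i - ε) ⟨hl, by linarith⟩).mul
        (hu'.tendsto_at (x := t i + ε) ⟨by linarith, hr⟩)
      filter_upwards [this.eventually (gt_mem_nhds (h1 i hi hi1))] with k hk _ using hk
  obtain ⟨k, hk⟩ := hk.exists
  have hs := (hW _ (hA (φ k))).radialSol R
  have hex : ∀ i, ∃ c, (i = 0 → c = 0) ∧ (1 ≤ i → i ≤ j → c ∈ Ioo (t i - ε) (t i + ε) ∧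
      V (A (φ k)) c = 0) := fun i => by
    by_cases hi : 1 ≤ i ∧ i ≤ j
    · obtain ⟨hl, hr⟩ := hloc i hi.1 hi.2
      have hsgn := hk i (Finset.mem_range.2 (by omega)) hi.1
      have hcont := hs.cont_v.mono (Icc_subset_Icc hl hr)
      have hle : t i - ε ≤ t i + ε := by linarith
      obtain ⟨c, hc, hc'⟩ : (0 : ℝ) ∈ V (A (φ k)) '' Ioo (t i - ε) (t i + ε) := by
        rcases mul_neg_iff.1 hsgn with ⟨p, q⟩ | ⟨p, q⟩
        · exact intermediate_value_Ioo' hle hcont ⟨q, p⟩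
        · exact intermediate_value_Ioo hle hcont ⟨p, q⟩
      exact ⟨c, fun h => by omega, fun _ _ => ⟨hc, hc'⟩⟩
    · exact ⟨0, fun _ => rfl, fun h h' => absurd ⟨h, h'⟩ hi⟩
  choose c hc0 hc using hex
  refine ⟨φ k, c, ⟨hc0 0 rfl, fun i hi => ?_, fun i hi => ?_⟩, ?_⟩
  · have hgap := h2 i (Finset.mem_range.2 hi)
    have hr := (hc (i + 1) (by omega) hi).1.1
    rcases Nat.eq_zero_or_pos i with rfl | hi1
    · rw [hc0 0 rfl]
      have := ht.zero
      linarith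
    · linarith [(hc i hi1 hi.le).1.2]
  · rcases Nat.eq_zero_or_pos i with rfl | hi1
    · rw [hc0 0 rfl]; exact hs.v_zero
    · exact (hc i hi1 hi).2
  · rcases Nat.eq_zero_or_pos j with rfl | hj1
    · rw [hc0 0 rfl]; exact hR
    · linarith [(hc j hj1 le_rfl).1.2]

/-- Shooting: between a slowly and a fast rotating trajectory there is one whose `j`-th critical
point is `R`. -/
theorem exists_encard_zeros (hf : Restoring f) (ha : 0 < a) (hR : 0 < R)
    (hW : ∀ α ∈ Ioo (0 : ℝ) 1, Trajectory n a f α (W α) (V α)) {j : ℕ} {α₁ α₂ : ℝ}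
    (h₁ : α₁ ∈ Ioo (0 : ℝ) 1) (h₂ : α₂ ∈ Ioo (0 : ℝ) 1)
    (hfast : ∃ t, CritChain (V α₁) j t ∧ t j < R)
    (hslow : ¬ ∃ t, CritChain (V α₂) j t ∧ t j ≤ R) :
    ∃ α ∈ uIcc α₁ α₂, α ≠ α₁ ∧ α ≠ α₂ ∧ V α R = 0 ∧
      {r ∈ Icc 0 R | W α r = 0}.encard = j := by
  have hsub : uIcc α₁ α₂ ⊆ Ioo (0 : ℝ) 1 := fun x hx =>
    ⟨(lt_min h₁.1 h₂.1).trans_le hx.1, hx.2.trans_lt (max_lt h₁.2 h₂.2)⟩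
  -- S (some t_j ≤ R) and T (no t_j < R) are closed and cover the interval. Connectedness gives a
  -- common point, and there the earliest j-th critical point is exactly R.
  set S := {α ∈ uIcc α₁ α₂ | ∃ t, CritChain (V α) j t ∧ t j ≤ R} with hS
  set T := {α ∈ uIcc α₁ α₂ | ¬ ∃ t, CritChain (V α) j t ∧ t j < R} with hT
  have hSc : IsClosed S := by
    refine IsSeqClosed.isClosed fun A α hA hlim => ?_
    have hmem : α ∈ uIcc α₁ α₂ := isClosed_Icc.isSeqClosed (fun k => (hA k).1) hlim
    exact ⟨hmem, hf.exists_critChain_of_tendsto ha hR hW (fun k => hsub (hA k).1) (hsub hmem) hlim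
      fun k => (hA k).2⟩
  have hTc : IsClosed T := by
    refine IsSeqClosed.isClosed fun A α hA hlim => ?_
    have hmem : α ∈ uIcc α₁ α₂ := isClosed_Icc.isSeqClosed (fun k => (hA k).1) hlim
    refine ⟨hmem, ?_⟩
    rintro ⟨t, ht, htR⟩
    obtain ⟨k, hk⟩ := hf.exists_critChain_lt_of_tendsto ha hR hW (fun k => hsub (hA k).1)
      (hsub hmem) hlim ht htR
    exact (hA k).2 hk
  obtain ⟨α, hα, ⟨-, t, ht, htR⟩, -, hTα⟩ := isPreconnected_closed_iff.1
    (isPreconnected_uIcc (a := α₁) (b := α₂)) S T hSc hTc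
    (fun x hx => by
      by_cases h : ∃ t, CritChain (V x) j t ∧ t j < R
      · obtain ⟨t, ht, htR⟩ := h
        exact Or.inl ⟨hx, t, ht, htR.le⟩
      · exact Or.inr ⟨hx, h⟩)
    ⟨α₁, left_mem_uIcc, left_mem_uIcc, by
      obtain ⟨t, ht, htR⟩ := hfast; exact ⟨t, ht, htR.le⟩⟩
    ⟨α₂, right_mem_uIcc, right_mem_uIcc, by
      rintro ⟨t, ht, htR⟩; exact hslow ⟨t, ht, htR.le⟩⟩
  refine ⟨α, hα, ?_, ?_, hf.encard_zeros ha (hW α (hsub hα)) (hsub hα) ht htR fun t ht => ?_⟩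
  · rintro rfl; exact hTα hfast
  · rintro rfl; exact hslow ⟨t, ht, htR⟩
  · by_contra! hlt; exact hTα ⟨t, ht, hlt⟩

end Restoring

/-! ### Slow trajectories -/

lemma exists_first_hit {g : ℝ → ℝ} {b R c : ℝ} (hg : ContinuousOn g (Icc b R)) (hb : g b < c)
    (h : ∃ r ∈ Icc b R, c ≤ g r) : ∃ s ∈ Ioc b R, g s = c ∧ ∀ t ∈ Ico b s, g t < c := by
  obtain ⟨r, hr, hcr⟩ := h
  set S := {t ∈ Icc b R | g t = c} with hS
  have hne : S.Nonempty := by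
    obtain ⟨t, ht, htc⟩ := intermediate_value_Icc hr.1 (hg.mono (Icc_subset_Icc_right hr.2))
      ⟨hb.le, hcr⟩
    exact ⟨t, ⟨ht.1, ht.2.trans hr.2⟩, htc⟩
  have hcl : IsClosed S := by
    have := hg.preimage_isClosed_of_isClosed isClosed_Icc (isClosed_singleton (x := c))
    exact this
  have hbdd : BddBelow S := ⟨b, fun t ht => ht.1.1⟩
  have hmem := hcl.csInf_mem hne hbdd
  have hlt : b < sInf S := hmem.1.1.lt_of_ne fun e => by rw [e, hmem.2] at hb; exact lt_irrefl _ hb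
  refine ⟨sInf S, ⟨hlt, hmem.1.2⟩, hmem.2, fun t ht => ?_⟩
  by_contra! hct
  obtain ⟨x, hx, hxc⟩ := intermediate_value_Icc ht.1
    (hg.mono (Icc_subset_Icc_right (ht.2.le.trans hmem.1.2))) ⟨hb.le, hct⟩
  exact absurd (csInf_le hbdd ⟨⟨hx.1, hx.2.trans (ht.2.le.trans hmem.1.2)⟩, hxc⟩)
    (not_le.2 (hx.2.trans_lt ht.2))

namespace Restoring

variable {n : ℕ} {a R α : ℝ} {f w v : ℝ → ℝ}

lemma not_exists_critChain_of_neg (hf : Restoring f) (ha : 0 < a) (h : Trajectory n a f α w v)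
    (hα : α ∈ Ioo (0 : ℝ) 1) (hneg : ∀ r ∈ Icc 0 R, w r < 0) {j : ℕ} (hj : 1 ≤ j) :
    ¬ ∃ t, CritChain v j t ∧ t j ≤ R := by
  rintro ⟨t, ht, htR⟩
  have h1 : t 1 ≤ R := (ht.mono hj le_rfl).trans htR
  have hs := h.radialSol R
  obtain ⟨c, hc, hfc⟩ := hs.exists_f_eq_zero (ht.nonneg (Nat.zero_le _)) (ht.lt_succ 0 hj) h1
    (by rw [ht.v_eq 0 (Nat.zero_le _), ht.v_eq 1 hj])
  have hcR : c ∈ Icc 0 R := ⟨(ht.nonneg (Nat.zero_le _)).trans hc.1.le, hc.2.le.trans h1⟩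
  exact (hneg c hcR).ne (hf.eq_zero (hf.neg_one_lt ha hs hα h.w_zero hcR) hfc)

/-- Trajectories starting close to `-1` stay close to `-1` for a long time. -/
lemma exists_forall_lt_of_near_one (hf : Restoring f) (ha : 0 < a) {C : ℝ}
    (hC : ∀ s ∈ Ioo (-1 : ℝ) 0, -f s ≤ C * (1 + s) ^ a) {η : ℝ} (hη : η ∈ Ico (0 : ℝ) 1)
    (hR : 0 < R) : ∃ α₀ < 1, ∀ α ∈ Ioo (0 : ℝ) 1, α₀ < α → ∀ w v, Trajectory n a f α w v →
      ∀ r ∈ Icc 0 R, w r < -η := by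
  have hb : 0 < a⁻¹ := inv_pos.2 ha
  have hC0 : 0 ≤ C := by
    have h1 := hC (-1 / 2) ⟨by norm_num, by norm_num⟩
    have h2 := hf.neg (-1 / 2) (by norm_num) (by norm_num)
    have h3 : (0 : ℝ) < (1 + (-1 / 2)) ^ a := by positivity
    by_contra! hneg
    nlinarith
  set K := (C * R) ^ a⁻¹ with hK
  have hK0 : 0 ≤ K := by positivity
  -- While w < 0 the profile increases, so the flux up to t is at most C R (1 + w t)^a and w' ≤ K (1
  -- + w). Then 1 + w grows at most by the factor exp(K R) from its initial value 1 - α, and α₀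
  -- makes this fall short of 1 - η.
  refine ⟨max η (1 - Real.exp (-(K * R)) * (1 - η)), ?_, fun α hα hα0 w v h r hr => ?_⟩
  · have : 0 < Real.exp (-(K * R)) * (1 - η) := mul_pos (Real.exp_pos _) (by linarith [hη.2])
    exact max_lt hη.2 (by linarith)
  have hs := h.radialSol R
  by_contra! hge
  obtain ⟨s, hsR, hws, hlt⟩ := exists_first_hit (c := -η) hs.cont_w
    (by rw [h.w_zero]; linarith [(le_max_left _ _).trans_lt hα0]) ⟨r, hr, hge⟩
  have hw1 : ∀ t ∈ Icc 0 R, -1 < w t := fun t ht => hf.neg_one_lt ha hs hα h.w_zero ht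
  have hwneg : ∀ t ∈ Ico 0 s, w t < 0 := fun t ht => (hlt t ht).trans_le (by linarith [hη.1])
  have hfneg : ∀ t ∈ Ico 0 s, 0 < -f (w t) := fun t ht =>
    neg_pos.2 (hf.neg _ (hw1 t ⟨ht.1, ht.2.le.trans hsR.2⟩) (hwneg t ht))
  have hvnn : ∀ t ∈ Ico 0 s, 0 ≤ v t := fun t ht => by
    have := hs.mul_pow_sub_le_v_sub (c := 0) le_rfl ht.1 (ht.2.le.trans hsR.2)
      (fun x hx => (hfneg x ⟨hx.1.le, hx.2.trans ht.2⟩).le)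
    rw [hs.v_zero] at this; linarith
  have hmono : ∀ x ∈ Icc 0 s, ∀ y ∈ Ico 0 s, x ≤ y → w x ≤ w y := fun x hx y hy hxy =>
    le_of_hasDerivAt_nonneg hxy (hs.cont_w.mono (Icc_subset_Icc hx.1 (hy.2.le.trans hsR.2)))
      (fun z hz => hs.deriv_w z ⟨hx.1.trans_lt hz.1, hz.2.trans (hy.2.trans_le hsR.2)⟩)
      (fun z hz => by
        have := hvnn z ⟨hx.1.trans hz.1.le, hz.2.trans hy.2⟩
        have h0 : 0 < z := hx.1.trans_lt hz.1
        rw [spow_of_nonneg hb (by positivity)]; positivity)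
  have hder : ∀ t ∈ Ioo 0 s, spow a⁻¹ (v t / t ^ n) ≤ K * (1 + w t) := fun t ht => by
    have htR : t ∈ Icc 0 R := ⟨ht.1.le, ht.2.le.trans hsR.2⟩
    have hu : 0 < 1 + w t := by linarith [hw1 t htR]
    have h1 := hs.abs_flux_le htR (K := C * (1 + w t) ^ a) fun x hx => by
      have hx' : x ∈ Ico 0 s := ⟨hx.1.le, hx.2.trans ht.2⟩
      have hx1 := hw1 x ⟨hx.1.le, hx.2.le.trans htR.2⟩
      rw [← abs_neg, abs_of_pos (hfneg x hx')]
      refine (hC _ ⟨hx1, hwneg x hx'⟩).trans (mul_le_mul_of_nonneg_left ?_ hC0)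
      refine Real.rpow_le_rpow (by linarith) ?_ ha.le
      linarith [hmono x ⟨hx.1.le, hx'.2.le⟩ t ⟨ht.1.le, ht.2⟩ hx.2.le]
    refine (le_abs_self _).trans ?_
    rw [abs_spow hb]
    calc |v t / t ^ n| ^ a⁻¹ ≤ (C * R * (1 + w t) ^ a) ^ a⁻¹ := by
          refine Real.rpow_le_rpow (abs_nonneg _) (h1.trans ?_) hb.le
          have : 0 ≤ C * (1 + w t) ^ a := by positivity
          nlinarith [mul_le_mul_of_nonneg_left htR.2 this]
      _ = K * (1 + w t) := by
          rw [Real.mul_rpow (by positivity) (by positivity), Real.rpow_rpow_inv hu.le ha.ne']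
  have hfin := le_of_hasDerivAt_nonneg (f := fun t => -(Real.exp (-(K * t)) * (1 + w t)))
    (f' := fun t => -(Real.exp (-(K * t)) * (-(K * 1)) * (1 + w t) +
      Real.exp (-(K * t)) * spow a⁻¹ (v t / t ^ n))) hsR.1.le
    (ContinuousOn.neg (ContinuousOn.mul (by fun_prop) (continuousOn_const.add
      (hs.cont_w.mono (Icc_subset_Icc_right hsR.2)))))
    (fun t ht => ((((hasDerivAt_id' t).const_mul K).neg.exp).mul
      ((hs.deriv_w t ⟨ht.1, ht.2.trans_le hsR.2⟩).const_add 1)).neg)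
    (fun t ht => by
      have h1 := hder t ht
      have h2 := Real.exp_pos (-(K * t))
      nlinarith [mul_le_mul_of_nonneg_left h1 h2.le])
  simp only [mul_zero, neg_zero, Real.exp_zero, one_mul, h.w_zero, hws] at hfin
  have h3 : Real.exp (-(K * R)) ≤ Real.exp (-(K * s)) :=
    Real.exp_le_exp.2 (neg_le_neg (mul_le_mul_of_nonneg_left hsR.2 hK0))
  have h4 : 1 - Real.exp (-(K * R)) * (1 - η) < α := (le_max_right _ _).trans_lt hα0
  nlinarith [mul_le_mul_of_nonneg_right h3 (by linarith [hη.2] : 0 ≤ 1 - η)]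

/-- When `f` is of smaller order than `|s| ^ a` at the origin, trajectories starting close to the
origin keep their sign for a long time. -/
lemma exists_forall_neg_of_near_zero (hf : Restoring f) (ha : 0 < a)
    (hsmall : ∀ ε > 0, ∃ δ > 0, ∀ s ∈ Ioo (-δ) 0, -f s ≤ ε * |s| ^ a)
    (hR : 0 < R) : ∃ α₀ > 0, ∀ α ∈ Ioo (0 : ℝ) 1, α < α₀ → ∀ w v, Trajectory n a f α w v →
      ∀ r ∈ Icc 0 R, w r < 0 := by
  have hb : 0 < a⁻¹ := inv_pos.2 ha
  -- Chosen so that the slope is at most α / (2R). Over a length R the profile climbs by at most α /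
  -- 2 and does not reach 0.
  set ε := (1 / (2 * R)) ^ a / R with hε
  obtain ⟨δ, hδ, H⟩ := hsmall ε (by positivity)
  refine ⟨δ, hδ, fun α hα hαδ w v h r hr => ?_⟩
  have hs := h.radialSol R
  by_contra! hge
  obtain ⟨s, hsR, hws, hlt⟩ := exists_first_hit (c := 0) hs.cont_w
    (by rw [h.w_zero]; linarith [hα.1]) ⟨r, hr, hge⟩
  have hw1 : ∀ t ∈ Icc 0 R, -α ≤ w t := fun t ht => hf.neg_le_of_radialSol ha hs hα h.w_zero ht
  have hder : ∀ t ∈ Ioo 0 s, spow a⁻¹ (v t / t ^ n) ≤ 1 / (2 * R) * α := fun t ht => by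
    have htR : t ∈ Icc 0 R := ⟨ht.1.le, ht.2.le.trans hsR.2⟩
    have h1 := hs.abs_flux_le htR (K := ε * α ^ a) fun x hx => by
      have hx0 := hlt x ⟨hx.1.le, hx.2.trans ht.2⟩
      have hxα := hw1 x ⟨hx.1.le, hx.2.le.trans htR.2⟩
      rw [abs_of_neg (hf.neg _ (by linarith [hα.2]) hx0)]
      refine (H _ ⟨by linarith, hx0⟩).trans (mul_le_mul_of_nonneg_left ?_ (by positivity))
      refine Real.rpow_le_rpow (abs_nonneg _) ?_ ha.le
      rw [abs_of_neg hx0]; linarith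
    refine (le_abs_self _).trans ?_
    rw [abs_spow hb]
    have hα0 := hα.1
    calc |v t / t ^ n| ^ a⁻¹ ≤ ((1 / (2 * R) * α) ^ a) ^ a⁻¹ := by
          refine Real.rpow_le_rpow (abs_nonneg _) (h1.trans ?_) hb.le
          rw [Real.mul_rpow (by positivity) hα0.le, hε]
          have : 0 ≤ (1 / (2 * R)) ^ a / R * α ^ a := by positivity
          calc _ ≤ (1 / (2 * R)) ^ a / R * α ^ a * R := mul_le_mul_of_nonneg_left htR.2 this
            _ = _ := by field_simp
      _ = _ := Real.rpow_rpow_inv (by positivity) ha.ne'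
  have := sub_le_of_hasDerivAt_le hsR.1.le (hs.cont_w.mono (Icc_subset_Icc_right hsR.2))
    (fun t ht => hs.deriv_w t ⟨ht.1, ht.2.trans_le hsR.2⟩) hder
  rw [hws, h.w_zero, sub_zero] at this
  have h2 : 1 / (2 * R) * α * s ≤ 1 / (2 * R) * α * R :=
    mul_le_mul_of_nonneg_left hsR.2 (by have := hα.1; positivity)
  have h3 : 1 / (2 * R) * α * R = α / 2 := by field_simp
  linarith [hα.1]

/-- Trajectories starting close to the origin stay close to the origin. -/
lemma exists_forall_abs_lt (hf : Restoring f) (ha : 0 < a) {δ : ℝ} (hδ : 0 < δ) :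
    ∃ α₀ > 0, ∀ α ∈ Ioo (0 : ℝ) 1, α < α₀ → ∀ w v, Trajectory n a f α w v →
      ∀ r, 0 ≤ r → |w r| < δ := by
  -- F(δ) is the barrier on the right. On the left, w ≥ -α already suffices.
  have hδF : 0 < potential f δ := potential_pos hf.cont zero_mem hf.sign
    (mem_Ioi.2 (by linarith)) hδ.ne'
  have hc : Tendsto (fun α => potential f (-α)) (𝓝 0) (𝓝 0) := by
    have := ((continuous_potential hf.cont).comp continuous_neg).tendsto 0
    simpa [Function.comp_def] using this
  obtain ⟨ε, hε, H⟩ := Metric.eventually_nhds_iff.1 (hc.eventually (gt_mem_nhds hδF))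
  refine ⟨min ε δ, lt_min hε hδ, fun α hα hα0 w v h r hr => ?_⟩
  have hs := h.radialSol r
  have hr' : r ∈ Icc 0 r := ⟨hr, le_rfl⟩
  have h1 := hf.neg_le_of_radialSol ha hs hα h.w_zero hr'
  have h2 := hs.potential_le_potential_zero ha hf.cont hr'
  rw [h.w_zero] at h2
  have h3 := H (y := α) (by
    rw [Real.dist_eq, sub_zero, abs_of_pos hα.1]; exact hα0.trans_le (min_le_left _ _))
  refine abs_lt.2 ⟨by linarith [hα0.trans_le (min_le_right _ _)], ?_⟩
  by_contra! hge
  have h4 : potential f δ ≤ potential f (w r) := by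
    rcases hge.eq_or_lt with e | e
    · rw [← e]
    · exact (potential_lt_of_nonneg hf.cont zero_mem hf.sign hδ.le e
        (mem_Ioi.2 (by linarith))).le
  linarith

end Restoring

/-! ### Fast rotation when f dominates the power -/

lemma pos_or_neg_of_ne_zero {g : ℝ → ℝ} {b c : ℝ} (hg : ContinuousOn g (Ioo b c))
    (h : ∀ x ∈ Ioo b c, g x ≠ 0) : (∀ x ∈ Ioo b c, 0 < g x) ∨ ∀ x ∈ Ioo b c, g x < 0 := by
  by_contra! hcon
  obtain ⟨⟨x, hx, hx'⟩, y, hy, hy'⟩ := hcon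
  obtain ⟨z, hz, hz'⟩ := isPreconnected_Ioo.intermediate_value hx hy hg ⟨hx', hy'⟩
  exact h z hz hz'

lemma nonneg_of_pos_Ioo {g : ℝ → ℝ} {b c : ℝ} (hbc : b < c) (hg : ContinuousOn g (Icc b c))
    (h : ∀ x ∈ Ioo b c, 0 < g x) : ∀ x ∈ Icc b c, 0 ≤ g x := by
  intro x hx
  have hx' : x ∈ closure (Ioo b c) := by rwa [closure_Ioo hbc.ne]
  have : (𝓝[Ioo b c] x).NeBot := mem_closure_iff_nhdsWithin_neBot.1 hx'
  exact ge_of_tendsto ((hg x hx).mono Ioo_subset_Icc_self).tendsto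
    (by filter_upwards [self_mem_nhdsWithin] with y hy using (h y hy).le)

namespace RadialSol

variable {n : ℕ} {a R : ℝ} {f w v : ℝ → ℝ}

/-- An interval on which neither `w` nor `v` vanishes is short. -/
lemma false_of_fast_of_pos (h : RadialSol n a f R w v) (ha : 0 < a) {ρ b L K : ℝ} (hρ : 0 < ρ)
    (hb : ρ ≤ b) (hL : 0 < L) (hbR : b + L ≤ R) (hK : (3 / L) ^ a / (ρ ^ n * L / (2 * R ^ n)) ≤ K)
    (hf : ∀ r ∈ Ioo b (b + L), K * |w r| ^ (a + 1) ≤ w r * f (w r))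
    (hw : ∀ r ∈ Ioo b (b + L), 0 < w r) (hv : ∀ r ∈ Ioo b (b + L), v r ≠ 0) : False := by
  have hi : 0 < a⁻¹ := inv_pos.2 ha
  have hR : 0 < R := by linarith
  have hbL : b < b + L := by linarith
  have hsub : Icc b (b + L) ⊆ Icc 0 R := Icc_subset_Icc (by linarith) hbR
  have hcw := h.cont_w.mono hsub
  have hcv := h.cont_v.mono hsub
  -- The bound on K is arranged so that a drop of v over half the interval forces slopes of at least
  -- 3 w(q) / L over the other half.
  set κ := ρ ^ n * L / (2 * R ^ n) with hκ
  have hκ0 : 0 < κ := by positivity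
  have hKκ : (3 / L) ^ a ≤ K * κ := (div_le_iff₀ hκ0).1 hK
  have hK0 : 0 < K := lt_of_lt_of_le (by positivity) hK
  -- If v > 0, then w ≥ w(q) on the right half; since v stays nonnegative up to the end, v(q) must
  -- be large. As v decreases, the slope on the left half is at least 3 w(q) / L, so w would rise
  -- there by 3 w(q) / 2 and start negative. For v < 0 the two halves exchange roles.
  set q := b + L / 2 with hq
  have hqm : q ∈ Ioo b (b + L) := ⟨by linarith, by linarith⟩
  have hwq := hw q hqm
  have hfw : ∀ r ∈ Ioo b (b + L), K * w r ^ a ≤ f (w r) := fun r hr => by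
    have h1 := hf r hr
    have h2 := hw r hr
    rw [abs_of_pos h2, Real.rpow_add_one h2.ne', ← mul_assoc, mul_comm (w r)] at h1
    exact le_of_mul_le_mul_right h1 h2
  have hfpos : ∀ r ∈ Ioo b (b + L), 0 < f (w r) := fun r hr =>
    lt_of_lt_of_le (mul_pos hK0 (Real.rpow_pos_of_pos (hw r hr) _)) (hfw r hr)
  have hdw : ∀ r ∈ Ioo b (b + L), HasDerivAt w (spow a⁻¹ (v r / r ^ n)) r := fun r hr =>
    h.deriv_w r ⟨by linarith [hr.1], by linarith [hr.2]⟩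
  have hdv : ∀ r ∈ Ioo b (b + L), HasDerivAt v (-(r ^ n * f (w r))) r := fun r hr =>
    h.deriv_v r ⟨by linarith [hr.1], by linarith [hr.2]⟩
  have hwnn := nonneg_of_pos_Ioo hbL hcw hw
  have hslope : ∀ x r : ℝ, 0 < r → r ≤ R → ρ ^ n * (K * w q ^ a) * (L / 2) ≤ x →
      3 / L * w q ≤ spow a⁻¹ (x / r ^ n) := by
    intro x r hr hrR hx
    have h1 : (3 / L * w q) ^ a ≤ x / r ^ n := by
      rw [Real.mul_rpow (by positivity) hwq.le, le_div_iff₀ (pow_pos hr n)]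
      have h2 : r ^ n ≤ R ^ n := pow_le_pow_left₀ hr.le hrR n
      have h3 : 0 < w q ^ a := Real.rpow_pos_of_pos hwq _
      calc (3 / L) ^ a * w q ^ a * r ^ n ≤ K * κ * w q ^ a * R ^ n := by gcongr
        _ = ρ ^ n * (K * w q ^ a) * (L / 2) := by rw [hκ]; field_simp
        _ ≤ x := hx
    have h4 := spow_mono hi h1
    have h5 : 0 < 3 / L * w q := by positivity
    rwa [← spow_of_pos h5, spow_inv_spow ha] at h4
  have hvd : ∀ r ∈ Ioo b (b + L), w q ≤ w r → -(r ^ n * f (w r)) ≤ -(ρ ^ n * (K * w q ^ a)) := by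
    intro r hr hwr
    have h1 : ρ ^ n ≤ r ^ n := pow_le_pow_left₀ hρ.le (by linarith [hr.1]) n
    have h2 : K * w q ^ a ≤ f (w r) :=
      (mul_le_mul_of_nonneg_left (Real.rpow_le_rpow hwq.le hwr ha.le) hK0.le).trans (hfw r hr)
    have h3 : 0 < w q ^ a := Real.rpow_pos_of_pos hwq _
    exact neg_le_neg (mul_le_mul h1 h2 (by positivity) (by linarith [pow_pos hρ n]))
  have hvanti : ∀ x ∈ Icc b (b + L), ∀ y ∈ Icc b (b + L), x ≤ y → v y ≤ v x := by
    intro x hx y hy hxy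
    have := sub_le_of_hasDerivAt_le (C := 0) hxy (hcv.mono (Icc_subset_Icc hx.1 hy.2))
      (fun r hr => hdv r ⟨hx.1.trans_lt hr.1, hr.2.trans_le hy.2⟩)
      (fun r hr => by
        have h1 := hfpos r ⟨hx.1.trans_lt hr.1, hr.2.trans_le hy.2⟩
        have h2 : 0 < r := by linarith [hx.1, hr.1]
        have := mul_pos (pow_pos h2 n) h1
        linarith)
    linarith
  rcases pos_or_neg_of_ne_zero (hcv.mono Ioo_subset_Icc_self) hv with hpos | hneg
  · have hmono : ∀ r ∈ Ioo q (b + L), w q ≤ w r := fun r hr =>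
      le_of_hasDerivAt_nonneg hr.1.le (hcw.mono (Icc_subset_Icc hqm.1.le hr.2.le))
        (fun x hx => hdw x ⟨hqm.1.trans hx.1, hx.2.trans hr.2⟩) fun x hx => by
          have hx0 : 0 < x := by linarith [hx.1, hqm.1]
          exact (spow_pos (div_pos (hpos x ⟨hqm.1.trans hx.1, hx.2.trans hr.2⟩)
            (pow_pos hx0 n))).le
    have h1 := sub_le_of_hasDerivAt_le hqm.2.le (hcv.mono (Icc_subset_Icc_left hqm.1.le))
      (fun r hr => hdv r ⟨hqm.1.trans hr.1, hr.2⟩)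
      (fun r hr => hvd r ⟨hqm.1.trans hr.1, hr.2⟩ (hmono r hr))
    have h2 := nonneg_of_pos_Ioo hbL hcv hpos (b + L) ⟨hbL.le, le_rfl⟩
    have h3 : ρ ^ n * (K * w q ^ a) * (L / 2) ≤ v q := by
      have e : b + L - q = L / 2 := by rw [hq]; ring
      rw [e] at h1; linarith
    have h4 := le_sub_of_le_hasDerivAt (C := 3 / L * w q) hqm.1.le
      (hcw.mono (Icc_subset_Icc_right hqm.2.le))
      (fun r hr => hdw r ⟨hr.1, hr.2.trans hqm.2⟩) fun r hr =>
        hslope _ _ (by linarith [hr.1]) (by linarith [hr.2, hqm.2])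
          (h3.trans (hvanti r ⟨hr.1.le, (hr.2.trans hqm.2).le⟩ q (Ioo_subset_Icc_self hqm) hr.2.le))
    have h5 := hwnn b ⟨le_rfl, hbL.le⟩
    have e : 3 / L * w q * (q - b) = 3 / 2 * w q := by rw [hq]; field_simp; ring
    linarith
  · have hmono : ∀ r ∈ Ioo b q, w q ≤ w r := fun r hr => by
      have := sub_le_of_hasDerivAt_le (C := 0) hr.2.le
        (hcw.mono (Icc_subset_Icc hr.1.le hqm.2.le))
        (fun x hx => hdw x ⟨hr.1.trans hx.1, hx.2.trans hqm.2⟩) fun x hx => by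
          have hx0 : 0 < x := by linarith [hx.1, hr.1]
          exact (spow_neg_of_neg (div_neg_of_neg_of_pos
            (hneg x ⟨hr.1.trans hx.1, hx.2.trans hqm.2⟩) (pow_pos hx0 n))).le
      linarith
    have h1 := sub_le_of_hasDerivAt_le hqm.1.le (hcv.mono (Icc_subset_Icc_right hqm.2.le))
      (fun r hr => hdv r ⟨hr.1, hr.2.trans hqm.2⟩)
      (fun r hr => hvd r ⟨hr.1, hr.2.trans hqm.2⟩ (hmono r hr))
    have h2 := nonneg_of_pos_Ioo hbL hcv.neg (fun x hx => neg_pos.2 (hneg x hx)) b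
      ⟨le_rfl, hbL.le⟩
    have h3 : ρ ^ n * (K * w q ^ a) * (L / 2) ≤ -v q := by
      have e : q - b = L / 2 := by rw [hq]; ring
      simp only [Pi.neg_apply] at h2
      rw [e] at h1; linarith
    have h4 := sub_le_of_hasDerivAt_le (C := -(3 / L * w q)) hqm.2.le
      (hcw.mono (Icc_subset_Icc_left hqm.1.le))
      (fun r hr => hdw r ⟨hqm.1.trans hr.1, hr.2⟩) fun r hr => by
        have hvr := hvanti q (Ioo_subset_Icc_self hqm) r ⟨(hqm.1.trans hr.1).le, hr.2.le⟩ hr.1.le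
        have := hslope (-v r) r (by linarith [hr.1, hqm.1]) (by linarith [hr.2]) (by linarith)
        rw [neg_div, spow_neg] at this
        linarith
    have h5 := hwnn (b + L) ⟨hbL.le, le_rfl⟩
    have e : -(3 / L * w q) * (b + L - q) = -(3 / 2 * w q) := by rw [hq]; field_simp; ring
    linarith

lemma false_of_fast (h : RadialSol n a f R w v) (ha : 0 < a) {ρ b L K : ℝ} (hρ : 0 < ρ)
    (hb : ρ ≤ b) (hL : 0 < L) (hbR : b + L ≤ R) (hK : (3 / L) ^ a / (ρ ^ n * L / (2 * R ^ n)) ≤ K)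
    (hf : ∀ r ∈ Ioo b (b + L), K * |w r| ^ (a + 1) ≤ w r * f (w r))
    (hw : ∀ r ∈ Ioo b (b + L), w r ≠ 0) (hv : ∀ r ∈ Ioo b (b + L), v r ≠ 0) : False := by
  have hsub : Ioo b (b + L) ⊆ Icc 0 R :=
    Ioo_subset_Icc_self.trans (Icc_subset_Icc (by linarith) hbR)
  rcases pos_or_neg_of_ne_zero (h.cont_w.mono hsub) hw with hpos | hneg
  · exact h.false_of_fast_of_pos ha hρ hb hL hbR hK hf hpos hv
  · refine h.neg.false_of_fast_of_pos ha hρ hb hL hbR hK (fun r hr => ?_)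
      (fun r hr => neg_pos.2 (hneg r hr)) (fun r hr => neg_ne_zero.2 (hv r hr))
    rw [abs_neg, neg_neg, neg_mul_neg]; exact hf r hr

/-- Without a critical point each half of the interval would contain a zero of w, and Rolle's
theorem between these two zeros gives one after all. -/
lemma exists_v_eq_zero_of_fast (h : RadialSol n a f R w v) (ha : 0 < a) {ρ b L K : ℝ}
    (hρ : 0 < ρ) (hb : ρ ≤ b) (hL : 0 < L) (hbR : b + 2 * L ≤ R)
    (hK : (3 / L) ^ a / (ρ ^ n * L / (2 * R ^ n)) ≤ K)
    (hf : ∀ r ∈ Icc 0 R, K * |w r| ^ (a + 1) ≤ w r * f (w r)) :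
    ∃ c ∈ Ioo b (b + 2 * L), v c = 0 := by
  by_contra! hv
  have key : ∀ b', b ≤ b' → b' + L ≤ b + 2 * L → ∃ x ∈ Ioo b' (b' + L), w x = 0 := by
    intro b' h1 h2
    by_contra! hw
    exact h.false_of_fast ha hρ (hb.trans h1) hL (h2.trans hbR) hK
      (fun r hr => hf r ⟨by linarith [hr.1], by linarith [hr.2]⟩) hw
      fun r hr => hv r ⟨by linarith [hr.1], by linarith [hr.2]⟩
  obtain ⟨x, hx, hwx⟩ := key b le_rfl (by linarith)
  obtain ⟨y, hy, hwy⟩ := key (b + L) (by linarith) (by linarith)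
  obtain ⟨c, hc, hvc⟩ := h.exists_v_eq_zero (by linarith [hx.1]) (hx.2.trans hy.1)
    (by linarith [hy.2]) (hwx.trans hwy.symm)
  exact hv c ⟨by linarith [hx.1, hc.1], by linarith [hy.2, hc.2]⟩ hvc

end RadialSol

namespace Restoring

variable {n : ℕ} {a R α : ℝ} {f w v : ℝ → ℝ}

/-- When `f` is of larger order than `|s| ^ a` at the origin, trajectories starting close to the
origin rotate fast. -/
lemma exists_critChain_of_fast (hf : Restoring f) (ha : 0 < a)
    (hfast : ∀ K, ∃ δ > 0, ∀ s, |s| < δ → K * |s| ^ (a + 1) ≤ s * f s) (hR : 0 < R) (k : ℕ) :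
    ∃ α₀ > 0, ∀ α ∈ Ioo (0 : ℝ) 1, α < α₀ → ∀ w v, Trajectory n a f α w v →
      ∃ t, CritChain v k t ∧ t k < R := by
  -- The windows of length 2L with indices 1, ..., k fit into [R/2, 3R/4], away from the degenerate
  -- weight at the origin, and each contains a critical point.
  set L := R / (8 * (k + 1)) with hL
  have hL0 : 0 < L := by positivity
  have hLR : 2 * L * (k + 1) = R / 4 := by rw [hL]; field_simp; ring
  obtain ⟨δ, hδ, H⟩ := hfast ((3 / L) ^ a / ((R / 2) ^ n * L / (2 * R ^ n)))
  obtain ⟨α₀, hα₀, Hα⟩ := hf.exists_forall_abs_lt (n := n) ha hδ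
  refine ⟨α₀, hα₀, fun α hα hαα w v h => ?_⟩
  have hs := h.radialSol R
  have hex : ∀ i : ℕ, ∃ c, (i = 0 → c = 0) ∧ (1 ≤ i → i ≤ k →
      c ∈ Ioo (R / 2 + i * (2 * L)) (R / 2 + i * (2 * L) + 2 * L) ∧ v c = 0) := fun i => by
    by_cases hi : 1 ≤ i ∧ i ≤ k
    · have hik : (i : ℝ) ≤ k := by exact_mod_cast hi.2
      obtain ⟨c, hc, hvc⟩ := hs.exists_v_eq_zero_of_fast ha (b := R / 2 + i * (2 * L)) (L := L)
        (half_pos hR) (le_add_of_nonneg_right (by positivity)) hL0 (by nlinarith) le_rfl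
        fun r hr => H _ (Hα α hα hαα w v h r hr.1)
      exact ⟨c, fun h => by omega, fun _ _ => ⟨hc, hvc⟩⟩
    · exact ⟨0, fun _ => rfl, fun h h' => absurd ⟨h, h'⟩ hi⟩
  choose c hc0 hc using hex
  refine ⟨c, ⟨hc0 0 rfl, fun i hi => ?_, fun i hi => ?_⟩, ?_⟩
  · have h2 := (hc (i + 1) (by omega) hi).1.1
    push_cast at h2
    rcases Nat.eq_zero_or_pos i with rfl | hi0
    · rw [hc0 0 rfl]
      refine lt_trans ?_ h2
      positivity
    · have h1 := (hc i hi0 hi.le).1.2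
      linarith
  · rcases Nat.eq_zero_or_pos i with rfl | hi0
    · rw [hc0 0 rfl]; exact hs.v_zero
    · exact (hc i hi0 hi).2
  · rcases Nat.eq_zero_or_pos k with rfl | hk0
    · rw [hc0 0 rfl]; exact hR
    · have := (hc k hk0 le_rfl).1.2
      linarith

end Restoring

/-! ### Picone's identity and Sturm comparison -/

lemma young_spow {a : ℝ} (ha : 0 < a) (p t : ℝ) :
    (a + 1) * (p * spow a t) ≤ p * spow a p + a * (t * spow a t) := by
  have hc : (a + 1).HolderConjugate ((a + 1) / a) :=
    Real.holderConjugate_iff.2 ⟨by linarith, by field_simp; ring⟩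
  have h := Real.young_inequality p (spow a t) hc
  rw [abs_spow ha, ← Real.rpow_mul (abs_nonneg t), mul_div_cancel₀ _ ha.ne', ← mul_spow_self ha,
    ← mul_spow_self ha] at h
  have e : (a + 1) * (p * spow a p / (a + 1) + t * spow a t / ((a + 1) / a)) =
      p * spow a p + a * (t * spow a t) := by field_simp
  rw [← e]
  exact mul_le_mul_of_nonneg_left h (by linarith)

/-- The function in Picone's identity. -/
noncomputable def picone (a : ℝ) (x X y Y : ℝ → ℝ) (r : ℝ) : ℝ :=
  X r * x r - Y r * |x r| ^ (a + 1) / spow a (y r)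

section Picone

variable {n : ℕ} {a R μ ν b c : ℝ} {f x X y Y : ℝ → ℝ}

lemma continuousWithinAt_picone (ha : 0 < a) {s : Set ℝ} {r : ℝ} (hx : ContinuousWithinAt x s r)
    (hX : ContinuousWithinAt X s r) (hy : ContinuousWithinAt y s r)
    (hY : ContinuousWithinAt Y s r) (h0 : y r ≠ 0) : ContinuousWithinAt (picone a x X y Y) s r := by
  refine (hX.mul hx).sub ((hY.mul (hx.abs.rpow_const (Or.inr (by linarith)))).div ?_ ?_)
  · exact (continuous_spow ha).continuousAt.comp_continuousWithinAt hy
  · exact fun h => h0 (spow_eq_zero_iff.1 h)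

/-- After inserting both equations, the terms containing the slopes p of x and q of y form r^n times
the gap in Young's inequality for p and x q / y, which is nonnegative. The zeroth-order terms leave
(ν - μ) |x|^(a+1). -/
lemma exists_hasDerivAt_picone (ha : 0 < a) (hx : RadialSol n a (fun s => μ * spow a s) R x X)
    (hy : RadialSol n a f R y Y) {r : ℝ} (hr : r ∈ Ioo 0 R) (hpos : 0 < y r)
    (hν : ν * |y r| ^ (a + 1) ≤ y r * f (y r)) :
    ∃ D', HasDerivAt (picone a x X y Y) D' r ∧ r ^ n * ((ν - μ) * |x r| ^ (a + 1)) ≤ D' := by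
  have hrn := pow_pos hr.1 n
  have hx' := hx.deriv_w r hr
  have hy' := hy.deriv_w r hr
  have hX : X r = r ^ n * spow a (spow a⁻¹ (X r / r ^ n)) := by
    rw [spow_spow_inv ha]; field_simp
  have hY : Y r = r ^ n * spow a (spow a⁻¹ (Y r / r ^ n)) := by
    rw [spow_spow_inv ha]; field_simp
  set p := spow a⁻¹ (X r / r ^ n) with hp
  set q := spow a⁻¹ (Y r / r ^ n) with hq
  have hA : HasDerivAt (fun s => spow a (y s)) (q * a * y r ^ (a - 1)) r := by
    refine (hy'.rpow_const (Or.inl hpos.ne')).congr_of_eventuallyEq ?_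
    filter_upwards [hy'.continuousAt.eventually (lt_mem_nhds hpos)] with s hs using spow_of_pos hs
  have hM : HasDerivAt (fun s => |x s| ^ (a + 1)) ((a + 1) * spow a (x r) * p) r :=
    (hasDerivAt_abs_rpow_add_one ha (x r)).comp r hx'
  have hA0 : 0 < spow a (y r) := spow_pos hpos
  have hD := ((hx.deriv_v r hr).mul hx').sub (((hy.deriv_v r hr).mul hM).div hA hA0.ne')
  refine ⟨_, hD, ?_⟩
  simp only [Pi.mul_apply]
  rw [Real.rpow_sub_one hpos.ne', ← spow_of_pos hpos]
  have hyg := young_spow ha p (x r * q / y r)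
  have hsτ : spow a (x r * q / y r) = spow a (x r) * spow a q / spow a (y r) := by
    rw [eq_div_iff hA0.ne', ← spow_mul, ← spow_mul, div_mul_cancel₀ _ hpos.ne']
  rw [hsτ] at hyg
  rw [abs_of_pos hpos, Real.rpow_add_one hpos.ne', ← spow_of_pos hpos] at hν
  have hν' : ν * spow a (y r) ≤ f (y r) := by
    refine le_of_mul_le_mul_left ?_ hpos
    linarith
  have hM0 : 0 ≤ |x r| ^ (a + 1) := by positivity
  have hMe := mul_spow_self ha (x r)
  have hfM : ν * |x r| ^ (a + 1) ≤ f (y r) * |x r| ^ (a + 1) / spow a (y r) := by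
    rw [le_div_iff₀ hA0]
    nlinarith [mul_le_mul_of_nonneg_right hν' hM0]
  generalize hE : -(r ^ n * (μ * spow a (x r))) * x r + X r * p -
    ((-(r ^ n * f (y r)) * |x r| ^ (a + 1) + Y r * ((a + 1) * spow a (x r) * p)) *
      spow a (y r) - Y r * |x r| ^ (a + 1) * (q * a * (spow a (y r) / y r))) /
      spow a (y r) ^ 2 = E
  have hE' : E = r ^ n * (-μ * |x r| ^ (a + 1) + f (y r) * |x r| ^ (a + 1) / spow a (y r) +
      (p * spow a p + a * (x r * q / y r * (spow a (x r) * spow a q / spow a (y r))) -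
        (a + 1) * (p * (spow a (x r) * spow a q / spow a (y r))))) := by
    rw [← hE, hX, hY, ← hMe]
    field_simp
    ring
  rw [hE']
  refine mul_le_mul_of_nonneg_left ?_ hrn.le
  linarith

/-- The Picone function is nondecreasing, starts from 0 and ends at l ≤ 0. It is therefore
identically 0, and its derivative bounds |x|^(a+1) since μ < ν. -/
lemma eq_zero_of_picone (ha : 0 < a) (hx : RadialSol n a (fun s => μ * spow a s) R x X)
    (hy : RadialSol n a f R y Y) (hμν : μ < ν) (hb : 0 ≤ b) (hc : c ≤ R)
    (hpos : ∀ r ∈ Ioo b c, 0 < y r)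
    (hν : ∀ r ∈ Ioo b c, ν * |y r| ^ (a + 1) ≤ y r * f (y r))
    (hl : Tendsto (picone a x X y Y) (𝓝[>] b) (𝓝 0)) {l : ℝ} (hl0 : l ≤ 0)
    (hr : Tendsto (picone a x X y Y) (𝓝[<] c) (𝓝 l)) : ∀ r ∈ Ioo b c, x r = 0 := by
  have hD : ∀ r, ∃ D', r ∈ Ioo b c → HasDerivAt (picone a x X y Y) D' r ∧
      r ^ n * ((ν - μ) * |x r| ^ (a + 1)) ≤ D' := fun r => by
    by_cases h : r ∈ Ioo b c
    · obtain ⟨D', h'⟩ := exists_hasDerivAt_picone ha hx hy ⟨hb.trans_lt h.1, h.2.trans_le hc⟩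
        (hpos r h) (hν r h)
      exact ⟨D', fun _ => h'⟩
    · exact ⟨0, fun h' => absurd h' h⟩
  choose D' hD using hD
  have hnn : ∀ r ∈ Ioo b c, 0 ≤ r ^ n * ((ν - μ) * |x r| ^ (a + 1)) := fun r h => by
    have : 0 < r := hb.trans_lt h.1
    have : 0 < ν - μ := by linarith
    positivity
  have hmono : ∀ s ∈ Ioo b c, ∀ t ∈ Ioo b c, s ≤ t → picone a x X y Y s ≤ picone a x X y Y t :=
    fun s hs t ht hst => le_of_hasDerivAt_nonneg hst
      (fun z hz => (hD z ⟨hs.1.trans_le hz.1, hz.2.trans_lt ht.2⟩).1.continuousAt.continuousWithinAt)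
      (fun z hz => (hD z ⟨hs.1.trans hz.1, hz.2.trans ht.2⟩).1)
      fun z hz => (hnn z ⟨hs.1.trans hz.1, hz.2.trans ht.2⟩).trans
        (hD z ⟨hs.1.trans hz.1, hz.2.trans ht.2⟩).2
  have hzero : ∀ t ∈ Ioo b c, picone a x X y Y t = 0 := fun t ht => by
    refine le_antisymm (le_trans (ge_of_tendsto hr ?_) hl0) (le_of_tendsto hl ?_)
    · filter_upwards [Ioo_mem_nhdsLT ht.2] with s hs
      exact hmono t ht s ⟨ht.1.trans hs.1, hs.2⟩ hs.1.le
    · filter_upwards [Ioo_mem_nhdsGT ht.1] with s hs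
      exact hmono s ⟨hs.1, hs.2.trans ht.2⟩ t ht hs.2.le
  intro r h
  have h0 : D' r = 0 := by
    refine (hD r h).1.unique ((hasDerivAt_const r (0 : ℝ)).congr_of_eventuallyEq ?_)
    filter_upwards [Ioo_mem_nhds h.1 h.2] with t ht using hzero t ht
  have h1 := (hD r h).2
  rw [h0] at h1
  have h2 : |x r| ^ (a + 1) = 0 := by
    have h3 : 0 < r ^ n * (ν - μ) := mul_pos (pow_pos (hb.trans_lt h.1) n) (by linarith)
    have h4 : 0 ≤ |x r| ^ (a + 1) := by positivity
    nlinarith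
  exact abs_eq_zero.1 ((Real.rpow_eq_zero (abs_nonneg _) (by linarith)).1 h2)

/-- Where y also vanishes its slope does not, so x / y has a finite limit. The singular term has
absolute value |Y| |x| |x / y|^a and tends to 0. -/
lemma tendsto_picone_of_eq_zero (ha : 0 < a) {g : ℝ → ℝ} (hx : RadialSol n a g R x X)
    (hy : RadialSol n a f R y Y) {r : ℝ} (hr : r ∈ Ioo 0 R) (hxr : x r = 0)
    (hnd : y r = 0 → Y r ≠ 0) : Tendsto (picone a x X y Y) (𝓝[≠] r) (𝓝 0) := by
  have hx' := hx.deriv_w r hr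
  have hy' := hy.deriv_w r hr
  have hcX := (hx.deriv_v r hr).continuousAt
  have hcY := (hy.deriv_v r hr).continuousAt
  have hx0 : Tendsto x (𝓝[≠] r) (𝓝 0) := hxr ▸ hx'.continuousAt.mono_left nhdsWithin_le_nhds
  obtain ⟨l, hl⟩ : ∃ l, Tendsto (fun s => x s / y s) (𝓝[≠] r) (𝓝 l) := by
    rcases eq_or_ne (y r) 0 with h0 | h0
    · have hq : spow a⁻¹ (Y r / r ^ n) ≠ 0 := fun h => by
        rw [spow_eq_zero_iff, div_eq_zero_iff] at h
        exact h.elim (hnd h0) (pow_pos hr.1 n).ne'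
      refine ⟨_, ((hasDerivAt_iff_tendsto_slope.1 hx').div (hasDerivAt_iff_tendsto_slope.1 hy')
        hq).congr' ?_⟩
      filter_upwards [self_mem_nhdsWithin] with s hs
      have : s - r ≠ 0 := sub_ne_zero.2 hs
      simp only [Pi.div_apply, slope, hxr, h0, vsub_eq_sub, sub_zero, smul_eq_mul]
      exact mul_div_mul_left _ _ (inv_ne_zero this)
    · exact ⟨0 / y r, hx0.div (hy'.continuousAt.mono_left nhdsWithin_le_nhds) h0⟩
  have h1 : Tendsto (fun s => |X s| * |x s| + |Y s| * (|x s| * |x s / y s| ^ a)) (𝓝[≠] r)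
      (𝓝 (|X r| * |0| + |Y r| * (|0| * |l| ^ a))) :=
    ((hcX.mono_left nhdsWithin_le_nhds).abs.mul hx0.abs).add
      ((hcY.mono_left nhdsWithin_le_nhds).abs.mul
        (hx0.abs.mul (hl.abs.rpow_const (Or.inr ha.le))))
  simp only [abs_zero, mul_zero, zero_mul, add_zero] at h1
  refine squeeze_zero_norm' (Eventually.of_forall fun s => ?_) h1
  rw [picone, Real.norm_eq_abs]
  refine (abs_sub _ _).trans (add_le_add (abs_mul _ _).le (le_of_eq ?_))
  rw [abs_div, abs_mul, abs_spow ha, abs_of_nonneg (by positivity : 0 ≤ |x s| ^ (a + 1)), abs_div,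
    Real.div_rpow (abs_nonneg _) (abs_nonneg _)]
  rcases eq_or_ne (x s) 0 with h | h
  · simp [h, Real.zero_rpow (by linarith : a + 1 ≠ 0)]
  · rw [Real.rpow_add_one (abs_ne_zero.2 h)]; ring

lemma tendsto_picone_zero (ha : 0 < a) {g : ℝ → ℝ} (hR : 0 < R) (hx : RadialSol n a g R x X)
    (hy : RadialSol n a f R y Y) (h0 : y 0 ≠ 0) : Tendsto (picone a x X y Y) (𝓝[>] 0) (𝓝 0) := by
  have hm : (0 : ℝ) ∈ Icc 0 R := ⟨le_rfl, hR.le⟩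
  have h := continuousWithinAt_picone ha (hx.cont_w 0 hm) (hx.cont_v 0 hm) (hy.cont_w 0 hm)
    (hy.cont_v 0 hm) h0
  have e : picone a x X y Y 0 = 0 := by simp [picone, hx.v_zero, hy.v_zero]
  rw [ContinuousWithinAt, e] at h
  refine h.mono_left ?_
  rw [← nhdsWithin_Ioo_eq_nhdsGT hR]
  exact nhdsWithin_mono _ Ioo_subset_Icc_self

lemma tendsto_picone_right (ha : 0 < a) {g : ℝ → ℝ} (hR : 0 < R) (hx : RadialSol n a g R x X)
    (hy : RadialSol n a f R y Y) (hXR : X R = 0) (hpos : 0 < y R) (hYR : 0 ≤ Y R) :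
    ∃ l ≤ 0, Tendsto (picone a x X y Y) (𝓝[<] R) (𝓝 l) := by
  have hm : R ∈ Icc 0 R := ⟨hR.le, le_rfl⟩
  have h := continuousWithinAt_picone ha (hx.cont_w R hm) (hx.cont_v R hm) (hy.cont_w R hm)
    (hy.cont_v R hm) hpos.ne'
  refine ⟨picone a x X y Y R, ?_, h.mono_left ?_⟩
  · have := spow_pos (a := a) hpos
    have h1 : 0 ≤ Y R * |x R| ^ (a + 1) / spow a (y R) := by positivity
    simp only [picone, hXR, zero_mul]
    linarith
  · rw [← nhdsWithin_Ioo_eq_nhdsLT hR]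
    exact nhdsWithin_mono _ Ioo_subset_Icc_self

lemma exists_eq_zero_of_eq_zero_of_eq_zero (ha : 0 < a)
    (hx : RadialSol n a (fun s => μ * spow a s) R x X)
    (hy : RadialSol n a f R y Y) (hμν : μ < ν)
    (hν : ∀ r ∈ Ioo 0 R, ν * |y r| ^ (a + 1) ≤ y r * f (y r))
    (hnd : ∀ r ∈ Ioo 0 R, y r = 0 → Y r ≠ 0) (hb : b ∈ Ioo 0 R) (hc : c ∈ Ioo 0 R)
    (hxb : x b = 0) (hxc : x c = 0) (hx0 : ∃ r ∈ Ioo b c, x r ≠ 0) : ∃ r ∈ Ioo b c, y r = 0 := by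
  by_contra! hne
  obtain ⟨r, hr, hxr⟩ := hx0
  have hsub : Ioo b c ⊆ Ioo 0 R := Ioo_subset_Ioo hb.1.le hc.2.le
  have key : ∀ {f y Y : ℝ → ℝ}, RadialSol n a f R y Y →
      (∀ r ∈ Ioo 0 R, ν * |y r| ^ (a + 1) ≤ y r * f (y r)) →
      (∀ r ∈ Ioo 0 R, y r = 0 → Y r ≠ 0) → (∀ r ∈ Ioo b c, 0 < y r) → False :=
    fun hy hν hnd hpos => hxr (eq_zero_of_picone ha hx hy hμν hb.1.le hc.2.le hpos
      (fun r hr => hν r (hsub hr))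
      ((tendsto_picone_of_eq_zero ha hx hy hb hxb (hnd b hb)).mono_left
        (nhdsWithin_mono _ fun z hz => ne_of_gt hz)) le_rfl
      ((tendsto_picone_of_eq_zero ha hx hy hc hxc (hnd c hc)).mono_left
        (nhdsWithin_mono _ fun z hz => ne_of_lt hz)) r hr)
  rcases pos_or_neg_of_ne_zero (hy.cont_w.mono (hsub.trans Ioo_subset_Icc_self)) hne with h | h
  · exact key hy hν hnd h
  · exact key hy.neg (fun r hr => by rw [abs_neg, neg_neg, neg_mul_neg]; exact hν r hr)
      (fun r hr h => neg_ne_zero.2 (hnd r hr (neg_eq_zero.1 h))) (fun r hr => neg_pos.2 (h r hr))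

lemma exists_eq_zero_left (ha : 0 < a) (hx : RadialSol n a (fun s => μ * spow a s) R x X)
    (hy : RadialSol n a f R y Y) (hμν : μ < ν)
    (hν : ∀ r ∈ Ioo 0 R, ν * |y r| ^ (a + 1) ≤ y r * f (y r))
    (hnd : ∀ r ∈ Ioo 0 R, y r = 0 → Y r ≠ 0) (hy0 : y 0 ≠ 0) (hc : c ∈ Ioo 0 R)
    (hxc : x c = 0) (hx0 : ∃ r ∈ Ioo 0 c, x r ≠ 0) : ∃ r ∈ Ioo 0 c, y r = 0 := by
  by_contra! hne
  obtain ⟨r, hr, hxr⟩ := hx0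
  have hsub : Ioo 0 c ⊆ Ioo 0 R := Ioo_subset_Ioo le_rfl hc.2.le
  have key : ∀ {f y Y : ℝ → ℝ}, RadialSol n a f R y Y →
      (∀ r ∈ Ioo 0 R, ν * |y r| ^ (a + 1) ≤ y r * f (y r)) →
      (∀ r ∈ Ioo 0 R, y r = 0 → Y r ≠ 0) → y 0 ≠ 0 → (∀ r ∈ Ioo 0 c, 0 < y r) → False :=
    fun hy hν hnd hy0 hpos => hxr (eq_zero_of_picone ha hx hy hμν le_rfl hc.2.le hpos
      (fun r hr => hν r (hsub hr)) (tendsto_picone_zero ha (hc.1.trans hc.2) hx hy hy0) le_rfl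
      ((tendsto_picone_of_eq_zero ha hx hy hc hxc (hnd c hc)).mono_left
        (nhdsWithin_mono _ fun z hz => ne_of_lt hz)) r hr)
  rcases pos_or_neg_of_ne_zero (hy.cont_w.mono (hsub.trans Ioo_subset_Icc_self)) hne with h | h
  · exact key hy hν hnd hy0 h
  · exact key hy.neg (fun r hr => by rw [abs_neg, neg_neg, neg_mul_neg]; exact hν r hr)
      (fun r hr h => neg_ne_zero.2 (hnd r hr (neg_eq_zero.1 h))) (neg_ne_zero.2 hy0)
      (fun r hr => neg_pos.2 (h r hr))

/-- At R the eigenfunction contributes X R x R = 0. Only the term with Y R remains, and its sign is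
controlled by y R * Y R ≥ 0; y need not satisfy the Neumann condition. -/
lemma exists_eq_zero_right (ha : 0 < a) (hx : RadialSol n a (fun s => μ * spow a s) R x X)
    (hy : RadialSol n a f R y Y) (hμν : μ < ν)
    (hν : ∀ r ∈ Ioo 0 R, ν * |y r| ^ (a + 1) ≤ y r * f (y r))
    (hnd : ∀ r ∈ Ioo 0 R, y r = 0 → Y r ≠ 0) (hb : b ∈ Ioo 0 R) (hxb : x b = 0)
    (hXR : X R = 0) (hyR : y R ≠ 0) (hYR : 0 ≤ y R * Y R)
    (hx0 : ∃ r ∈ Ioo b R, x r ≠ 0) : ∃ r ∈ Ioo b R, y r = 0 := by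
  by_contra! hne
  obtain ⟨r, hr, hxr⟩ := hx0
  have hR := hb.1.trans hb.2
  have hsub : Ioo b R ⊆ Ioo 0 R := Ioo_subset_Ioo hb.1.le le_rfl
  have key : ∀ {f y Y : ℝ → ℝ}, RadialSol n a f R y Y →
      (∀ r ∈ Ioo 0 R, ν * |y r| ^ (a + 1) ≤ y r * f (y r)) →
      (∀ r ∈ Ioo 0 R, y r = 0 → Y r ≠ 0) → y R ≠ 0 → 0 ≤ y R * Y R →
      (∀ r ∈ Ioo b R, 0 < y r) → False := by
    intro f y Y hy hν hnd hyR hYR hpos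
    have hp : 0 < y R := lt_of_le_of_ne (nonneg_of_pos_Ioo hb.2
      (hy.cont_w.mono (Icc_subset_Icc_left hb.1.le)) hpos R ⟨hb.2.le, le_rfl⟩) hyR.symm
    obtain ⟨l, hl0, hl⟩ := tendsto_picone_right ha hR hx hy hXR hp (nonneg_of_mul_nonneg_right hYR hp)
    exact hxr (eq_zero_of_picone ha hx hy hμν hb.1.le le_rfl hpos
      (fun r hr => hν r (hsub hr)) ((tendsto_picone_of_eq_zero ha hx hy hb hxb (hnd b hb)).mono_left
        (nhdsWithin_mono _ fun z hz => ne_of_gt hz)) hl0 hl r hr)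
  rcases pos_or_neg_of_ne_zero (hy.cont_w.mono (hsub.trans Ioo_subset_Icc_self)) hne with h | h
  · exact key hy hν hnd hyR hYR h
  · exact key hy.neg (fun r hr => by rw [abs_neg, neg_neg, neg_mul_neg]; exact hν r hr)
      (fun r hr h => neg_ne_zero.2 (hnd r hr (neg_eq_zero.1 h))) (neg_ne_zero.2 hyR)
      (by rwa [neg_mul_neg]) (fun r hr => neg_pos.2 (h r hr))

lemma exists_eq_zero_of_neumann (ha : 0 < a) (hR : 0 < R)
    (hx : RadialSol n a (fun s => μ * spow a s) R x X)
    (hy : RadialSol n a f R y Y) (hμν : μ < ν)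
    (hν : ∀ r ∈ Ioo 0 R, ν * |y r| ^ (a + 1) ≤ y r * f (y r))
    (hy0 : y 0 ≠ 0) (hXR : X R = 0) (hyR : y R ≠ 0) (hYR : Y R = 0)
    (hx0 : ∃ r ∈ Ioo 0 R, x r ≠ 0) : ∃ r ∈ Ioo 0 R, y r = 0 := by
  by_contra! hne
  obtain ⟨r, hr, hxr⟩ := hx0
  have key : ∀ {f y Y : ℝ → ℝ}, RadialSol n a f R y Y →
      (∀ r ∈ Ioo 0 R, ν * |y r| ^ (a + 1) ≤ y r * f (y r)) → y 0 ≠ 0 → y R ≠ 0 → Y R = 0 →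
      (∀ r ∈ Ioo 0 R, 0 < y r) → False := by
    intro f y Y hy hν hy0 hyR hYR hpos
    have hp : 0 < y R := lt_of_le_of_ne (nonneg_of_pos_Ioo hR hy.cont_w hpos R ⟨hR.le, le_rfl⟩)
      hyR.symm
    obtain ⟨l, hl0, hl⟩ := tendsto_picone_right ha hR hx hy hXR hp hYR.ge
    exact hxr (eq_zero_of_picone ha hx hy hμν le_rfl le_rfl hpos hν
      (tendsto_picone_zero ha hR hx hy hy0) hl0 hl r hr)
  rcases pos_or_neg_of_ne_zero (hy.cont_w.mono Ioo_subset_Icc_self) hne with h | h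
  · exact key hy hν hy0 hyR hYR h
  · exact key hy.neg (fun r hr => by rw [abs_neg, neg_neg, neg_mul_neg]; exact hν r hr)
      (neg_ne_zero.2 hy0) (neg_ne_zero.2 hyR) (by simp [hYR]) (fun r hr => neg_pos.2 (h r hr))

end Picone

/-! ### Radial eigenfunctions and the number of their zeros -/

/-- `(x, X)` is a radial Neumann eigenfunction with eigenvalue `μ`. -/
structure RadialEigen (n : ℕ) (a R μ : ℝ) (x X : ℝ → ℝ) : Prop where
  radialSol : RadialSol n a (fun s => μ * spow a s) R x X
  neumann : X R = 0
  ne_zero : ∃ r ∈ Icc 0 R, x r ≠ 0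

/-- `x` has at least `m` zeros in `(0, R)`. -/
def HasZeros (R : ℝ) (x : ℝ → ℝ) (m : ℕ) : Prop :=
  ∃ z : ℕ → ℝ, (∀ i < m, z i ∈ Ioo 0 R ∧ x (z i) = 0) ∧ ∀ i, i + 1 < m → z i < z (i + 1)

namespace RadialEigen

variable {n : ℕ} {a R μ ν : ℝ} {x X y Y : ℝ → ℝ}

/-- If μ < 0, the product X x is nondecreasing and zero at both ends. So it is constant, and its
derivative, which is at least -μ r^n |x|^(a+1), vanishes. -/
lemma eigenvalue_nonneg (h : RadialEigen n a R μ x X) (ha : 0 < a) (hR : 0 < R) : 0 ≤ μ := by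
  by_contra! hμ
  have hs := h.radialSol
  have hd : ∀ r ∈ Ioo 0 R, HasDerivAt (fun r => X r * x r) (-(r ^ n * (μ * spow a (x r))) * x r +
      X r * spow a⁻¹ (X r / r ^ n)) r := fun r hr => (hs.deriv_v r hr).mul (hs.deriv_w r hr)
  have hnn : ∀ r ∈ Ioo 0 R, r ^ n * (-μ * |x r| ^ (a + 1)) ≤ -(r ^ n * (μ * spow a (x r))) * x r +
      X r * spow a⁻¹ (X r / r ^ n) := fun r hr => by
    have h1 : 0 ≤ X r * spow a⁻¹ (X r / r ^ n) := by
      have h2 : X r * spow a⁻¹ (X r / r ^ n) = r ^ n * |X r / r ^ n| ^ (a⁻¹ + 1) := by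
        rw [← mul_spow_self (inv_pos.2 ha)]
        have := (pow_pos hr.1 n).ne'
        field_simp
      rw [h2]
      have := hr.1
      positivity
    rw [← mul_spow_self ha]
    linarith
  have hpos : ∀ r ∈ Ioo 0 R, 0 ≤ r ^ n * (-μ * |x r| ^ (a + 1)) := fun r hr => by
    have := hr.1
    have : 0 < -μ := by linarith
    positivity
  have hmono : ∀ s ∈ Icc 0 R, ∀ t ∈ Icc 0 R, s ≤ t → X s * x s ≤ X t * x t :=
    fun s hs' t ht hst => le_of_hasDerivAt_nonneg hst
      ((hs.cont_v.mul hs.cont_w).mono (Icc_subset_Icc hs'.1 ht.2))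
      (fun r hr => hd r ⟨hs'.1.trans_lt hr.1, hr.2.trans_le ht.2⟩) fun r hr =>
        (hpos r ⟨hs'.1.trans_lt hr.1, hr.2.trans_le ht.2⟩).trans
          (hnn r ⟨hs'.1.trans_lt hr.1, hr.2.trans_le ht.2⟩)
  have hzero : ∀ r ∈ Icc 0 R, X r * x r = 0 := fun r hr => by
    have h1 := hmono 0 ⟨le_rfl, hR.le⟩ r hr hr.1
    have h2 := hmono r hr R ⟨hR.le, le_rfl⟩ hr.2
    rw [hs.v_zero, zero_mul] at h1
    rw [h.neumann, zero_mul] at h2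
    exact le_antisymm h2 h1
  have hx0 : ∀ r ∈ Ioo 0 R, x r = 0 := fun r hr => by
    have e := (hd r hr).unique ((hasDerivAt_const r (0 : ℝ)).congr_of_eventuallyEq (by
      filter_upwards [Ioo_mem_nhds hr.1 hr.2] with t ht using hzero t (Ioo_subset_Icc_self ht)))
    have h1 := hnn r hr
    rw [e] at h1
    have h2 : |x r| ^ (a + 1) = 0 := by
      have h3 : 0 < r ^ n * (-μ) := mul_pos (pow_pos hr.1 n) (by linarith)
      have h4 : 0 ≤ |x r| ^ (a + 1) := by positivity
      nlinarith
    exact abs_eq_zero.1 ((Real.rpow_eq_zero (abs_nonneg _) (by linarith)).1 h2)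
  obtain ⟨r, hr, hxr⟩ := h.ne_zero
  refine hxr ?_
  have hr' : r ∈ closure (Ioo 0 R) := by rwa [closure_Ioo hR.ne]
  have : (𝓝[Ioo 0 R] r).NeBot := mem_closure_iff_nhdsWithin_neBot.1 hr'
  refine tendsto_nhds_unique ((hs.cont_w r hr).mono Ioo_subset_Icc_self).tendsto
    (tendsto_const_nhds.congr' ?_)
  filter_upwards [self_mem_nhdsWithin] with t ht using (hx0 t ht).symm

lemma eq_const_of_eigenvalue_eq_zero (h : RadialEigen n a R μ x X) (hμ : μ = 0) :
    ∀ r ∈ Icc 0 R, x r = x 0 := by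
  subst hμ
  have hs := h.radialSol
  have hX : ∀ r ∈ Icc 0 R, X r = 0 := fun r hr => by
    have := hs.abs_v_le (K := 0) hr fun t _ => by simp
    rw [zero_mul] at this
    exact abs_eq_zero.1 (le_antisymm this (abs_nonneg _))
  intro r hr
  have := abs_sub_le_of_abs_hasDerivAt_le (C := 0) hr.1 (hs.cont_w.mono (Icc_subset_Icc_right hr.2))
    (fun t ht => hs.deriv_w t ⟨ht.1, ht.2.trans_le hr.2⟩) fun t ht => by
      simp [hX t ⟨ht.1.le, ht.2.le.trans hr.2⟩]
  rw [zero_mul] at this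
  exact sub_eq_zero.1 (abs_eq_zero.1 (le_antisymm this (abs_nonneg _)))

lemma sign (ha : 0 < a) (hμ : 0 < μ) : ∀ s ∈ (univ : Set ℝ), s ≠ 0 → 0 < s * (μ * spow a s) := by
  intro s _ hs
  have : s * (μ * spow a s) = μ * |s| ^ (a + 1) := by rw [← mul_spow_self ha]; ring
  rw [this]
  have := abs_pos.2 hs
  positivity

lemma continuous_rhs (ha : 0 < a) : Continuous fun s => μ * spow a s :=
  continuous_const.mul (continuous_spow ha)

/-- For μ > 0 the potential along x is bounded by its value at the origin, so x 0 = 0 would make x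
vanish. For μ = 0 the eigenfunction is constant. -/
lemma zero_ne_zero (h : RadialEigen n a R μ x X) (ha : 0 < a) (hR : 0 < R) : x 0 ≠ 0 := by
  intro h0
  obtain ⟨r, hr, hxr⟩ := h.ne_zero
  rcases (h.eigenvalue_nonneg ha hR).eq_or_lt with hμ | hμ
  · exact hxr ((h.eq_const_of_eigenvalue_eq_zero hμ.symm r hr).trans h0)
  · have h1 := h.radialSol.potential_le_potential_zero ha (continuous_rhs ha) hr
    have h2 := potential_pos (continuous_rhs ha) (mem_univ 0) (sign ha hμ) (mem_univ _) hxr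
    rw [h0, potential_zero] at h1
    linarith

lemma X_ne_zero (h : RadialEigen n a R μ x X) (ha : 0 < a) (hR : 0 < R) (hμ : 0 < μ) {r : ℝ}
    (hr : r ∈ Ioc 0 R) (hxr : x r = 0) : X r ≠ 0 :=
  h.radialSol.w_ne_zero_or_v_ne_zero ha (continuous_rhs ha) (mem_univ 0) (sign ha hμ)
    (fun _ _ => mem_univ _) (h.zero_ne_zero ha hR) hr hxr

lemma exists_ne_zero (h : RadialEigen n a R μ x X) (ha : 0 < a) (hR : 0 < R) {b c : ℝ}
    (hb : 0 ≤ b) (hbc : b < c) (hc : c ≤ R) : ∃ r ∈ Ioo b c, x r ≠ 0 := by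
  have hmid : (b + c) / 2 ∈ Ioo b c := ⟨by linarith, by linarith⟩
  have hmid' : (b + c) / 2 ∈ Ioo 0 R := ⟨hb.trans_lt hmid.1, hmid.2.trans_le hc⟩
  rcases (h.eigenvalue_nonneg ha hR).eq_or_lt with hμ | hμ
  · refine ⟨_, hmid, ?_⟩
    rw [h.eq_const_of_eigenvalue_eq_zero hμ.symm _ (Ioo_subset_Icc_self hmid')]
    exact h.zero_ne_zero ha hR
  · by_contra! hx
    refine h.X_ne_zero ha hR hμ (Ioo_subset_Ioc_self hmid') (hx _ hmid) ?_
    have e := (h.radialSol.deriv_w _ hmid').unique ((hasDerivAt_const _ (0 : ℝ)).congr_of_eventuallyEq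
      (by filter_upwards [Ioo_mem_nhds hmid.1 hmid.2] with t ht using hx t ht))
    rw [spow_eq_zero_iff, div_eq_zero_iff] at e
    exact e.resolve_right (pow_pos hmid'.1 n).ne'

/-- Sturm: a larger eigenvalue has an eigenfunction with more zeros. -/
lemma hasZeros_succ (hx : RadialEigen n a R μ x X) (hy : RadialEigen n a R ν y Y) (ha : 0 < a)
    (hR : 0 < R) (hμν : μ < ν) {m : ℕ} (hm : HasZeros R x m) : HasZeros R y (m + 1) := by
  obtain ⟨z, hz, hzlt⟩ := hm
  have hν0 : 0 < ν := (hx.eigenvalue_nonneg ha hR).trans_lt hμν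
  have hν : ∀ r ∈ Ioo 0 R, ν * |y r| ^ (a + 1) ≤ y r * (ν * spow a (y r)) := fun r _ => by
    rw [← mul_spow_self ha]; exact le_of_eq (by ring)
  have hnd : ∀ r ∈ Ioo 0 R, y r = 0 → Y r ≠ 0 := fun r hr =>
    hy.X_ne_zero ha hR hν0 (Ioo_subset_Ioc_self hr)
  have hyR : y R ≠ 0 := fun h => hy.X_ne_zero ha hR hν0 ⟨hR, le_rfl⟩ h hy.neumann
  have hy0 := hy.zero_ne_zero ha hR
  -- The m zeros of x cut [0, R] into m + 1 pieces, each containing a zero of y. The Neumann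
  -- conditions make the two end pieces work, and the whole interval when m = 0.
  have hex : ∀ i, ∃ c, i < m + 1 → (i = 0 ∨ z (i - 1) < c) ∧ (i < m → c < z i) ∧ c ∈ Ioo 0 R ∧
      y c = 0 := fun i => by
    by_cases hi : i < m + 1
    swap
    · exact ⟨0, fun h => absurd h hi⟩
    rcases Nat.eq_zero_or_pos i with rfl | hi0
    · rcases Nat.eq_zero_or_pos m with rfl | hm0
      · obtain ⟨c, hc, hyc⟩ := exists_eq_zero_of_neumann ha hR hx.radialSol hy.radialSol hμν hν hy0
          hx.neumann hyR hy.neumann (hx.exists_ne_zero ha hR le_rfl hR le_rfl)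
        exact ⟨c, fun _ => ⟨Or.inl rfl, fun h => absurd h (by omega), hc, hyc⟩⟩
      · obtain ⟨hz0, hxz⟩ := hz 0 hm0
        obtain ⟨c, hc, hyc⟩ := exists_eq_zero_left ha hx.radialSol hy.radialSol hμν hν hnd hy0 hz0 hxz
          (hx.exists_ne_zero ha hR le_rfl hz0.1 hz0.2.le)
        exact ⟨c, fun _ => ⟨Or.inl rfl, fun _ => hc.2, ⟨hc.1, hc.2.trans hz0.2⟩, hyc⟩⟩
    · obtain ⟨hz0, hxz⟩ := hz (i - 1) (by omega)
      rcases Nat.lt_or_ge i m with him | him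
      · obtain ⟨hz1, hxz1⟩ := hz i him
        have hlt := hzlt (i - 1) (by omega)
        rw [Nat.sub_add_cancel hi0] at hlt
        obtain ⟨c, hc, hyc⟩ := exists_eq_zero_of_eq_zero_of_eq_zero ha hx.radialSol hy.radialSol hμν
          hν hnd hz0 hz1 hxz hxz1 (hx.exists_ne_zero ha hR hz0.1.le hlt hz1.2.le)
        exact ⟨c, fun _ => ⟨Or.inr hc.1, fun _ => hc.2, ⟨hz0.1.trans hc.1, hc.2.trans hz1.2⟩, hyc⟩⟩
      · obtain ⟨c, hc, hyc⟩ := exists_eq_zero_right ha hx.radialSol hy.radialSol hμν hν hnd hz0 hxz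
          hx.neumann hyR (by rw [hy.neumann, mul_zero])
          (hx.exists_ne_zero ha hR hz0.1.le hz0.2 le_rfl)
        exact ⟨c, fun _ => ⟨Or.inr hc.1, fun h => absurd h (by omega), ⟨hz0.1.trans hc.1, hc.2⟩, hyc⟩⟩
  choose c hc using hex
  refine ⟨c, fun i hi => (hc i hi).2.2, fun i hi => ?_⟩
  have h1 := (hc i (by omega)).2.1 (by omega)
  have h2 := (hc (i + 1) hi).1.resolve_left (by omega)
  exact h1.trans h2

/-- Each step upwards in the eigenvalue gains a zero. Only a lower bound for the number of zeros is
used, so neither simplicity nor discreteness of the spectrum enters. -/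
lemma exists_hasZeros (ha : 0 < a) (hR : 0 < R) (m : ℕ) : ∀ μ : ℝ,
    ((m + 1 : ℕ) : ℕ∞) ≤ {ν : ℝ | (∃ x X, RadialEigen n a R ν x X) ∧ ν ≤ μ}.encard →
      ∃ ν ≤ μ, ∃ x X, RadialEigen n a R ν x X ∧ HasZeros R x m := by
  induction m with
  | zero =>
    intro μ h
    obtain ⟨ν, ⟨x, X, hx⟩, hν⟩ : {ν : ℝ | (∃ x X, RadialEigen n a R ν x X) ∧ ν ≤ μ}.Nonempty := by
      rw [← encard_pos]; exact lt_of_lt_of_le (by simp) h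
    exact ⟨ν, hν, x, X, hx, fun _ => 0, fun i hi => absurd hi (by omega),
      fun i hi => absurd hi (by omega)⟩
  | succ m ih =>
    intro μ h
    obtain ⟨T, hT, hTc⟩ := exists_subset_encard_eq h
    have hTf : T.Finite := finite_of_encard_eq_coe hTc
    have hne : T.Nonempty := by rw [← encard_pos, hTc]; simp
    obtain ⟨l, hl, hmax⟩ := T.exists_max_image id hTf hne
    have hc' : (T \ {l}).encard = (m + 1 : ℕ) := by
      have := encard_sdiff_singleton_add_one hl
      rw [hTc] at this
      push_cast at this ⊢
      exact WithTop.add_right_cancel ENat.one_ne_top this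
    have hne' : (T \ {l}).Nonempty := by rw [← encard_pos, hc']; simp
    obtain ⟨l', hl', hmax'⟩ := (T \ {l}).exists_max_image id hTf.sdiff hne'
    -- The induction hypothesis is applied at the second largest of the m + 2 chosen eigenvalues,
    -- and the largest is compared with the result.
    have hlt : l' < l := (hmax l' hl'.1).lt_of_ne hl'.2
    obtain ⟨ν, hν, x, X, hx, hz⟩ := ih l' (by
      rw [← hc']
      exact encard_le_encard fun t ht => ⟨(hT ht.1).1, hmax' t ht⟩)
    obtain ⟨⟨y, Y, hy⟩, hlμ⟩ := hT hl
    exact ⟨l, hlμ, y, Y, hy, hx.hasZeros_succ hy ha hR (hν.trans_lt hlt) hz⟩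

end RadialEigen

/-! ### Comparing trajectories with eigenfunctions -/

namespace Restoring

variable {n : ℕ} {a R α μ ν : ℝ} {f w v x X : ℝ → ℝ}

/-- Sturm comparison puts zeros c_0 < ... < c_(k-1) of w to the left of the corresponding zeros of
x. Rolle's theorem gives k - 1 critical points between them, and the Neumann condition on x forces
one more after c_(k-1) and before R. -/
lemma critChain_of_hasZeros (hf : Restoring f) (ha : 0 < a) (hR : 0 < R)
    (hx : RadialEigen n a R μ x X) {k : ℕ} (hk : 1 ≤ k) (hz : HasZeros R x k)
    (h : Trajectory n a f α w v) (hα : α ∈ Ioo (0 : ℝ) 1) (hμν : μ < ν)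
    (hν : ∀ r ∈ Ioo 0 R, ν * |w r| ^ (a + 1) ≤ w r * f (w r)) :
    ∃ t, CritChain v k t ∧ t k < R := by
  obtain ⟨z, hz, hzlt⟩ := hz
  have hs := h.radialSol R
  have hw0 : w 0 ≠ 0 := by rw [h.w_zero]; exact neg_ne_zero.2 hα.1.ne'
  have hnd' : ∀ r ∈ Icc 0 R, w r = 0 → v r ≠ 0 := fun r hr hwr hvr =>
    hf.ne_zero_of_v_eq_zero ha hs hα h.w_zero hr hvr hwr
  have hnd : ∀ r ∈ Ioo 0 R, w r = 0 → v r ≠ 0 := fun r hr => hnd' r (Ioo_subset_Icc_self hr)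
  have hex : ∀ i, ∃ c, i < k → (i = 0 ∨ z (i - 1) < c) ∧ c ∈ Ioo 0 (z i) ∧ w c = 0 := fun i => by
    by_cases hi : i < k
    swap
    · exact ⟨0, fun h => absurd h hi⟩
    obtain ⟨hz1, hxz1⟩ := hz i hi
    rcases Nat.eq_zero_or_pos i with rfl | hi0
    · obtain ⟨c, hc, hyc⟩ := exists_eq_zero_left ha hx.radialSol hs hμν hν hnd hw0 hz1 hxz1
        (hx.exists_ne_zero ha hR le_rfl hz1.1 hz1.2.le)
      exact ⟨c, fun _ => ⟨Or.inl rfl, hc, hyc⟩⟩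
    · obtain ⟨hz0, hxz⟩ := hz (i - 1) (by omega)
      have hlt := hzlt (i - 1) (by omega)
      rw [Nat.sub_add_cancel hi0] at hlt
      obtain ⟨c, hc, hyc⟩ := exists_eq_zero_of_eq_zero_of_eq_zero ha hx.radialSol hs hμν
        hν hnd hz0 hz1 hxz hxz1 (hx.exists_ne_zero ha hR hz0.1.le hlt hz1.2.le)
      exact ⟨c, fun _ => ⟨Or.inr hc.1, ⟨hz0.1.trans hc.1, hc.2⟩, hyc⟩⟩
  choose c hc using hex
  have hcR : ∀ i < k, c i ∈ Ioo 0 R := fun i hi =>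
    ⟨(hc i hi).2.1.1, (hc i hi).2.1.2.trans (hz i hi).1.2⟩
  have hcc : ∀ i, i + 1 < k → c i < c (i + 1) := fun i hi =>
    (hc i (by omega)).2.1.2.trans ((hc (i + 1) hi).1.resolve_left (by omega))
  -- Otherwise w moves away from 0 after its last zero, so w v ≥ 0 at R. The comparison on the last
  -- piece then gives yet another zero of w, and with it a zero of v by Rolle.
  have hlast : ∃ s ∈ Ioo (c (k - 1)) R, v s = 0 := by
    by_contra! hv
    obtain ⟨-, hcz, hwc⟩ := hc (k - 1) (by omega)
    obtain ⟨hzk, hxk⟩ := hz (k - 1) (by omega)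
    have hc0 := hcR (k - 1) (by omega)
    set ζ := c (k - 1) with hζ
    have hne : ∀ r ∈ Ioc ζ R, w r ≠ 0 := fun r hr hwr => by
      obtain ⟨s, hs', hvs⟩ := hs.exists_v_eq_zero hc0.1.le hr.1 hr.2 (hwc.trans hwr.symm)
      exact hv s ⟨hs'.1, hs'.2.trans_le hr.2⟩ hvs
    have hprod : ∀ r ∈ Ioo ζ R, 0 < w r * v r := by
      have hsub : Ioo ζ R ⊆ Icc 0 R := fun r hr => ⟨hc0.1.le.trans hr.1.le, hr.2.le⟩
      have key : ∀ {f w v : ℝ → ℝ}, RadialSol n a f R w v → w ζ = 0 → (∀ r ∈ Ioo ζ R, 0 < v r) →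
          ∀ r ∈ Ioo ζ R, 0 < w r * v r := by
        intro f w v hs hwc hpos r hr
        have := lt_of_hasDerivAt_pos hr.1 (hs.cont_w.mono (Icc_subset_Icc hc0.1.le hr.2.le))
          (fun t ht => hs.deriv_w t ⟨hc0.1.trans ht.1, ht.2.trans hr.2⟩) fun t ht =>
            spow_pos (div_pos (hpos t ⟨ht.1, ht.2.trans hr.2⟩) (pow_pos (hc0.1.trans ht.1) n))
        rw [hwc] at this
        exact mul_pos this (hpos r hr)
      rcases pos_or_neg_of_ne_zero (hs.cont_v.mono hsub) hv with hp | hp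
      · exact key hs hwc hp
      · intro r hr
        have := key hs.neg (by simp [hwc]) (fun r hr => neg_pos.2 (hp r hr)) r hr
        rwa [neg_mul_neg] at this
    have hprodR := nonneg_of_pos_Ioo hc0.2 ((hs.cont_w.mul hs.cont_v).mono
      (Icc_subset_Icc_left hc0.1.le)) hprod R ⟨hc0.2.le, le_rfl⟩
    obtain ⟨s, hs', hws⟩ := exists_eq_zero_right ha hx.radialSol hs hμν hν hnd hzk hxk hx.neumann
      (hne R ⟨hc0.2, le_rfl⟩) hprodR (hx.exists_ne_zero ha hR hzk.1.le hzk.2 le_rfl)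
    exact hne s ⟨hcz.2.trans hs'.1, hs'.2.le⟩ hws
  obtain ⟨s, hs', hvs⟩ := hlast
  have hex' : ∀ i, ∃ t, (i = 0 → t = 0) ∧ (1 ≤ i → i ≤ k → c (i - 1) < t ∧ (i < k → t < c i) ∧
      v t = 0 ∧ t < R) := fun i => by
    by_cases hi : 1 ≤ i ∧ i ≤ k
    swap
    · exact ⟨0, fun _ => rfl, fun h h' => absurd ⟨h, h'⟩ hi⟩
    rcases hi.2.eq_or_lt with rfl | hik
    · exact ⟨s, fun h => by omega, fun _ _ => ⟨hs'.1, fun h => absurd h (by omega), hvs, hs'.2⟩⟩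
    · have hlt := hcc (i - 1) (by omega)
      rw [Nat.sub_add_cancel hi.1] at hlt
      obtain ⟨t, ht, hvt⟩ := hs.exists_v_eq_zero (hcR (i - 1) (by omega)).1.le hlt (hcR i hik).2.le
        ((hc (i - 1) (by omega)).2.2.trans (hc i hik).2.2.symm)
      exact ⟨t, fun h => by omega, fun _ _ => ⟨ht.1, fun _ => ht.2, hvt, ht.2.trans (hcR i hik).2⟩⟩
  choose t ht0 ht using hex'
  refine ⟨t, ⟨ht0 0 rfl, fun i hi => ?_, fun i hi => ?_⟩, (ht k hk le_rfl).2.2.2⟩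
  · have h1 := (ht (i + 1) (by omega) hi).1
    rw [Nat.add_sub_cancel] at h1
    rcases Nat.eq_zero_or_pos i with rfl | hi0
    · rw [ht0 0 rfl]; exact (hcR 0 hi).1.trans h1
    · exact ((ht i hi0 hi.le).2.1 hi).trans h1
  · rcases Nat.eq_zero_or_pos i with rfl | hi0
    · rw [ht0 0 rfl]; exact hs.v_zero
    · exact (ht i hi0 hi).2.2.1

lemma exists_critChain_of_eigen (hf : Restoring f) (ha : 0 < a) (hR : 0 < R)
    (hx : RadialEigen n a R μ x X) {k : ℕ} (hk : 1 ≤ k) (hz : HasZeros R x k) (hμν : μ < ν)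
    (hν : ∃ δ > 0, ∀ s, |s| < δ → ν * |s| ^ (a + 1) ≤ s * f s) :
    ∃ α₀ > 0, ∀ α ∈ Ioo (0 : ℝ) 1, α < α₀ → ∀ w v, Trajectory n a f α w v →
      ∃ t, CritChain v k t ∧ t k < R := by
  obtain ⟨δ, hδ, H⟩ := hν
  obtain ⟨α₀, hα₀, Hα⟩ := hf.exists_forall_abs_lt (n := n) ha hδ
  exact ⟨α₀, hα₀, fun α hα hαα w v h => hf.critChain_of_hasZeros ha hR hx hk hz h hα hμν
    fun r hr => H _ (Hα α hα hαα w v h r hr.1.le)⟩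

end Restoring

/-! ### Oscillation on the half line -/

/-- A global solution with values in an interval `I` on which `f` has the sign of the identity. -/
structure Orbit (n : ℕ) (a : ℝ) (f : ℝ → ℝ) (I : Set ℝ) (w v : ℝ → ℝ) : Prop where
  cont : Continuous f
  ord : I.OrdConnected
  zero_mem : (0 : ℝ) ∈ I
  sign : ∀ s ∈ I, s ≠ 0 → 0 < s * f s
  sol : ∀ R, RadialSol n a f R w v
  mem : ∀ r, 0 ≤ r → w r ∈ I

namespace Orbit

variable {n : ℕ} {a : ℝ} {f : ℝ → ℝ} {I : Set ℝ} {w v : ℝ → ℝ}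

lemma neg (h : Orbit n a f I w v) :
    Orbit n a (fun s => -f (-s)) (Neg.neg ⁻¹' I) (fun r => -w r) (fun r => -v r) where
  cont := (h.cont.comp continuous_neg).neg
  ord := ⟨fun x hx y hy z hz => h.ord.out hy hx ⟨neg_le_neg hz.2, neg_le_neg hz.1⟩⟩
  zero_mem := by simpa using h.zero_mem
  sign s hs hs0 := by
    have := h.sign (-s) hs (neg_ne_zero.2 hs0)
    linarith
  sol R := (h.sol R).neg
  mem r hr := by simpa using h.mem r hr

lemma f_pos (h : Orbit n a f I w v) {s : ℝ} (hs : s ∈ I) (h0 : 0 < s) : 0 < f s :=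
  pos_of_mul_pos_right (h.sign s hs h0.ne') h0.le

lemma f_neg (h : Orbit n a f I w v) {s : ℝ} (hs : s ∈ I) (h0 : s < 0) : f s < 0 := by
  by_contra! hc
  exact absurd (h.sign s hs h0.ne) (not_lt.2 (mul_nonpos_of_nonpos_of_nonneg h0.le hc))

lemma deriv_w (h : Orbit n a f I w v) {r : ℝ} (hr : 0 < r) :
    HasDerivAt w (spow a⁻¹ (v r / r ^ n)) r := (h.sol (r + 1)).deriv_w r ⟨hr, by linarith⟩

lemma deriv_v (h : Orbit n a f I w v) {r : ℝ} (hr : 0 < r) :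
    HasDerivAt v (-(r ^ n * f (w r))) r := (h.sol (r + 1)).deriv_v r ⟨hr, by linarith⟩

lemma cont_w (h : Orbit n a f I w v) {b c : ℝ} (hb : 0 ≤ b) : ContinuousOn w (Icc b c) :=
  (h.sol c).cont_w.mono (Icc_subset_Icc_left hb)

lemma cont_v (h : Orbit n a f I w v) {b c : ℝ} (hb : 0 ≤ b) : ContinuousOn v (Icc b c) :=
  (h.sol c).cont_v.mono (Icc_subset_Icc_left hb)

lemma w_le_of_v_nonneg (h : Orbit n a f I w v) (ha : 0 < a) {b c : ℝ} (hb : 0 ≤ b) (hbc : b ≤ c)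
    (hv : ∀ t ∈ Ioo b c, 0 ≤ v t) : w b ≤ w c :=
  le_of_hasDerivAt_nonneg hbc (h.cont_w hb) (fun t ht => h.deriv_w (hb.trans_lt ht.1))
    fun t ht => by
      have := hb.trans_lt ht.1
      rw [spow_of_nonneg (inv_pos.2 ha) (div_nonneg (hv t ht) (by positivity))]
      exact Real.rpow_nonneg (div_nonneg (hv t ht) (by positivity)) _

lemma w_lt_of_v_pos (h : Orbit n a f I w v) {b c : ℝ} (hb : 0 ≤ b) (hbc : b < c)
    (hv : ∀ t ∈ Ioo b c, 0 < v t) : w b < w c :=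
  lt_of_hasDerivAt_pos hbc (h.cont_w hb) (fun _ ht => h.deriv_w (hb.trans_lt ht.1))
    fun t ht => spow_pos (div_pos (hv t ht) (pow_pos (hb.trans_lt ht.1) n))

lemma v_lt_of_w_neg (h : Orbit n a f I w v) {b c : ℝ} (hb : 0 ≤ b) (hbc : b < c)
    (hw : ∀ t ∈ Ioo b c, w t < 0) : v b < v c :=
  lt_of_hasDerivAt_pos hbc (h.cont_v hb) (fun t ht => h.deriv_v (hb.trans_lt ht.1))
    fun t ht => by
      have h0 := hb.trans_lt ht.1
      have := mul_neg_of_pos_of_neg (pow_pos h0 n) (h.f_neg (h.mem t h0.le) (hw t ht))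
      linarith

/-- A bounded orbit moving outwards turns back. -/
lemma exists_turn (h : Orbit n a f I w v) {b M : ℝ} (hb : 0 < b)
    (hwb : 0 ≤ w b) (hvb : 0 < v b) (hM : M ∈ I)
    (hwM : ∀ r, b ≤ r → (∀ t ∈ Icc b r, 0 < v t) → w r ≤ M) :
    ∃ c, b < c ∧ v c = 0 ∧ ∀ t ∈ Ico b c, 0 < v t := by
  by_contra! hcon
  have hpos : ∀ r, b ≤ r → 0 < v r := by
    intro r hr
    by_contra! hle
    obtain ⟨s, hs, hvs, hlt⟩ := exists_first_hit (g := fun r => -v r) (c := 0) (h.cont_v hb.le).neg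
      (neg_neg_of_pos hvb) ⟨r, ⟨hr, le_rfl⟩, neg_nonneg.2 hle⟩
    obtain ⟨t, ht, htv⟩ := hcon s hs.1 (neg_eq_zero.1 hvs)
    have := hlt t ht
    linarith
  set m := w (b + 1) with hm
  have hm0 : 0 < m := hwb.trans_lt
    (h.w_lt_of_v_pos hb.le (by linarith) fun t ht => hpos t ht.1.le)
  have hmem : ∀ r, b + 1 ≤ r → w r ∈ Icc m M := fun r hr => ⟨by
    rcases hr.eq_or_lt with e | e
    · rw [hm, e]
    · exact (h.w_lt_of_v_pos (by linarith) e fun t ht => hpos t (by linarith [ht.1])).le,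
    hwM r (by linarith) fun t ht => hpos t ht.1⟩
  have hsub : Icc m M ⊆ I := h.ord.out (h.mem _ (by linarith)) hM
  -- If v never vanished, w would stay in the compact interval [m, M], where f is bounded below by f
  -- s > 0. Since t^n ≥ 1 there, v would decrease at least linearly and become negative.
  obtain ⟨s, hs, hmin⟩ := isCompact_Icc.exists_isMinOn ⟨m, hmem _ le_rfl⟩ (h.cont.continuousOn (s := Icc m M))
  have hκ : 0 < f s := h.f_pos (hsub hs) (hm0.trans_le hs.1)
  have hlin : ∀ r, b + 1 ≤ r → v r - v (b + 1) ≤ -f s * (r - (b + 1)) := fun r hr =>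
    sub_le_of_hasDerivAt_le hr (h.cont_v (by linarith)) (fun t ht => h.deriv_v (by linarith [ht.1]))
      fun t ht => by
        have h1 : f s ≤ f (w t) := hmin (hmem t ht.1.le)
        have h2 : (1 : ℝ) ≤ t ^ n := one_le_pow₀ (by linarith [ht.1])
        nlinarith
  have h1 := hlin (b + 1 + v (b + 1) / f s) (by
    have := hpos (b + 1) (by linarith)
    have : 0 < v (b + 1) / f s := by positivity
    linarith)
  have h2 := hpos (b + 1 + v (b + 1) / f s) (by
    have := hpos (b + 1) (by linarith)
    have : 0 < v (b + 1) / f s := by positivity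
    linarith)
  have e : -f s * (b + 1 + v (b + 1) / f s - (b + 1)) = -v (b + 1) := by field_simp; ring
  linarith

/-- An orbit moving inwards crosses the equilibrium when its slope has a lower bound which is not
integrable. -/
lemma exists_cross_of_slope (h : Orbit n a f I w v) {b : ℝ} (hb : 0 ≤ b) (hwb : w b < 0)
    (hvb : 0 ≤ v b) (hslope : (∀ r, b ≤ r → w r < 0) → ∃ κ > 0, ∀ r, b + 1 ≤ r →
      κ / r ≤ spow a⁻¹ (v r / r ^ n)) :
    ∃ c, b < c ∧ w c = 0 ∧ 0 < v c ∧ ∀ t ∈ Ico b c, w t < 0 := by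
  by_cases hex : ∃ r, b ≤ r ∧ 0 ≤ w r
  · obtain ⟨r, hr, hwr⟩ := hex
    obtain ⟨s, hs, hws, hlt⟩ := exists_first_hit (c := 0) (h.cont_w hb) hwb ⟨r, ⟨hr, le_rfl⟩, hwr⟩
    exact ⟨s, hs.1, hws, hvb.trans_lt (h.v_lt_of_w_neg hb hs.1 fun t ht => hlt t ⟨ht.1.le, ht.2⟩),
      hlt⟩
  · push Not at hex
    obtain ⟨κ, hκ, H⟩ := hslope hex
    exfalso
    have hlog : ∀ r, b + 1 ≤ r →
        w (b + 1) - κ * Real.log (b + 1) ≤ w r - κ * Real.log r := fun r hr =>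
      le_of_hasDerivAt_nonneg (f := fun r => w r - κ * Real.log r) hr
        ((h.cont_w (by linarith)).sub (continuousOn_const.mul
          (Real.continuousOn_log.mono fun t ht => (by linarith [ht.1] : 0 < t).ne')))
        (fun t ht => (h.deriv_w (by linarith [ht.1])).sub
          ((Real.hasDerivAt_log (by linarith [ht.1] : 0 < t).ne').const_mul κ)) fun t ht => by
            have := H t ht.1.le
            rw [div_eq_mul_inv] at this
            linarith
    have htend := Real.tendsto_log_atTop.const_mul_atTop hκ
    obtain ⟨r, hr1, hr2⟩ := ((htend.eventually_ge_atTop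
      (κ * Real.log (b + 1) - w (b + 1))).and (eventually_ge_atTop (b + 1))).exists
    have := hlog r hr2
    linarith [hex r (by linarith)]

/-- Here N ≤ p. While w < 0 the flux increases, so w' ≥ (const / r^n)^(1/a) ≥ const / r for r ≥ 1,
which is not integrable. -/
lemma exists_cross_of_le (h : Orbit n a f I w v) (ha : 0 < a) (hna : n ≤ a) {b : ℝ} (hb : 0 ≤ b)
    (hwb : w b < 0) (hvb : 0 ≤ v b) : ∃ c, b < c ∧ w c = 0 ∧ 0 < v c ∧ ∀ t ∈ Ico b c, w t < 0 := by
  refine h.exists_cross_of_slope hb hwb hvb fun hneg => ?_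
  have hκ : 0 < v (b + 1) := hvb.trans_lt
    (h.v_lt_of_w_neg hb (by linarith) fun t ht => hneg t ht.1.le)
  refine ⟨spow a⁻¹ (v (b + 1)), spow_pos hκ, fun r hr => ?_⟩
  have hr0 : 0 < r := by linarith
  have hvr : v (b + 1) ≤ v r := by
    rcases hr.eq_or_lt with e | e
    · rw [e]
    · exact (h.v_lt_of_w_neg (by linarith) e fun t ht => hneg t (by linarith [ht.1])).le
  have h1 : r ^ n ≤ spow a r := by
    rw [spow_of_pos hr0, ← Real.rpow_natCast]
    exact Real.rpow_le_rpow_of_exponent_le (by linarith) hna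
  have h2 : spow a (spow a⁻¹ (v (b + 1)) / r) ≤ v r / r ^ n := by
    have e : spow a (spow a⁻¹ (v (b + 1)) / r) * spow a r = v (b + 1) := by
      rw [← spow_mul, div_mul_cancel₀ _ hr0.ne', spow_spow_inv ha]
    rw [← eq_div_iff (spow_pos hr0).ne'] at e
    rw [e]
    exact div_le_div₀ (hκ.le.trans hvr) hvr (pow_pos hr0 n) h1
  have := spow_mono (inv_pos.2 ha) h2
  rwa [spow_inv_spow ha] at this

/-- The loss of energy along a monotone piece of an orbit. -/
lemma energy_sub_energy_le (h : Orbit n a f I w v) (ha : 0 < a) {ρ Z b c : ℝ} (hρ : 0 < ρ)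
    (hb : ρ ≤ b) (hbc : b ≤ c) (hZ : ∀ r, 0 ≤ r → |v r / r ^ n| ≤ Z)
    (hv : ∀ t ∈ Ioo b c, 0 ≤ v t) :
    energy n a f w v b - energy n a f w v c ≤ n * Z / ρ * (w c - w b) := by
  have hb0 : 0 < b := hρ.trans_le hb
  -- The friction is n / r times the flux density |v / r^n| times w'. Bounding the first two factors
  -- by n Z / ρ leaves the increase of w.
  have := le_of_hasDerivAt_nonneg (f := fun r => energy n a f w v r + n * Z / ρ * w r) hbc
    ((((h.sol c).continuousOn_energy ha h.cont).mono (Icc_subset_Icc_left hb0.le)).add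
      (continuousOn_const.mul (h.cont_w hb0.le)))
    (fun t ht => ((h.sol c).hasDerivAt_energy ha h.cont ⟨hb0.trans ht.1, ht.2⟩).add
      ((h.deriv_w (hb0.trans ht.1)).const_mul _)) fun t ht => by
        have ht0 : 0 < t := hb0.trans ht.1
        have hz : 0 ≤ v t / t ^ n := div_nonneg (hv t ht) (pow_pos ht0 n).le
        have hs : 0 ≤ spow a⁻¹ (v t / t ^ n) := by
          rw [spow_of_nonneg (inv_pos.2 ha) hz]; positivity
        rw [← mul_spow_self (inv_pos.2 ha)]
        have h1 := hZ t ht0.le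
        rw [abs_of_nonneg hz] at h1
        have h2 : (n : ℝ) / t ≤ n / ρ :=
          div_le_div_of_nonneg_left (by positivity) hρ (hb.trans ht.1.le)
        have h3 : (n : ℝ) / t * (v t / t ^ n) ≤ n / ρ * Z := mul_le_mul h2 h1 hz (by positivity)
        have h4 := mul_le_mul_of_nonneg_right h3 hs
        have e : (n : ℝ) * Z / ρ = n / ρ * Z := by ring
        rw [e]
        linarith
  linarith

lemma energy_of_v_eq_zero (ha : 0 < a) {r : ℝ} (hv : v r = 0) :
    energy n a f w v r = potential f (w r) := by
  have hb : a⁻¹ + 1 ≠ 0 := by positivity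
  simp [energy, hv, Real.zero_rpow hb]

/-- Beyond ρ, climbing from -η to 0 costs at most E/4 of the energy. The energy thus stays away from
zero and the orbit cannot creep towards the equilibrium. -/
lemma exists_cross_of_energy (h : Orbit n a f I w v) (ha : 0 < a) {η E ρ Z b : ℝ} (hρ : 0 < ρ)
    (hb : ρ ≤ b) (hη : 0 < η) (hE : 0 < E) (hF : E ≤ potential f (-η))
    (hZ : ∀ r, 0 ≤ r → |v r / r ^ n| ≤ Z) (hρZ : n * Z * η ≤ E / 4 * ρ) (hwb : w b ≤ -η)
    (hvb : 0 ≤ v b) : ∃ c, b < c ∧ w c = 0 ∧ 0 < v c ∧ E / 2 ≤ energy n a f w v c := by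
  have hb0 : 0 < b := hρ.trans_le hb
  have hi : 0 < a⁻¹ := inv_pos.2 ha
  have hloss : ∀ r, b < r → (∀ t ∈ Ico b r, w t < 0) → -η ≤ w r → w r ≤ 0 →
      E * (3 / 4) ≤ energy n a f w v r := by
    intro r hr hneg h1 h2
    obtain ⟨s, hs, hws⟩ := intermediate_value_Icc hr.le (h.cont_w hb0.le) ⟨hwb, h1⟩
    have hvs : ∀ t ∈ Ioo s r, 0 ≤ v t := fun t ht => hvb.trans
      (h.v_lt_of_w_neg hb0.le (hs.1.trans_lt ht.1) fun x hx => hneg x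
        ⟨hx.1.le, hx.2.trans ht.2⟩).le
    have h3 := h.energy_sub_energy_le ha hρ (hb.trans hs.1) hs.2 hZ hvs
    have h4 := RadialSol.potential_le_energy (n := n) (f := f) (w := w) (v := v) ha s
    rw [hws] at h3 h4
    have hZ0 : 0 ≤ Z := (abs_nonneg _).trans (hZ 0 le_rfl)
    have h5 : n * Z / ρ * (w r - -η) ≤ n * Z / ρ * η :=
      mul_le_mul_of_nonneg_left (by linarith) (by positivity)
    have h6 : n * Z / ρ * η ≤ E / 4 := by
      rw [div_mul_eq_mul_div, div_le_iff₀ hρ]; exact hρZ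
    linarith
  obtain ⟨c, hc, hwc, hvc, hneg⟩ := h.exists_cross_of_slope hb0.le (hwb.trans_lt (by linarith)) hvb
    fun hneg => by
    obtain ⟨η', hη', hη'η, hsm⟩ : ∃ η' > 0, η' ≤ η ∧ ∀ s ∈ Icc (-η') 0, potential f s ≤ E / 4 := by
      have hc : Tendsto (potential f) (𝓝 0) (𝓝 0) := by
        simpa using (continuous_potential h.cont).tendsto 0
      obtain ⟨ε, hε, H⟩ := Metric.eventually_nhds_iff.1
        (hc.eventually (ge_mem_nhds (by positivity : 0 < E / 4)))
      refine ⟨min (ε / 2) η, by positivity, min_le_right _ _, fun s hs => H ?_⟩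
      rw [Real.dist_eq, sub_zero, abs_of_nonpos hs.2]
      linarith [hs.1, min_le_left (ε / 2) η]
    have hvpos : ∀ r, b < r → 0 < v r := fun r hr => hvb.trans_lt
      (h.v_lt_of_w_neg hb0.le hr fun t ht => hneg t ht.1.le)
    have hne : (Icc (w b) (-η')).Nonempty := ⟨w b, le_rfl, by linarith⟩
    obtain ⟨s, hs, hmax⟩ := isCompact_Icc.exists_isMaxOn hne (h.cont.continuousOn (s := Icc (w b) (-η')))
    have hsI : s ∈ I := h.ord.out (h.mem b hb0.le) h.zero_mem ⟨hs.1, by linarith [hs.2]⟩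
    have hκ : f s < 0 := h.f_neg hsI (by linarith [hs.2])
    set z₁ := ((a⁻¹ + 1) * (E / 4)) ^ (a⁻¹ + 1)⁻¹ with hz₁
    have hz₁0 : 0 < z₁ := by positivity
    set z₂ := -f s / (n + 1) with hz₂
    have hz₂0 : 0 < z₂ := div_pos (by linarith) (by positivity)
    -- Two regimes. Close to 0 the potential is at most E/4, so the kinetic part is at least E/4,
    -- which gives z₁. Farther away -f is bounded below, and integrating from b gives z₂, the
    -- condition r ≥ b + 1 ensuring r^(n+1) - b^(n+1) ≥ r^n.
    have hz : ∀ r, b + 1 ≤ r → min z₁ z₂ ≤ v r / r ^ n := by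
      intro r hr
      have hr0 : 0 < r := by linarith
      have hrn := pow_pos hr0 n
      have hbr : b < r := by linarith
      rcases le_or_gt (-η') (w r) with h1 | h1
      · refine (min_le_left _ _).trans ?_
        have h2 := hloss r hbr (fun t ht => hneg t ht.1) (by linarith) (hneg r hbr.le).le
        have h3 := hsm (w r) ⟨h1, (hneg r hbr.le).le⟩
        unfold energy at h2
        have h4 : E / 4 ≤ (a⁻¹ + 1)⁻¹ * |v r / r ^ n| ^ (a⁻¹ + 1) := by linarith
        have hp : 0 < a⁻¹ + 1 := by positivity
        rw [le_inv_mul_iff₀ hp] at h4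
        calc z₁ ≤ (|v r / r ^ n| ^ (a⁻¹ + 1)) ^ (a⁻¹ + 1)⁻¹ :=
              Real.rpow_le_rpow (by positivity) h4 (by positivity)
          _ = |v r / r ^ n| := Real.rpow_rpow_inv (abs_nonneg _) hp.ne'
          _ = v r / r ^ n := abs_of_pos (div_pos (hvpos r hbr) hrn)
      · refine (min_le_right _ _).trans ?_
        have h2 := (h.sol r).mul_pow_sub_le_v_sub (c := -f s) hb0.le hbr.le le_rfl fun t ht =>
          neg_le_neg (hmax ⟨h.w_le_of_v_nonneg ha hb0.le ht.1.le fun x hx => (hvpos x hx.1).le,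
            (h.w_le_of_v_nonneg ha (hb0.le.trans ht.1.le) ht.2.le fun x hx =>
              (hvpos x (ht.1.trans hx.1)).le).trans h1.le⟩)
        have h3 : r ^ n ≤ r ^ (n + 1) - b ^ (n + 1) := by
          have h4 : b ^ n ≤ r ^ n := pow_le_pow_left₀ hb0.le hbr.le n
          rw [pow_succ, pow_succ]
          nlinarith [mul_le_mul_of_nonneg_right h4 hb0.le]
        rw [hz₂, le_div_iff₀ hrn]
        have h5 : -f s / (n + 1) * r ^ n ≤ -f s * ((r ^ (n + 1) - b ^ (n + 1)) / (n + 1)) := by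
          rw [div_mul_eq_mul_div, ← mul_div_assoc]
          exact div_le_div_of_nonneg_right (mul_le_mul_of_nonneg_left h3 (by linarith))
            (by positivity)
        linarith
    have hm0 : 0 < min z₁ z₂ := lt_min hz₁0 hz₂0
    refine ⟨spow a⁻¹ (min z₁ z₂), spow_pos hm0, fun r hr => ?_⟩
    refine (div_le_self (spow_pos hm0).le (by linarith)).trans (spow_mono hi (hz r hr))
  refine ⟨c, hc, hwc, hvc, ?_⟩
  have := hloss c hc hneg (by linarith) hwc.le
  linarith

/-- Half a rotation with controlled loss of amplitude. -/
lemma exists_half_rotation (h : Orbit n a f I w v) (ha : 0 < a) {η η' E ρ Z b : ℝ} (hρ : 0 < ρ)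
    (hb : ρ ≤ b) (hη : 0 < η) (hη' : η' ≤ η) (hE : 0 < E) (hF : E ≤ potential f (-η))
    (hsmall : ∀ s ∈ Ico 0 η', potential f s < E / 4)
    (hZ : ∀ r, 0 ≤ r → |v r / r ^ n| ≤ Z) (hρZ : n * Z * η ≤ E / 4 * ρ) (hwb : w b ≤ -η)
    (hvb : 0 ≤ v b) (hturn : ∀ c, b < c → w c = 0 → 0 < v c →
      ∃ M ∈ I, ∀ r, c ≤ r → (∀ t ∈ Icc c r, 0 < v t) → w r ≤ M) :
    ∃ c, b < c ∧ v c = 0 ∧ η' ≤ w c := by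
  have hb0 : 0 < b := hρ.trans_le hb
  obtain ⟨c, hc, hwc, hvc, hEc⟩ := h.exists_cross_of_energy ha hρ hb hη hE hF hZ hρZ hwb hvb
  obtain ⟨M, hM, hwM⟩ := hturn c hc hwc hvc
  obtain ⟨d, hd, hvd, hpos⟩ := h.exists_turn (hb0.trans hc) hwc.ge hvc hM hwM
  refine ⟨d, hc.trans hd, hvd, ?_⟩
  -- At a turning point all energy is potential. An amplitude below η' would mean energy less than
  -- E/4 there, plus a loss of at most E/4 since the crossing, against E/2 at the crossing.
  by_contra! hlt
  have h1 := h.energy_sub_energy_le ha hρ (hb.trans hc.le) hd.le hZ fun t ht =>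
    (hpos t ⟨ht.1.le, ht.2⟩).le
  have h2 : w c < w d := h.w_lt_of_v_pos (hb0.trans hc).le hd fun t ht => hpos t ⟨ht.1.le, ht.2⟩
  rw [energy_of_v_eq_zero ha hvd, hwc, sub_zero] at h1
  rw [hwc] at h2
  have h3 := hsmall (w d) ⟨h2.le, hlt⟩
  have hZ0 : 0 ≤ Z := (abs_nonneg _).trans (hZ 0 le_rfl)
  have h4 : n * Z / ρ * w d ≤ n * Z / ρ * η :=
    mul_le_mul_of_nonneg_left (by linarith) (by positivity)
  have h5 : n * Z / ρ * η ≤ E / 4 := by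
    rw [div_mul_eq_mul_div, div_le_iff₀ hρ]; exact hρZ
  linarith

/-- In the subcritical range `p < N`, an orbit moving outwards stays bounded. -/
lemma exists_bound_of_lt (h : Orbit n a f I w v) (ha : 0 < a) (hna : a < n) {b : ℝ} (hb : 0 < b)
    (hwb : 0 ≤ w b) (hvb : 0 < v b) :
    ∃ M ≥ 0, ∀ r, b ≤ r → (∀ t ∈ Icc b r, 0 < v t) → w r ≤ M := by
  have hi : 0 < a⁻¹ := inv_pos.2 ha
  -- Outwards from b the flux decreases, so w' ≤ K r^(-γ) with γ > 1, which is integrable. The bound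
  -- M is w b plus the integral over [b, ∞).
  set γ := n * a⁻¹ with hγ
  have hγ1 : 0 < γ - 1 := by
    rw [hγ, ← div_eq_mul_inv, sub_pos, one_lt_div ha]; exact hna
  set K := v b ^ a⁻¹ with hK
  have hK0 : 0 < K := Real.rpow_pos_of_pos hvb _
  refine ⟨w b + K / (γ - 1) * b ^ (-(γ - 1)), by positivity, fun r hr hpos => ?_⟩
  have hfpos : ∀ t ∈ Ioc b r, 0 < f (w t) := fun t ht =>
    h.f_pos (h.mem t (hb.trans ht.1).le) (hwb.trans_lt
      (h.w_lt_of_v_pos hb.le ht.1 fun x hx => hpos x ⟨hx.1.le, hx.2.le.trans ht.2⟩))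
  have hvle : ∀ t ∈ Ioo b r, v t ≤ v b := fun t ht => by
    have := le_of_hasDerivAt_nonneg (f := fun t => -v t) ht.1.le (h.cont_v hb.le).neg
      (fun x hx => (h.deriv_v (hb.trans hx.1)).neg) fun x hx => by
        have := mul_pos (pow_pos (hb.trans hx.1) n) (hfpos x ⟨hx.1, (hx.2.trans ht.2).le⟩)
        rw [neg_neg]
        exact this.le
    linarith
  have hG := le_of_hasDerivAt_nonneg
    (f := fun t => -w t - K / (γ - 1) * t ^ (-(γ - 1))) hr
    ((h.cont_w hb.le).neg.sub (continuousOn_const.mul (continuousOn_id.rpow_const fun t ht =>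
      Or.inl (hb.trans_le ht.1).ne')))
    (fun t ht => (h.deriv_w (hb.trans ht.1)).neg.sub
      ((Real.hasDerivAt_rpow_const (p := -(γ - 1)) (Or.inl (hb.trans ht.1).ne')).const_mul _))
    fun t ht => by
      have ht0 : 0 < t := hb.trans ht.1
      have hvt : 0 < v t := hpos t ⟨ht.1.le, ht.2.le⟩
      have e : K / (γ - 1) * (-(γ - 1) * t ^ (-(γ - 1) - 1)) = -(v b / t ^ n) ^ a⁻¹ := by
        rw [Real.div_rpow hvb.le (by positivity), ← Real.rpow_natCast, ← Real.rpow_mul ht0.le,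
          ← hγ, ← hK, show -(γ - 1) - 1 = -γ by ring, Real.rpow_neg ht0.le]
        field_simp
      rw [e, spow_of_pos (by positivity)]
      have : (v t / t ^ n) ^ a⁻¹ ≤ (v b / t ^ n) ^ a⁻¹ :=
        Real.rpow_le_rpow (by positivity)
          (div_le_div_of_nonneg_right (hvle t ht) (by positivity)) hi.le
      linarith
  have h1 : 0 ≤ K / (γ - 1) * r ^ (-(γ - 1)) := by
    have : 0 ≤ r := hb.le.trans hr
    positivity
  linarith

end Orbit

/-- A dependent choice of successive critical points, with P i carrying what the i-th step needs.
The starting point b itself is not required to be a zero of v. -/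
lemma exists_chain {v : ℝ → ℝ} {P : ℕ → ℝ → Prop} {k : ℕ}
    (hstep : ∀ i < k, ∀ b, P i b → ∃ c, b < c ∧ v c = 0 ∧ P (i + 1) c) {b : ℝ} (hb : P 0 b) :
    ∃ t : ℕ → ℝ, t 0 = b ∧ (∀ i < k, t i < t (i + 1)) ∧ (∀ i, 1 ≤ i → i ≤ k → v (t i) = 0) := by
  have hex : ∀ i b, ∃ c, i < k → P i b → b < c ∧ v c = 0 ∧ P (i + 1) c := by
    intro i b
    by_cases h : i < k ∧ P i b
    · obtain ⟨c, hc⟩ := hstep i h.1 b h.2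
      exact ⟨c, fun _ _ => hc⟩
    · exact ⟨b, fun h1 h2 => absurd ⟨h1, h2⟩ h⟩
  choose F hF using hex
  let t : ℕ → ℝ := fun i => Nat.rec b (fun i x => F i x) i
  have hP : ∀ i ≤ k, P i (t i) := by
    intro i
    induction i with
    | zero => exact fun _ => hb
    | succ i ih => exact fun hi => (hF i (t i) (by omega) (ih (by omega))).2.2
  refine ⟨t, rfl, fun i hi => (hF i (t i) hi (hP i hi.le)).1, fun i h1 hi => ?_⟩
  obtain ⟨i, rfl⟩ : ∃ m, i = m + 1 := ⟨i - 1, by omega⟩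
  exact (hF i (t i) (by omega) (hP i (by omega))).2.1

lemma Trajectory.orbit {n : ℕ} {a α : ℝ} {f w v : ℝ → ℝ} (hf : Restoring f) (ha : 0 < a)
    (h : Trajectory n a f α w v) (hα : α ∈ Ioo (0 : ℝ) 1) : Orbit n a f (Ioi (-1)) w v where
  cont := hf.cont
  ord := ordConnected_Ioi
  zero_mem := Restoring.zero_mem
  sign := hf.sign
  sol := h.radialSol
  mem r hr := hf.neg_one_lt ha (h.radialSol r) hα h.w_zero ⟨hr, le_rfl⟩

namespace Restoring

variable {n : ℕ} {a : ℝ} {f : ℝ → ℝ}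

/-- F need not be coercive at infinity. Taking F(-α) < F(1) confines the orbit to [-α, 1], so it
must turn after every crossing; the other side follows by reflecting w. -/
lemma exists_critChain_of_le (hf : Restoring f) (ha : 0 < a) (hna : n ≤ a) (k : ℕ) :
    ∃ α ∈ Ioo (0 : ℝ) 1, ∀ w v, Trajectory n a f α w v → ∃ t, CritChain v k t := by
  obtain ⟨α, hα, hle⟩ : ∃ α ∈ Ioo (0 : ℝ) 1, potential f (-α) < potential f 1 := by
    have hp : 0 < potential f 1 :=
      potential_pos hf.cont zero_mem hf.sign (by simp) one_ne_zero
    have hc : Tendsto (fun α => potential f (-α)) (𝓝[>] 0) (𝓝 0) := by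
      have := ((continuous_potential hf.cont).comp continuous_neg).tendsto 0
      simp only [Function.comp_def, neg_zero, potential_zero] at this
      exact this.mono_left nhdsWithin_le_nhds
    obtain ⟨α, h1, h2⟩ := ((hc.eventually (gt_mem_nhds hp)).and
      (Ioo_mem_nhdsGT (zero_lt_one' ℝ))).exists
    exact ⟨α, h2, h1⟩
  refine ⟨α, hα, fun w v h => ?_⟩
  have ho := h.orbit hf ha hα
  have hne : ∀ r, 0 ≤ r → v r = 0 → w r ≠ 0 := fun r hr =>
    hf.ne_zero_of_v_eq_zero ha (h.radialSol r) hα h.w_zero ⟨hr, le_rfl⟩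
  have hw1 : ∀ r, 0 ≤ r → w r ≤ 1 := fun r hr => by
    by_contra! hlt
    have h1 := (h.radialSol r).potential_le_potential_zero ha hf.cont (r := r) ⟨hr, le_rfl⟩
    rw [h.w_zero] at h1
    have := potential_lt_of_nonneg hf.cont zero_mem hf.sign zero_le_one hlt (ho.mem r hr)
    linarith
  have hwα : ∀ r, 0 ≤ r → -α ≤ w r := fun r hr =>
    hf.neg_le_of_radialSol ha (h.radialSol r) hα h.w_zero ⟨hr, le_rfl⟩
  have key : ∀ {f' : ℝ → ℝ} {I w' v'} {M : ℝ}, Orbit n a f' I w' v' → M ∈ I →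
      (∀ r, 0 ≤ r → w' r ≤ M) → ∀ b, 0 ≤ b → w' b < 0 → 0 ≤ v' b →
      ∃ c, b < c ∧ v' c = 0 := fun ho hM hwM b hb hwb hvb => by
    obtain ⟨c, hc, hwc, hvc, -⟩ := ho.exists_cross_of_le ha hna hb hwb hvb
    obtain ⟨d, hd, hvd, -⟩ := ho.exists_turn (hb.trans_lt hc) hwc.ge hvc hM
      fun r hr _ => hwM r ((hb.trans hc.le).trans hr)
    exact ⟨d, hc.trans hd, hvd⟩
  obtain ⟨t, ht0, hlt, hv⟩ := exists_chain (v := v) (k := k) (b := 0)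
    (P := fun _ b => 0 ≤ b ∧ v b = 0) (fun i _ b hb => by
      rcases (hne b hb.1 hb.2).lt_or_gt with hw | hw
      · obtain ⟨c, hc, hvc⟩ := key ho (by norm_num : (1 : ℝ) ∈ Ioi (-1)) hw1 b hb.1 hw hb.2.ge
        exact ⟨c, hc, hvc, hb.1.trans hc.le, hvc⟩
      · obtain ⟨c, hc, hvc⟩ := key ho.neg (M := α) (by simpa using hα.2)
          (fun r hr => neg_le.1 (hwα r hr)) b hb.1 (neg_neg_of_pos hw) (by simp [hb.2])
        exact ⟨c, hc, neg_eq_zero.1 hvc, hb.1.trans hc.le, neg_eq_zero.1 hvc⟩)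
    ⟨le_rfl, (h.radialSol 0).v_zero⟩
  exact ⟨t, ht0, hlt, fun i hi => by
    rcases Nat.eq_zero_or_pos i with rfl | h0
    · rw [ht0]; exact (h.radialSol 0).v_zero
    · exact hv i h0 hi⟩

/-- Far from the origin the damping is so weak that the amplitude of the next extremum is bounded
below in terms of the amplitude of the present one. -/
lemma exists_next_extremum (hf : Restoring f) (ha : 0 < a) (hna : a < n) {η : ℝ}
    (hη : η ∈ Ioo (0 : ℝ) 1) : ∃ η' ∈ Ioc 0 η, ∃ ρ > 0, ∀ α ∈ Ioo (0 : ℝ) 1, ∀ w v,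
      Trajectory n a f α w v → ∀ b, ρ ≤ b → (w b ≤ -η ∧ 0 ≤ v b ∨ η ≤ w b ∧ v b ≤ 0) →
      ∃ c, b < c ∧ v c = 0 ∧ (w c ≤ -η' ∨ η' ≤ w c) := by
  set E := min (potential f η) (potential f (-η)) with hE
  have hE0 : 0 < E := lt_min
    (potential_pos hf.cont zero_mem hf.sign (by simp; linarith [hη.1]) hη.1.ne')
    (potential_pos hf.cont zero_mem hf.sign (by simp; linarith [hη.2]) (neg_neg_of_pos hη.1).ne)
  obtain ⟨η', hη', hsm⟩ : ∃ η' ∈ Ioc 0 η, ∀ s, |s| < η' → potential f s < E / 4 := by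
    have hc : Tendsto (potential f) (𝓝 0) (𝓝 0) := by
      simpa using (continuous_potential hf.cont).tendsto 0
    obtain ⟨ε, hε, H⟩ := Metric.eventually_nhds_iff.1
      (hc.eventually (gt_mem_nhds (by positivity : 0 < E / 4)))
    refine ⟨min ε η, ⟨lt_min hε hη.1, min_le_right _ _⟩, fun s hs => H ?_⟩
    rw [Real.dist_eq, sub_zero]
    exact hs.trans_le (min_le_left _ _)
  set Z := ((a⁻¹ + 1) * potential f (-1)) ^ (a⁻¹ + 1)⁻¹ with hZ
  -- Beyond this radius the energy lost over a change of η in w is at most E/4. It depends on η but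
  -- not on α, which permits choosing α afterwards.
  set ρ := max 1 (4 * n * Z * η / E) with hρ
  have hρ0 : 0 < ρ := lt_max_of_lt_left one_pos
  have hρZ : n * Z * η ≤ E / 4 * ρ := by
    have : 4 * n * Z * η / E ≤ ρ := le_max_right _ _
    rw [div_le_iff₀ hE0] at this
    linarith
  refine ⟨η', hη', ρ, hρ0, fun α hα w v h b hb hcase => ?_⟩
  have ho := h.orbit hf ha hα
  have hZv : ∀ r, 0 ≤ r → |v r / r ^ n| ≤ Z := fun r hr =>
    hf.abs_flux_le ha (h.radialSol r) hα h.w_zero ⟨hr, le_rfl⟩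
  rcases hcase with ⟨hwb, hvb⟩ | ⟨hwb, hvb⟩
  · obtain ⟨c, hc, hvc, hwc⟩ := ho.exists_half_rotation ha hρ0 hb hη.1 hη'.2 hE0 (min_le_right _ _)
      (fun s hs => hsm s (by rw [abs_of_nonneg hs.1]; exact hs.2)) hZv hρZ hwb hvb
      fun c hc hwc hvc => by
        obtain ⟨M, hM, H⟩ := ho.exists_bound_of_lt ha hna (hρ0.trans_le (hb.trans hc.le)) hwc.ge hvc
        exact ⟨M, by simp only [mem_Ioi]; linarith, H⟩
    exact ⟨c, hc, hvc, Or.inr hwc⟩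
  · obtain ⟨c, hc, hvc, hwc⟩ := ho.neg.exists_half_rotation ha hρ0 hb hη.1 hη'.2 hE0
      (by rw [potential_neg]; exact min_le_left _ _)
      (fun s hs => by
        rw [← neg_neg s, potential_neg]
        exact hsm _ (by rw [abs_neg, abs_of_nonneg hs.1]; exact hs.2))
      (fun r hr => by rw [neg_div, abs_neg]; exact hZv r hr) hρZ (neg_le_neg hwb)
      (neg_nonneg.2 hvb) fun c hc _ _ => ⟨α, by simpa using hα.2, fun r hr _ => neg_le.1
        (hf.neg_le_of_radialSol ha (h.radialSol r) hα h.w_zero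
          ⟨(hρ0.le.trans hb).trans (hc.le.trans hr), le_rfl⟩)⟩
    exact ⟨c, hc, neg_eq_zero.1 hvc, Or.inl (by linarith)⟩

/-- The amplitudes and their threshold radii for k half turns are fixed first, starting from
amplitude 1/2. Then α is taken so close to 1 that w is still below -1/2 at the largest threshold ρ',
where the half turns begin. -/
lemma exists_critChain_of_lt (hf : Restoring f) (ha : 0 < a) (hna : a < n) {C : ℝ}
    (hC : ∀ s ∈ Ioo (-1 : ℝ) 0, -f s ≤ C * (1 + s) ^ a) (k : ℕ) :
    ∃ α ∈ Ioo (0 : ℝ) 1, ∀ w v, Trajectory n a f α w v → ∃ t, CritChain v k t := by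
  have hex : ∀ η : Ioo (0 : ℝ) 1, ∃ η' : Ioo (0 : ℝ) 1, ∃ ρ > 0, ∀ α ∈ Ioo (0 : ℝ) 1, ∀ w v,
      Trajectory n a f α w v → ∀ b, ρ ≤ b →
      (w b ≤ -η ∧ 0 ≤ v b ∨ η ≤ w b ∧ v b ≤ 0) →
      ∃ c, b < c ∧ v c = 0 ∧ (w c ≤ -η' ∨ η' ≤ w c) := fun η => by
    obtain ⟨η', hη', H⟩ := hf.exists_next_extremum ha hna η.2
    exact ⟨⟨η', hη'.1, hη'.2.trans_lt η.2.2⟩, H⟩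
  choose next ρ hρ H using hex
  let η₀ : Ioo (0 : ℝ) 1 := ⟨1 / 2, by norm_num⟩
  let lev : ℕ → Ioo (0 : ℝ) 1 := fun i => next^[i] η₀
  have hlev : ∀ i, lev (i + 1) = next (lev i) := fun i => Function.iterate_succ_apply' next i η₀
  obtain ⟨ρ', hρ'⟩ : ∃ ρ' > 0, ∀ i ∈ Finset.range (k + 1), ρ (lev i) ≤ ρ' := by
    have hb := ((Finset.range (k + 1)).image fun i => ρ (lev i)).exists_le
    obtain ⟨m, hm⟩ := hb
    exact ⟨max m 1, lt_max_of_lt_right one_pos, fun i hi =>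
      (hm _ (Finset.mem_image_of_mem _ hi)).trans (le_max_left _ _)⟩
  obtain ⟨α₀, hα₀, Hα⟩ := hf.exists_forall_lt_of_near_one (n := n) ha hC
    (η := 1 / 2) (by norm_num) hρ'.1
  obtain ⟨α, hα⟩ := exists_between (max_lt hα₀ one_pos)
  have hα' : α ∈ Ioo (0 : ℝ) 1 := ⟨(le_max_right _ _).trans_lt hα.1, hα.2⟩
  refine ⟨α, hα', fun w v h => ?_⟩
  have hw := Hα α hα' ((le_max_left _ _).trans_lt hα.1) w v h
  have hvρ : 0 < v ρ' := by
    have := (h.orbit hf ha hα').v_lt_of_w_neg le_rfl hρ'.1 fun t ht =>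
      (hw t ⟨ht.1.le, ht.2.le⟩).trans (by norm_num)
    rwa [(h.radialSol 0).v_zero] at this
  obtain ⟨t, ht0, hlt, hv⟩ := exists_chain (v := v) (k := k) (b := ρ')
    (P := fun i b => ρ' ≤ b ∧ (w b ≤ -lev i ∧ 0 ≤ v b ∨ lev i ≤ w b ∧ v b ≤ 0))
    (fun i hi b hb => by
      obtain ⟨c, hc, hvc, hwc⟩ := H (lev i) α hα' w v h b
        ((hρ'.2 i (Finset.mem_range.2 (by omega))).trans hb.1) hb.2
      refine ⟨c, hc, hvc, hb.1.trans hc.le, ?_⟩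
      rw [hlev]
      exact hwc.imp (fun h => ⟨h, hvc.ge⟩) fun h => ⟨h, hvc.le⟩)
    ⟨le_rfl, Or.inl ⟨(hw ρ' ⟨hρ'.1.le, le_rfl⟩).le, hvρ.le⟩⟩
  -- The chain was started at ρ', which is not critical; its first entry is moved to the critical
  -- point 0.
  refine ⟨fun i => if i = 0 then 0 else t i, by simp, fun i hi => ?_, fun i hi => ?_⟩
  · have := hlt i hi
    rcases Nat.eq_zero_or_pos i with rfl | h0
    · rw [ht0] at this
      simpa using hρ'.1.trans this
    · simpa [h0.ne'] using this
  · rcases Nat.eq_zero_or_pos i with rfl | h0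
    · simpa using (h.radialSol 0).v_zero
    · simpa [h0.ne'] using hv i h0 hi

/-- Some trajectory oscillates at least `k` times. -/
theorem exists_critChain (hf : Restoring f) (ha : 0 < a) {C : ℝ}
    (hC : ∀ s ∈ Ioo (-1 : ℝ) 0, -f s ≤ C * (1 + s) ^ a) (k : ℕ) :
    ∃ α ∈ Ioo (0 : ℝ) 1, ∀ w v, Trajectory n a f α w v → ∃ t, CritChain v k t := by
  rcases le_or_gt (n : ℝ) a with h | h
  · exact hf.exists_critChain_of_le ha h k
  · exact hf.exists_critChain_of_lt ha h hC k

end Restoring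

/-! ### Integration over balls in polar coordinates -/

section Polar

variable {E : Type*} [NormedAddCommGroup E] [NormedSpace ℝ E] [MeasurableSpace E] [BorelSpace E]
  [Nontrivial E] [FiniteDimensional ℝ E] (μ : Measure E) [μ.IsAddHaarMeasure]

/-- A function on a ball whose weighted integral along each radius vanishes has mean zero. -/
lemma integral_ball_eq_zero_of_radii {H : E → ℝ} {R : ℝ} {n : ℕ}
    (hn : Module.finrank ℝ E = n + 1) (hH : IntegrableOn H (Metric.ball 0 R) μ)
    (h0 : ∀ θ : E, ‖θ‖ = 1 → ∫ r in Ioo 0 R, r ^ n * H (r • θ) = 0) :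
    ∫ x in Metric.ball 0 R, H x ∂μ = 0 := by
  set G : E → ℝ := (Metric.ball 0 R).indicator H with hG
  have hGi : Integrable G μ := (integrable_indicator_iff measurableSet_ball).2 hH
  rw [← integral_indicator measurableSet_ball, ← hG]
  have hemb := (homeomorphUnitSphereProd E).symm.measurableEmbedding
  have hmp := μ.measurePreserving_homeomorphUnitSphereProd
  rw [hn, Nat.add_sub_cancel] at hmp
  have hmp' : MeasurePreserving (homeomorphUnitSphereProd E).symm
      (μ.toSphere.prod (.volumeIoiPow n)) (μ.comap (↑)) :=
    hmp.symm (homeomorphUnitSphereProd E).toMeasurableEquiv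
  have e1 : ∫ x, G x ∂μ = ∫ x : ({(0)}ᶜ : Set E), G x ∂(μ.comap (↑)) := by
    rw [integral_subtype_comap (measurableSet_singleton _).compl, restrict_compl_singleton]
  have hGi' : Integrable (fun x : ({(0)}ᶜ : Set E) => G x) (μ.comap (↑)) := by
    have := (integrableOn_iff_comap_subtypeVal (μ := μ) (f := G)
      (measurableSet_singleton (0 : E)).compl).1 hGi.integrableOn
    exact this
  have hprod : Integrable (fun z => G ((homeomorphUnitSphereProd E).symm z))
      (μ.toSphere.prod (.volumeIoiPow n)) := (hmp'.integrable_comp_emb hemb).2 hGi'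
  rw [e1, ← hmp'.integral_comp hemb (fun x : ({(0)}ᶜ : Set E) => G x),
    integral_prod _ hprod]
  refine integral_eq_zero_of_ae (Eventually.of_forall fun θ => ?_)
  have hθ : ‖(θ : E)‖ = 1 := by simp
  simp only [homeomorphUnitSphereProd_symm_apply_coe, Measure.volumeIoiPow, ENNReal.ofReal,
    Pi.zero_apply]
  rw [integral_withDensity_eq_integral_smul (by fun_prop),
    integral_subtype_comap measurableSet_Ioi
      fun r : ℝ => Real.toNNReal (r ^ n) • G (r • (θ : E))]
  refine Eq.trans ?_ (h0 θ hθ)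
  rw [← integral_indicator measurableSet_Ioi, ← integral_indicator measurableSet_Ioo]
  congr 1
  ext r
  by_cases hr : 0 < r
  · by_cases hrR : r < R
    · have : r • (θ : E) ∈ Metric.ball (0 : E) R := by
        simpa [norm_smul, hθ, abs_of_pos hr] using hrR
      simp [hr, hrR, hG, this, NNReal.smul_def, pow_nonneg hr.le n]
    · have : r • (θ : E) ∉ Metric.ball (0 : E) R := by
        simpa [norm_smul, hθ, abs_of_pos hr] using hrR
      simp [hrR, hG, this]
  · simp [hr]

lemma exists_integral_ball_norm_eq {n : ℕ} (hn : Module.finrank ℝ E = n + 1) :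
    ∃ c > 0, ∀ (f : ℝ → ℝ) (R : ℝ),
      ∫ x in Metric.ball 0 R, f ‖x‖ ∂μ = c * ∫ r in Ioo 0 R, r ^ n * f r := by
  refine ⟨(n + 1) * μ.real (Metric.ball 0 1), by
    have : 0 < μ.real (Metric.ball (0 : E) 1) :=
      ENNReal.toReal_pos (Metric.measure_ball_pos μ 0 one_pos).ne' measure_ball_lt_top.ne
    positivity, fun f R => ?_⟩
  have e : (Metric.ball (0 : E) R).indicator (fun x => f ‖x‖)
      = fun x => (Iio R).indicator f ‖x‖ := by
    ext x; simp [indicator]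
  rw [← integral_indicator measurableSet_ball, e, integral_fun_norm_addHaar, hn,
    Nat.add_sub_cancel, ← integral_indicator measurableSet_Ioi,
    ← integral_indicator measurableSet_Ioo]
  simp only [nsmul_eq_mul, smul_eq_mul, ← mul_assoc, Nat.cast_add, Nat.cast_one]
  congr 2
  ext r
  by_cases h1 : 0 < r <;> by_cases h2 : r < R <;> simp [indicator, h1, h2]

end Polar

/-! ### Radial vector fields and gradients of radial functions -/

section RadialField

variable {E : Type*} [NormedAddCommGroup E] [InnerProductSpace ℝ E]

/-- The radial vector field with radial component `c`. -/
noncomputable def radialField (c : ℝ → ℝ) (x : E) : E := (c ‖x‖ / ‖x‖) • x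

lemma norm_radialField {c : ℝ → ℝ} {x : E} (h0 : x = 0 → c 0 = 0) :
    ‖radialField c x‖ = |c ‖x‖| := by
  rcases eq_or_ne x 0 with rfl | hx
  · simp [radialField, h0 rfl]
  · have := norm_pos_iff.2 hx
    rw [radialField, norm_smul, norm_div, norm_norm, Real.norm_eq_abs, div_mul_cancel₀ _ this.ne']

lemma rpow_norm_smul_radialField {c : ℝ → ℝ} {p : ℝ} {x : E} (h0 : x = 0 → c 0 = 0) :
    ‖radialField c x‖ ^ (p - 2) • radialField c x = radialField (fun r => spow (p - 1) (c r)) x := by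
  have := abs_rpow_sub_one_mul (p - 1) (c ‖x‖)
  rw [show p - 1 - 1 = p - 2 by ring] at this
  rw [norm_radialField h0, radialField, smul_smul, ← mul_div_assoc, this, radialField]

lemma continuous_radialField {c : ℝ → ℝ} (hc : ContinuousOn c (Ici 0)) (h0 : c 0 = 0) :
    Continuous (radialField c : E → E) := by
  have hcn : Continuous fun x : E => c ‖x‖ :=
    hc.comp_continuous continuous_norm fun x => norm_nonneg x
  refine continuous_iff_continuousAt.2 fun x => ?_
  rcases eq_or_ne x 0 with rfl | hx
  · have e : radialField c (0 : E) = 0 := by simp [radialField]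
    unfold ContinuousAt
    rw [e]
    refine tendsto_zero_iff_norm_tendsto_zero.2 ?_
    simp only [norm_radialField fun _ => h0]
    have := hcn.abs.tendsto 0
    simpa [h0] using this
  · exact (hcn.continuousAt.div continuous_norm.continuousAt (norm_ne_zero_iff.2 hx)).smul
      continuousAt_id

variable [CompleteSpace E]

lemma hasGradientAt_norm_comp {W : ℝ → ℝ} {d : ℝ} {x : E} (hx : x ≠ 0)
    (hW : HasDerivAt W d ‖x‖) : HasGradientAt (fun y : E => W ‖y‖) ((d / ‖x‖) • x) x := by
  have hx0 := norm_pos_iff.2 hx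
  have h1 : HasFDerivAt (fun y : E => √(‖y‖ ^ 2)) ((1 / (2 * √(‖x‖ ^ 2))) • (2 • innerSL ℝ x)) x :=
    (hasStrictFDerivAt_norm_sq x).hasFDerivAt.sqrt (by positivity)
  simp only [Real.sqrt_sq (norm_nonneg _)] at h1
  have h2 := hW.comp_hasFDerivAt x h1
  rw [hasGradientAt_iff_hasFDerivAt]
  refine h2.congr_fderiv ?_
  ext y
  simp
  field_simp

lemma hasGradientAt_norm_comp_zero {W : ℝ → ℝ} (hW : HasDerivWithinAt W 0 (Ici 0) 0) :
    HasGradientAt (fun y : E => W ‖y‖) 0 0 := by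
  rw [hasGradientAt_iff_isLittleO]
  have h1 := hasDerivWithinAt_iff_isLittleO.1 hW
  have ht : Tendsto (fun x : E => ‖x‖) (𝓝 0) (𝓝[≥] 0) :=
    tendsto_nhdsWithin_iff.2 ⟨tendsto_norm_zero, Eventually.of_forall fun x => norm_nonneg x⟩
  have h2 := h1.comp_tendsto ht
  simp only [Function.comp_def, sub_zero, smul_zero] at h2
  simpa using h2.of_norm_right

/-- The norm is not differentiable at the origin, but D 0 = 0 makes the one-sided derivative of W
vanish there, so the composition has gradient zero. -/
lemma hasGradientAt_radial {W D : ℝ → ℝ} (hW : ContinuousOn W (Ici 0))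
    (hD : ContinuousOn D (Ici 0)) (h0 : D 0 = 0) (hd : ∀ r > 0, HasDerivAt W (D r) r) (x : E) :
    HasGradientAt (fun y : E => W ‖y‖) (radialField D x) x := by
  rcases eq_or_ne x 0 with rfl | hx
  · have e : radialField D (0 : E) = 0 := by simp [radialField]
    rw [e]
    refine hasGradientAt_norm_comp_zero ?_
    refine hasDerivWithinAt_Ici_of_tendsto_deriv (s := Ioi 0)
      (fun r hr => (hd r hr).differentiableAt.differentiableWithinAt)
      ((hW 0 self_mem_Ici).mono Ioi_subset_Ici_self) self_mem_nhdsWithin ?_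
    have := (hD 0 self_mem_Ici).mono Ioi_subset_Ici_self
    unfold ContinuousWithinAt at this
    rw [h0] at this
    refine this.congr' ?_
    filter_upwards [self_mem_nhdsWithin] with r hr using (hd r hr).deriv.symm
  · exact hasGradientAt_norm_comp hx (hd _ (norm_pos_iff.2 hx))

lemma contDiff_radial {W D : ℝ → ℝ} (hW : ContinuousOn W (Ici 0))
    (hD : ContinuousOn D (Ici 0)) (h0 : D 0 = 0) (hd : ∀ r > 0, HasDerivAt W (D r) r) :
    ContDiff ℝ 1 fun y : E => W ‖y‖ := by
  rw [contDiff_one_iff_hasFDerivAt]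
  exact ⟨fun x => InnerProductSpace.toDual ℝ E (radialField D x),
    (InnerProductSpace.toDual ℝ E).continuous.comp (continuous_radialField hD h0),
    fun x => (hasGradientAt_radial hW hD h0 hd x).hasFDerivAt⟩

end RadialField

lemma continuousOn_Ici_of_Icc {g : ℝ → ℝ} (h : ∀ R, ContinuousOn g (Icc 0 R)) :
    ContinuousOn g (Ici 0) := fun r hr =>
  (h (r + 1) r ⟨hr, by linarith⟩).mono_of_mem_nhdsWithin <| by
    rw [← Ici_inter_Iic]
    exact inter_mem_nhdsWithin _ (Iic_mem_nhds (by linarith))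

/-! ### From the radial equation to the weak Neumann problem -/

section Neumann

variable {n : ℕ} {p R : ℝ} {f w v : ℝ → ℝ}

/-- On each ray the integrand is the derivative of v(r) φ(r θ), and v vanishes at both ends. So
arbitrary test functions are handled ray by ray, without averaging over spheres. -/
lemma integral_radius_eq_zero {E : Type*} [NormedAddCommGroup E] [InnerProductSpace ℝ E]
    [CompleteSpace E] {a : ℝ} (hs : ∀ R, RadialSol n a f R w v)
    (hR : 0 < R) (hv : v R = 0) {φ : E → ℝ} (hφ : ContDiff ℝ 1 φ)
    (hH : Continuous fun x : E => inner ℝ (radialField (fun r => v r / r ^ n) x) (gradient φ x)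
      - f (w ‖x‖) * φ x) {θ : E} (hθ : ‖θ‖ = 1) :
    ∫ r in Ioo 0 R, r ^ n * (inner ℝ (radialField (fun r => v r / r ^ n) (r • θ))
      (gradient φ (r • θ)) - f (w ‖r • θ‖) * φ (r • θ)) = 0 := by
  rw [← integral_Ioc_eq_integral_Ioo, ← intervalIntegral.integral_of_le hR.le]
  rw [intervalIntegral.integral_eq_sub_of_hasDerivAt_of_le (f := fun r => v r * φ (r • θ)) hR.le]
  · rw [hv, (hs R).v_zero]; simp
  · exact (hs R).cont_v.mul (hφ.continuous.comp (by fun_prop)).continuousOn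
  · intro r hr
    have hg : HasGradientAt φ (gradient φ (r • θ)) (r • θ) :=
      ((hφ.differentiable one_ne_zero) _).hasGradientAt
    have h1 : HasDerivAt (fun r : ℝ => φ (r • θ)) (inner ℝ (gradient φ (r • θ)) θ) r := by
      have h2 : HasDerivAt (fun r : ℝ => r • θ) θ r := by
        simpa using (hasDerivAt_id r).smul_const θ
      simpa [Function.comp_def] using hg.hasFDerivAt.comp_hasDerivAt r h2
    refine (((hs R).deriv_v r hr).mul h1).congr_deriv ?_
    have hr0 := hr.1
    have hn : ‖r • θ‖ = r := by rw [norm_smul, hθ, mul_one, Real.norm_eq_abs, abs_of_pos hr0]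
    rw [radialField, hn, smul_smul, real_inner_smul_left, real_inner_comm]
    field_simp
    ring
  · refine Continuous.intervalIntegrable ?_ _ _
    exact (continuous_id.pow n).mul (hH.comp (by fun_prop : Continuous fun r : ℝ => r • θ))

/-- A solution of the radial equation on the half line gives a solution of the Neumann problem in
every ball on whose boundary the flux vanishes. -/
theorem isNeumannSolution_of_radialSol (hp : 1 < p) (hR : 0 < R) (hf : Continuous f)
    (hs : ∀ R, RadialSol n (p - 1) f R w v) (hv : v R = 0) (c : ℝ) :
    IsNeumannSolution (n + 1) p R (fun x => f (w ‖x‖)) (radialFun (n + 1) fun r => c + w r) := by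
  have ha : 0 < p - 1 := by linarith
  have hi : 0 < (p - 1)⁻¹ := inv_pos.2 ha
  have hcflux : ContinuousOn (fun r => v r / r ^ n) (Ici 0) :=
    continuousOn_Ici_of_Icc fun R => (hs R).continuousOn_flux hf
  have hflux0 : v 0 / 0 ^ n = 0 := by rw [(hs 0).v_zero, zero_div]
  set D : ℝ → ℝ := fun r => spow (p - 1)⁻¹ (v r / r ^ n) with hD
  have hcD : ContinuousOn D (Ici 0) := (continuous_spow hi).comp_continuousOn hcflux
  have hD0 : D 0 = 0 := by simp only [hD]; rw [hflux0, spow_eq_zero_iff]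
  have hcw : ContinuousOn w (Ici 0) := continuousOn_Ici_of_Icc fun R => (hs R).cont_w
  have hcW : ContinuousOn (fun r => c + w r) (Ici 0) := continuousOn_const.add hcw
  have hdW : ∀ r > 0, HasDerivAt (fun r => c + w r) (D r) r := fun r hr =>
    ((hs (r + 1)).deriv_w r ⟨hr, by linarith⟩).const_add c
  have hgrad : ∀ x : EuclideanSpace ℝ (Fin (n + 1)),
      HasGradientAt (radialFun (n + 1) fun r => c + w r) (radialField D x) x :=
    hasGradientAt_radial hcW hcD hD0 hdW
  have hcwn : Continuous fun x : EuclideanSpace ℝ (Fin (n + 1)) => f (w ‖x‖) :=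
    hf.comp (hcw.comp_continuous continuous_norm fun x => norm_nonneg x)
  refine ⟨(contDiff_radial hcW hcD hD0 hdW).contDiffOn, fun φ hφ => ?_, fun x hx => ?_⟩
  · have hφ1 : ContDiff ℝ 1 φ := hφ.of_le (by norm_cast)
    have hpt : ∀ x : EuclideanSpace ℝ (Fin (n + 1)),
        ‖gradient (radialFun (n + 1) fun r => c + w r) x‖ ^ (p - 2) •
          gradient (radialFun (n + 1) fun r => c + w r) x
          = radialField (fun r => v r / r ^ n) x := fun x => by
      rw [(hgrad x).gradient, rpow_norm_smul_radialField fun _ => hD0]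
      simp only [hD, radialField, spow_spow_inv ha]
    simp only [hpt]
    have hc1 : Continuous fun x : EuclideanSpace ℝ (Fin (n + 1)) =>
        inner ℝ (radialField (fun r => v r / r ^ n) x) (gradient φ x) :=
      (continuous_radialField hcflux hflux0).inner
        ((InnerProductSpace.toDual ℝ _).symm.continuous.comp (hφ1.continuous_fderiv one_ne_zero))
    have hc2 : Continuous fun x => f (w ‖x‖) * φ x := hcwn.mul hφ.continuous
    have hint : ∀ {H : EuclideanSpace ℝ (Fin (n + 1)) → ℝ}, Continuous H →
        IntegrableOn H (Metric.ball 0 R) := fun hH =>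
      (hH.continuousOn.integrableOn_compact (isCompact_closedBall 0 R)).mono_set
        Metric.ball_subset_closedBall
    rw [← sub_eq_zero, ← integral_sub (hint hc1) (hint hc2)]
    exact integral_ball_eq_zero_of_radii volume (by simp) (hint (hc1.sub hc2))
      fun θ hθ => integral_radius_eq_zero hs hR hv hφ1 (hc1.sub hc2) hθ
  · have hu : UniqueDiffWithinAt ℝ (Metric.closedBall (0 : EuclideanSpace ℝ (Fin (n + 1))) R) x :=
      uniqueDiffOn_convex (convex_closedBall 0 R)
        ⟨0, Metric.ball_subset_interior_closedBall (Metric.mem_ball_self hR)⟩ x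
        (Metric.sphere_subset_closedBall hx)
    rw [(hgrad x).hasFDerivAt.hasFDerivWithinAt.fderivWithin hu]
    have : D R = 0 := by simp only [hD]; rw [hv, zero_div, spow_eq_zero_iff]
    simp [radialField, mem_sphere_zero_iff_norm.1 hx, this]

end Neumann

/-! ### From weak eigenfunctions to the radial equation -/

section RadialTest

variable {R : ℝ} {η : ℝ → ℝ}

lemma contDiff_primitive (hη : ContDiff ℝ (⊤ : ℕ∞) η) (R : ℝ) :
    ContDiff ℝ (⊤ : ℕ∞) fun r => ∫ s in R..r, η s := by
  have hd : ∀ r, HasDerivAt (fun r => ∫ s in R..r, η s) (η r) r := fun r =>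
    hη.continuous.integral_hasStrictDerivAt R r |>.hasDerivAt
  refine contDiff_infty_iff_deriv.2 ⟨fun r => (hd r).differentiableAt, ?_⟩
  rwa [show deriv (fun r => ∫ s in R..r, η s) = η from funext fun r => (hd r).deriv]

/-- Provides radial test functions with prescribed radial derivative η. They are smooth at the
origin because they are constant near it. -/
lemma contDiff_primitive_norm {E : Type*} [NormedAddCommGroup E] [InnerProductSpace ℝ E]
    (hη : ContDiff ℝ (⊤ : ℕ∞) η) (h0 : η =ᶠ[𝓝 0] 0) (R : ℝ) :
    ContDiff ℝ (⊤ : ℕ∞) fun x : E => ∫ s in R..‖x‖, η s := by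
  refine contDiff_iff_contDiffAt.2 fun x => ?_
  rcases eq_or_ne x 0 with rfl | hx
  · obtain ⟨ε, hε, H⟩ := Metric.eventually_nhds_iff.1 h0
    refine (contDiffAt_const (c := ∫ s in R..0, η s)).congr_of_eventuallyEq ?_
    filter_upwards [Metric.ball_mem_nhds (0 : E) hε] with x hx
    rw [mem_ball_zero_iff] at hx
    rw [← sub_eq_zero, intervalIntegral.integral_interval_sub_left
      (hη.continuous.intervalIntegrable _ _) (hη.continuous.intervalIntegrable _ _)]
    refine (intervalIntegral.integral_congr fun s hs => ?_).trans intervalIntegral.integral_zero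
    rw [uIcc_of_le (norm_nonneg x)] at hs
    exact H (by rw [Real.dist_eq, sub_zero, abs_of_nonneg hs.1]; exact hs.2.trans_lt hx)
  · exact (contDiff_primitive hη R).contDiffAt.comp x (contDiffAt_norm ℝ hx)

end RadialTest

/-- The radial eigenvalues of the Neumann `p`-Laplacian are eigenvalues of the radial equation. -/
theorem IsRadialEigenvalue.exists_radialEigen {n : ℕ} {p R μ : ℝ} (hp : 1 < p) (hR : 0 < R)
    (h : IsRadialEigenvalue (n + 1) p R μ) : ∃ x X, RadialEigen n (p - 1) R μ x X := by
  have ha : 0 < p - 1 := by linarith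
  obtain ⟨w, ⟨x₀, hx₀, hne⟩, hsol⟩ := h
  set e : EuclideanSpace ℝ (Fin (n + 1)) := EuclideanSpace.single 0 1 with he
  have hen : ‖e‖ = 1 := by simp [he]
  have hnorm : ∀ r : ℝ, 0 ≤ r → ‖r • e‖ = r := fun r hr => by
    rw [norm_smul, hen, mul_one, Real.norm_eq_abs, abs_of_nonneg hr]
  have hcw : ContinuousOn w (Icc 0 R) := by
    have := hsol.contDiffOn.continuousOn.comp (f := fun r : ℝ => r • e) (s := Icc 0 R)
      (by fun_prop) fun r hr => by
        rw [mem_closedBall_zero_iff, hnorm r hr.1]; exact hr.2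
    refine this.congr fun r hr => ?_
    simp [radialFun, hnorm r hr.1]
  have hdw : ContDiffOn ℝ 1 w (Ioo 0 R) := by
    have := hsol.contDiffOn.comp (f := fun r : ℝ => r • e) (s := Ioo 0 R)
      (by fun_prop) fun r hr => by
        rw [mem_closedBall_zero_iff, hnorm r hr.1.le]; exact hr.2.le
    refine this.congr fun r hr => ?_
    simp [radialFun, hnorm r hr.1.le]
  set D := deriv w with hD
  have hcD : ContinuousOn D (Ioo 0 R) := hdw.continuousOn_deriv_of_isOpen isOpen_Ioo le_rfl
  have hder : ∀ r ∈ Ioo 0 R, HasDerivAt w (D r) r := fun r hr =>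
    ((hdw.differentiableOn one_ne_zero).differentiableAt (isOpen_Ioo.mem_nhds hr)).hasDerivAt
  -- Clamping the argument to [0, R] makes q continuous on the whole line. The candidate flux X is
  -- minus its primitive, and the weak form must identify X with r^n φ(w').
  set q : ℝ → ℝ := fun s => s ^ n * (μ * spow (p - 1) (w (max 0 (min s R)))) with hq
  have hcq : Continuous q := by
    refine (continuous_id.pow n).mul (continuous_const.mul ((continuous_spow ha).comp ?_))
    exact hcw.comp_continuous (by fun_prop) fun s => ⟨le_max_left _ _,
      max_le hR.le (min_le_right _ _)⟩
  have hqr : ∀ r ∈ Icc 0 R, q r = r ^ n * (μ * spow (p - 1) (w r)) := fun r hr => by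
    simp only [hq]
    rw [min_eq_left hr.2, max_eq_right hr.1]
  set X : ℝ → ℝ := fun r => -∫ s in (0 : ℝ)..r, q s with hX
  have hdX : ∀ r, HasDerivAt X (-q r) r := fun r =>
    (hcq.integral_hasStrictDerivAt 0 r).hasDerivAt.neg
  have hcX : Continuous X := continuous_iff_continuousAt.2 fun r => (hdX r).continuousAt
  have hX0 : X 0 = 0 := by simp [hX]
  obtain ⟨c, hc, hpolar⟩ := exists_integral_ball_norm_eq (n := n)
    (volume : Measure (EuclideanSpace ℝ (Fin (n + 1)))) (by simp)
  have hrhs : ∀ Ψ : ℝ → ℝ, ∫ x in Metric.ball (0 : EuclideanSpace ℝ (Fin (n + 1))) R,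
      μ * (|radialFun (n + 1) w x| ^ (p - 2) * radialFun (n + 1) w x) * Ψ ‖x‖ =
      c * ∫ r in (0 : ℝ)..R, q r * Ψ r := fun Ψ => by
    have := hpolar (fun r => μ * (|w r| ^ (p - 2) * w r) * Ψ r) R
    simp only [radialFun]
    rw [this, intervalIntegral.integral_of_le hR.le, integral_Ioc_eq_integral_Ioo]
    congr 1
    refine setIntegral_congr_fun measurableSet_Ioo fun r hr => ?_
    have h1 := abs_rpow_sub_one_mul (p - 1) (w r)
    rw [show p - 1 - 1 = p - 2 by ring] at h1
    simp only [h1, hqr r (Ioo_subset_Icc_self hr)]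
    ring
  -- Testing with the constant 1 gives the Neumann condition in terms of the flux.
  have hXR : X R = 0 := by
    have h1 := hsol.weak (fun _ => 1) contDiff_const
    rw [hrhs fun _ => 1] at h1
    simp only [gradient_fun_const, inner_zero_right, integral_zero, mul_one] at h1
    have := (mul_eq_zero.1 h1.symm).resolve_left hc.ne'
    simp [hX, this]
  -- Testing with Ψ(|x|), where Ψ' = η has compact support in (0, R) and Ψ(R) = 0, and integrating
  -- by parts gives zero integral of (r^n φ(w') - X) η. The fundamental lemma and continuity yield
  -- equality everywhere.
  have hflux : EqOn (fun r => r ^ n * spow (p - 1) (D r) - X r) (fun _ => 0) (Ioo 0 R) := by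
    have hcont : ContinuousOn (fun r => r ^ n * spow (p - 1) (D r) - X r) (Ioo 0 R) :=
      ((continuousOn_id.pow n).mul ((continuous_spow ha).comp_continuousOn hcD)).sub
        hcX.continuousOn
    refine Measure.eqOn_open_of_ae_eq (μ := volume) ?_ isOpen_Ioo hcont continuousOn_const
    rw [EventuallyEq, ae_restrict_iff' measurableSet_Ioo]
    refine isOpen_Ioo.ae_eq_zero_of_integral_contDiff_smul_eq_zero
      (hcont.locallyIntegrableOn measurableSet_Ioo) fun η hη hηc hηs => ?_
    have hη0 : ∀ r ∉ Ioo 0 R, η r = 0 := fun r hr =>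
      image_eq_zero_of_notMem_tsupport fun h => hr (hηs h)
    have hηn : η =ᶠ[𝓝 0] 0 := notMem_tsupport_iff_eventuallyEq.1 fun h => by
      simpa using (hηs h).1
    set Ψ : ℝ → ℝ := fun r => ∫ s in R..r, η s with hΨ
    have hdΨ : ∀ r, HasDerivAt Ψ (η r) r := fun r =>
      hη.continuous.integral_hasStrictDerivAt R r |>.hasDerivAt
    have hcΨ : Continuous Ψ := continuous_iff_continuousAt.2 fun r => (hdΨ r).continuousAt
    have hweak := hsol.weak _ (contDiff_primitive_norm hη hηn R)
    rw [hrhs Ψ] at hweak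
    have hlhs : ∫ x in Metric.ball (0 : EuclideanSpace ℝ (Fin (n + 1))) R,
        inner ℝ (‖gradient (radialFun (n + 1) w) x‖ ^ (p - 2) • gradient (radialFun (n + 1) w) x)
          (gradient (fun x => Ψ ‖x‖) x) =
        ∫ x in Metric.ball (0 : EuclideanSpace ℝ (Fin (n + 1))) R,
          spow (p - 1) (D ‖x‖) * η ‖x‖ := by
      refine setIntegral_congr_ae measurableSet_ball ?_
      filter_upwards [compl_mem_ae_iff.2 (measure_singleton 0)] with x hx hxR
      have hx0 : x ≠ 0 := hx
      have hxn := norm_pos_iff.2 hx0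
      have hg : gradient (radialFun (n + 1) w) x = radialField D x :=
        (hasGradientAt_norm_comp hx0 (hder _ ⟨hxn, mem_ball_zero_iff.1 hxR⟩)).gradient
      rw [hg, (hasGradientAt_norm_comp hx0 (hdΨ _)).gradient,
        rpow_norm_smul_radialField fun h => absurd h hx0, radialField, real_inner_smul_left,
        real_inner_smul_right, real_inner_self_eq_norm_sq]
      field_simp
    rw [hlhs, hpolar fun r => spow (p - 1) (D r) * η r] at hweak
    have hw := mul_left_cancel₀ hc.ne' hweak
    have hc1 : Continuous fun r => X r * η r := hcX.mul hη.continuous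
    have hc2 : Continuous fun r => q r * Ψ r := hcq.mul hcΨ
    have hparts : ∫ r in (0 : ℝ)..R, (X r * η r - q r * Ψ r) = 0 := by
      rw [intervalIntegral.integral_eq_sub_of_hasDerivAt (f := fun r => X r * Ψ r)
        (f' := fun r => X r * η r - q r * Ψ r) (fun r _ => ((hdX r).mul (hdΨ r)).congr_deriv (by ring))
        ((hc1.sub hc2).intervalIntegrable _ _)]
      simp [hX0, hΨ]
    rw [intervalIntegral.integral_sub (hc1.intervalIntegrable _ _)
      (hc2.intervalIntegrable _ _)] at hparts
    have hint : IntegrableOn (fun r => r ^ n * (spow (p - 1) (D r) * η r)) (Ioo 0 R) := by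
      have : IntegrableOn (fun r => r ^ n * (spow (p - 1) (D r) * η r)) (tsupport η) :=
        ContinuousOn.integrableOn_compact hηc ((continuousOn_id.pow n).mul
          (((continuous_spow ha).comp_continuousOn (hcD.mono hηs)).mul hη.continuous.continuousOn))
      rw [integrableOn_iff_integrable_of_support_subset] at this
      · exact this.integrableOn
      · intro r hr
        refine subset_tsupport _ fun h => hr ?_
        simp only [h, mul_zero]
    rw [← setIntegral_eq_integral_of_forall_compl_eq_zero (s := Ioo 0 R)
      fun r hr => by rw [hη0 r hr, zero_smul]]
    have hsplit : ∀ r, η r • (r ^ n * spow (p - 1) (D r) - X r) =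
        r ^ n * (spow (p - 1) (D r) * η r) - X r * η r := fun r => by
      rw [smul_eq_mul]; ring
    simp only [hsplit]
    rw [integral_sub hint ((hc1.continuousOn.integrableOn_compact
      isCompact_Icc).mono_set Ioo_subset_Icc_self), hw, ← integral_Ioc_eq_integral_Ioo,
      ← intervalIntegral.integral_of_le hR.le]
    linarith
  refine ⟨w, X, ⟨hcw, hcX.continuousOn, hX0, fun r hr => ?_, fun r hr => ?_⟩, hXR,
    ‖x₀‖, ⟨norm_nonneg _, (mem_ball_zero_iff.1 hx₀).le⟩, hne⟩
  · have h1 : X r = r ^ n * spow (p - 1) (D r) := (sub_eq_zero.1 (hflux hr)).symm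
    rw [h1, mul_div_cancel_left₀ _ (pow_pos hr.1 n).ne', spow_inv_spow ha]
    exact hder r hr
  · rw [← hqr r (Ioo_subset_Icc_self hr)]
    exact hdX r

/-! ### The nonlinearity centred at the equilibrium -/

/-- The nonlinearity `g u - u ^ a` in terms of `s = u - 1`, frozen for `u ≤ 0`. -/
noncomputable def centered (a : ℝ) (g : ℝ → ℝ) (s : ℝ) : ℝ :=
  g (max (1 + s) 0) - max (1 + s) 0 ^ a

section Centered

variable {a : ℝ} {g : ℝ → ℝ}

lemma centered_of_neg_one_le {s : ℝ} (hs : -1 ≤ s) : centered a g s = g (1 + s) - (1 + s) ^ a := by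
  rw [centered, max_eq_left (by linarith)]

lemma map_zero_of_tendsto_div (ha : 0 < a) (hg : ContinuousOn g (Ici 0)) {l : ℝ}
    (h : Tendsto (fun s => g s / s ^ a) (𝓝[>] 0) (𝓝 l)) : g 0 = 0 := by
  have h1 : Tendsto g (𝓝[>] 0) (𝓝 (g 0)) := (hg 0 self_mem_Ici).mono Ioi_subset_Ici_self
  have h2 : Tendsto (fun s : ℝ => s ^ a) (𝓝[>] 0) (𝓝 0) := by
    have := (Real.continuous_rpow_const ha.le).tendsto 0
    rw [Real.zero_rpow ha.ne'] at this
    exact this.mono_left nhdsWithin_le_nhds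
  have h3 := h.mul h2
  rw [mul_zero] at h3
  refine tendsto_nhds_unique h1 (h3.congr' ?_)
  filter_upwards [self_mem_nhdsWithin] with s hs
  exact div_mul_cancel₀ _ (Real.rpow_pos_of_pos hs a).ne'

lemma continuous_centered (ha : 0 < a) (hg : ContinuousOn g (Ici 0)) : Continuous (centered a g) :=
  (hg.comp_continuous (by fun_prop) fun s => mem_Ici.2 (le_max_right _ _)).sub
    ((by fun_prop : Continuous fun s : ℝ => max (1 + s) 0).rpow_const fun _ => Or.inr ha.le)

lemma exists_lipschitz_centered (hg : ContDiffOn ℝ 1 g (Ioi 0)) {b : ℝ} (hb : -1 < b)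
    (c : ℝ) : ∃ L ≥ 0, ∀ x ∈ Icc b c, ∀ y ∈ Icc b c,
      |centered a g x - centered a g y| ≤ L * |x - y| := by
  set h : ℝ → ℝ := fun s => g (1 + s) - (1 + s) ^ a with hh
  have hd : ContDiffOn ℝ 1 h (Ioi (-1)) := by
    have hm : MapsTo (fun s : ℝ => 1 + s) (Ioi (-1)) (Ioi 0) := fun s hs => by
      simp only [mem_Ioi] at hs ⊢; linarith
    refine (hg.comp (by fun_prop) hm).sub ?_
    exact ContDiffOn.rpow_const_of_ne (by fun_prop) fun s hs => (hm hs).ne'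
  have hsub : Icc b c ⊆ Ioi (-1) := fun s hs => hb.trans_le hs.1
  obtain ⟨L, hL⟩ := isCompact_Icc.exists_bound_of_continuousOn
    ((hd.continuousOn_deriv_of_isOpen isOpen_Ioi le_rfl).mono hsub)
  refine ⟨max L 0, le_max_right _ _, fun x hx y hy => ?_⟩
  rw [centered_of_neg_one_le (hsub hx).le, centered_of_neg_one_le (hsub hy).le]
  exact (convex_Icc b c).norm_image_sub_le_of_norm_deriv_le (f := h) (fun s hs =>
    (hd.differentiableOn one_ne_zero).differentiableAt (isOpen_Ioi.mem_nhds (hsub hs)))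
    (fun s hs => (hL s hs).trans (le_max_left _ _)) hy hx

lemma restoring_centered (ha : 0 < a) (hg_cont : ContinuousOn g (Ici 0))
    (hg_diff : ContDiffOn ℝ 1 g (Ioi 0)) (hg0 : g 0 = 0)
    (hg_lt : ∀ s : ℝ, 0 < s → s < 1 → g s - s ^ a < 0)
    (hg_gt : ∀ s : ℝ, 1 < s → 0 < g s - s ^ a) : Restoring (centered a g) where
  cont := continuous_centered ha hg_cont
  neg s h1 h2 := by
    rw [centered_of_neg_one_le h1.le]
    exact hg_lt _ (by linarith) (by linarith)
  pos s hs := by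
    rw [centered_of_neg_one_le (by linarith)]
    exact hg_gt _ (by linarith)
  zero_left s hs := by
    rw [centered, max_eq_right (by linarith), hg0, Real.zero_rpow ha.ne', sub_zero]
  lip b c hb := exists_lipschitz_centered hg_diff hb c

/-- Near -1 the condition at zero gives g(t) ≥ (l - 1) t^a with t = 1 + s, hence the constant 2 - l.
On the rest of (-1, 0) the power is bounded below by δ^a and the nonlinearity is bounded. -/
lemma exists_neg_centered_le (ha : 0 < a) (hg : ContinuousOn g (Ici 0)) {l : ℝ}
    (h : Tendsto (fun s => g s / s ^ a) (𝓝[>] 0) (𝓝 l)) :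
    ∃ C, ∀ s ∈ Ioo (-1 : ℝ) 0, -centered a g s ≤ C * (1 + s) ^ a := by
  obtain ⟨δ, hδ, H⟩ := Metric.eventually_nhds_iff.1
    (eventually_nhdsWithin_iff.1 (h.eventually (lt_mem_nhds (sub_one_lt l))))
  obtain ⟨K, hK⟩ := isCompact_Icc.exists_bound_of_continuousOn (s := Icc (-1 : ℝ) 0)
    (continuous_centered ha hg).continuousOn
  refine ⟨max (2 - l) (K / δ ^ a), fun s hs => ?_⟩
  have hs0 : 0 < 1 + s := by linarith [hs.1]
  have hp := Real.rpow_pos_of_pos hs0 a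
  rcases lt_or_ge (1 + s) δ with h1 | h1
  · refine le_trans ?_ (mul_le_mul_of_nonneg_right (le_max_left _ _) hp.le)
    have h2 := H (y := 1 + s) (by rwa [Real.dist_eq, sub_zero, abs_of_pos hs0]) hs0
    rw [lt_div_iff₀ hp] at h2
    rw [centered_of_neg_one_le hs.1.le]
    linarith
  · refine le_trans ?_ (mul_le_mul_of_nonneg_right (le_max_right _ _) hp.le)
    have h2 := hK s (Ioo_subset_Icc_self hs)
    have h3 : δ ^ a ≤ (1 + s) ^ a := Real.rpow_le_rpow hδ.le h1 ha.le
    have h4 := Real.rpow_pos_of_pos hδ a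
    have hK0 : 0 ≤ K := (norm_nonneg _).trans h2
    rw [Real.norm_eq_abs] at h2
    have h5 : K ≤ K / δ ^ a * (1 + s) ^ a := by
      rw [div_mul_eq_mul_div, le_div_iff₀ h4]
      exact mul_le_mul_of_nonneg_left h3 hK0
    linarith [neg_abs_le (centered a g s)]

/-- Multiplying by s removes the sign from the quotient in the condition at one, and gives the form
used by the comparison lemmas on both sides of 0. -/
lemma exists_centered_quotient {p : ℝ} (hp : 1 < p) {P : ℝ → Prop}
    (h : ∀ᶠ s in 𝓝[≠] (1 : ℝ), P ((g s - s ^ (p - 1)) / (|s - 1| ^ (p - 2) * (s - 1)))) :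
    ∃ δ > 0, ∀ s : ℝ, s ≠ 0 → |s| < δ →
      ∃ q, P q ∧ s * centered (p - 1) g s = q * |s| ^ (p - 1 + 1) := by
  obtain ⟨δ, hδ, H⟩ := Metric.eventually_nhds_iff.1 (eventually_nhdsWithin_iff.1 h)
  refine ⟨min δ 1, by positivity, fun s hs0 hs => ?_⟩
  have h1 : -1 < s := (abs_lt.1 (hs.trans_le (min_le_right _ _))).1
  have h2 := H (y := 1 + s) (by
    rw [Real.dist_eq, add_sub_cancel_left]; exact hs.trans_le (min_le_left _ _)) (by simpa using hs0)
  refine ⟨_, h2, ?_⟩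
  have h3 := abs_rpow_sub_one_mul (p - 1) s
  rw [show p - 1 - 1 = p - 2 by ring] at h3
  have h4 : spow (p - 1) s ≠ 0 := fun h => hs0 (spow_eq_zero_iff.1 h)
  rw [centered_of_neg_one_le h1.le, add_sub_cancel_left, h3, ← mul_spow_self (by linarith)]
  field_simp

variable {p : ℝ} {C₁ : ENNReal}

lemma exists_le_mul_centered (hp : 1 < p)
    (hg_one : Tendsto
      (fun s : ℝ => (((g s - s ^ (p - 1)) / (|s - 1| ^ (p - 2) * (s - 1)) : ℝ) : EReal))
      (𝓝[≠] 1) (𝓝 (C₁ : EReal))) {K : ℝ} (hK : (K : EReal) < C₁) :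
    ∃ δ > 0, ∀ s, |s| < δ → K * |s| ^ (p - 1 + 1) ≤ s * centered (p - 1) g s := by
  obtain ⟨δ, hδ, H⟩ := exists_centered_quotient (P := fun q => K < q) hp
    ((hg_one.eventually (lt_mem_nhds hK)).mono fun s hs => EReal.coe_lt_coe_iff.1 hs)
  refine ⟨δ, hδ, fun s hs => ?_⟩
  rcases eq_or_ne s 0 with rfl | hs0
  · rw [abs_zero, Real.zero_rpow (by linarith), mul_zero, zero_mul]
  · obtain ⟨q, hq, e⟩ := H s hs0 hs
    rw [e]
    exact mul_le_mul_of_nonneg_right hq.le (by positivity)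

lemma exists_neg_centered_le_mul (hp : 1 < p)
    (hg_one : Tendsto
      (fun s : ℝ => (((g s - s ^ (p - 1)) / (|s - 1| ^ (p - 2) * (s - 1)) : ℝ) : EReal))
      (𝓝[≠] 1) (𝓝 (C₁ : EReal))) {ε : ℝ} (hε : (C₁ : EReal) < ε) :
    ∃ δ > 0, ∀ s ∈ Ioo (-δ) 0, -centered (p - 1) g s ≤ ε * |s| ^ (p - 1) := by
  obtain ⟨δ, hδ, H⟩ := exists_centered_quotient (P := fun q => q < ε) hp
    ((hg_one.eventually (gt_mem_nhds hε)).mono fun s hs => EReal.coe_lt_coe_iff.1 hs)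
  refine ⟨δ, hδ, fun s hs => ?_⟩
  have hsa : |s| = -s := abs_of_neg hs.2
  have hs0 : 0 < |s| := abs_pos.2 hs.2.ne
  obtain ⟨q, hq, e⟩ := H s hs.2.ne (by rw [hsa]; linarith [hs.1])
  rw [Real.rpow_add_one hs0.ne'] at e
  have h1 : -centered (p - 1) g s = q * |s| ^ (p - 1) := by
    refine mul_right_cancel₀ hs0.ne' ?_
    rw [mul_assoc, ← e, hsa]
    ring
  rw [h1]
  exact mul_le_mul_of_nonneg_right hq.le (by positivity)

end Centered

/-! ### Solutions of the Neumann problem from pairs of trajectories -/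

section Solutions

variable {n : ℕ} {p R α : ℝ} {g w v : ℝ → ℝ}

lemma CritChain.restrict {v : ℝ → ℝ} {k : ℕ} {t : ℕ → ℝ} (h : CritChain v k t) {j : ℕ}
    (hj : j ≤ k) : CritChain v j t :=
  ⟨h.zero, fun i hi => h.lt_succ i (hi.trans_le hj), fun i hi => h.v_eq i (hi.trans hj)⟩

lemma Trajectory.isRadialSolution (hp : 1 < p) (hf : Restoring (centered (p - 1) g)) (hR : 0 < R)
    (hα : α ∈ Ioo (0 : ℝ) 1) (h : Trajectory n (p - 1) (centered (p - 1) g) α w v)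
    (hv : v R = 0) : IsRadialSolution (n + 1) p R g fun r => 1 + w r := by
  have hw : ∀ r, 0 ≤ r → -1 < w r := fun r hr =>
    hf.neg_one_lt (by linarith) (h.radialSol r) hα h.w_zero ⟨hr, le_rfl⟩
  refine ⟨fun x _ => ?_, ?_⟩
  · have := hw ‖x‖ (norm_nonneg x)
    simp only [radialFun]
    linarith
  · have := isNeumannSolution_of_radialSol hp hR hf.cont h.radialSol hv 1
    simp only [centered_of_neg_one_le (hw _ (norm_nonneg _)).le] at this
    exact this

lemma Trajectory.isNonconstantRadialSolution (hp : 1 < p) (hf : Restoring (centered (p - 1) g))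
    (hR : 0 < R) (hα : α ∈ Ioo (0 : ℝ) 1)
    (h : Trajectory n (p - 1) (centered (p - 1) g) α w v) (hv : v R = 0) {j : ℕ} (hj : 1 ≤ j)
    (hz : {r ∈ Icc 0 R | w r = 0}.encard = j) :
    IsNonconstantRadialSolution (n + 1) p R g (fun r => 1 + w r) ∧
      HasExactlyZeros R (fun r => 1 + w r) j := by
  refine ⟨⟨h.isRadialSolution hp hf hR hα hv, ?_⟩, by simpa [HasExactlyZeros] using hz⟩
  obtain ⟨r, hr, hwr⟩ : {r ∈ Icc 0 R | w r = 0}.Nonempty := by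
    rw [← encard_ne_zero, hz]
    exact_mod_cast (by omega : j ≠ 0)
  refine ⟨0, ⟨le_rfl, hR.le⟩, r, hr, ?_⟩
  simp only [h.w_zero, hwr]
  have := hα.1
  intro h
  linarith

lemma HasExactlyZeros.eq_of_eqOn {u₁ u₂ : ℝ → ℝ} {i j : ℕ} (h₁ : HasExactlyZeros R u₁ i)
    (h₂ : HasExactlyZeros R u₂ j) (h : EqOn u₁ u₂ (Icc 0 R)) : i = j := by
  have e : {r ∈ Icc 0 R | u₁ r - 1 = 0} = {r ∈ Icc 0 R | u₂ r - 1 = 0} := by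
    ext r
    exact and_congr_right fun hr => by rw [h hr]
  unfold HasExactlyZeros at h₁ h₂
  rw [e, h₂] at h₁
  exact_mod_cast h₁.symm

/-- A fast trajectory and the slow ones starting near `-1` enclose a solution. -/
lemma exists_solution_of_critChain (hp : 1 < p) (hf : Restoring (centered (p - 1) g)) {C : ℝ}
    (hC : ∀ s ∈ Ioo (-1 : ℝ) 0, -centered (p - 1) g s ≤ C * (1 + s) ^ (p - 1)) (hR : 0 < R)
    (hα : α ∈ Ioo (0 : ℝ) 1) {j : ℕ} (hj : 1 ≤ j)
    (hfast : ∀ w v, Trajectory n (p - 1) (centered (p - 1) g) α w v →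
      ∃ t, CritChain v j t ∧ t j < R) :
    ∃ u, (IsNonconstantRadialSolution (n + 1) p R g u ∧ HasExactlyZeros R u j) ∧
      u 0 < 1 - α := by
  have ha : 0 < p - 1 := by linarith
  choose! W V hW using fun β (hβ : β ∈ Ioo (0 : ℝ) 1) =>
    hf.exists_trajectory (n := n) ha hβ
  obtain ⟨α₀, hα₀, H⟩ := hf.exists_forall_lt_of_near_one (n := n) ha hC (η := 0) (by norm_num) hR
  obtain ⟨β, hβ⟩ := exists_between (max_lt hα₀ hα.2)
  have hβα : α < β := (le_max_right _ _).trans_lt hβ.1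
  have hβ' : β ∈ Ioo (0 : ℝ) 1 := ⟨hα.1.trans hβα, hβ.2⟩
  -- The fast end is α, the slow end is β close to 1. Since γ ≠ α, the bound u 0 < 1 - α is strict,
  -- which later separates the two families.
  obtain ⟨γ, hγ, hγα, -, hv, hz⟩ := hf.exists_encard_zeros ha hR hW hα hβ' (hfast _ _ (hW α hα))
    (hf.not_exists_critChain_of_neg ha (hW β hβ') hβ' (fun r hr => by
      simpa using H β hβ' ((le_max_left _ _).trans_lt hβ.1) _ _ (hW β hβ') r hr) hj)
  rw [uIcc_of_le hβα.le] at hγ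
  have hγ' : γ ∈ Ioo (0 : ℝ) 1 := ⟨hα.1.trans_le hγ.1, hγ.2.trans_lt hβ'.2⟩
  refine ⟨_, (hW γ hγ').isNonconstantRadialSolution hp hf hR hγ' hv hj hz, ?_⟩
  have := lt_of_le_of_ne hγ.1 hγα.symm
  simp only [(hW γ hγ').w_zero]
  linarith

/-- A fast trajectory and the slow ones starting near the equilibrium enclose a solution. -/
lemma exists_solution_of_critChain_of_small (hp : 1 < p) (hf : Restoring (centered (p - 1) g))
    (hsmall : ∀ ε > 0, ∃ δ > 0, ∀ s ∈ Ioo (-δ) 0, -centered (p - 1) g s ≤ ε * |s| ^ (p - 1))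
    (hR : 0 < R) (hα : α ∈ Ioo (0 : ℝ) 1) {j : ℕ} (hj : 1 ≤ j)
    (hfast : ∀ w v, Trajectory n (p - 1) (centered (p - 1) g) α w v →
      ∃ t, CritChain v j t ∧ t j < R) :
    ∃ u, (IsNonconstantRadialSolution (n + 1) p R g u ∧ HasExactlyZeros R u j) ∧
      1 - α < u 0 := by
  have ha : 0 < p - 1 := by linarith
  choose! W V hW using fun β (hβ : β ∈ Ioo (0 : ℝ) 1) =>
    hf.exists_trajectory (n := n) ha hβ
  obtain ⟨α₀, hα₀, H⟩ := hf.exists_forall_neg_of_near_zero (n := n) ha hsmall hR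
  obtain ⟨β, hβ⟩ := exists_between (lt_min hα₀ hα.1)
  have hβα : β < α := hβ.2.trans_le (min_le_right _ _)
  have hβ' : β ∈ Ioo (0 : ℝ) 1 := ⟨hβ.1, hβα.trans hα.2⟩
  obtain ⟨γ, hγ, hγα, -, hv, hz⟩ := hf.exists_encard_zeros ha hR hW hα hβ' (hfast _ _ (hW α hα))
    (hf.not_exists_critChain_of_neg ha (hW β hβ') hβ'
      (H β hβ' (hβ.2.trans_le (min_le_left _ _)) _ _ (hW β hβ')) hj)
  rw [uIcc_of_ge hβα.le] at hγ
  have hγ' : γ ∈ Ioo (0 : ℝ) 1 := ⟨hβ'.1.trans_le hγ.1, hγ.2.trans_lt hα.2⟩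
  refine ⟨_, (hW γ hγ').isNonconstantRadialSolution hp hf hR hγ' hv hj hz, ?_⟩
  have := lt_of_le_of_ne hγ.2 hγα
  simp only [(hW γ hγ').w_zero]
  linarith

/-- If all trajectories near the equilibrium are fast, there are solutions with any admissible
number of zeros. -/
lemma exists_solution_of_near_zero (hp : 1 < p) (hf : Restoring (centered (p - 1) g)) {C : ℝ}
    (hC : ∀ s ∈ Ioo (-1 : ℝ) 0, -centered (p - 1) g s ≤ C * (1 + s) ^ (p - 1)) (hR : 0 < R)
    {j k : ℕ} (hj : 1 ≤ j) (hjk : j ≤ k)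
    (hfast : ∃ α₀ > 0, ∀ α ∈ Ioo (0 : ℝ) 1, α < α₀ → ∀ w v,
      Trajectory n (p - 1) (centered (p - 1) g) α w v → ∃ t, CritChain v k t ∧ t k < R) :
    ∃ u, IsNonconstantRadialSolution (n + 1) p R g u ∧ HasExactlyZeros R u j := by
  obtain ⟨α₀, hα₀, H⟩ := hfast
  obtain ⟨α, hα⟩ := exists_between (lt_min hα₀ one_pos)
  have hα' : α ∈ Ioo (0 : ℝ) 1 := ⟨hα.1, hα.2.trans_le (min_le_right _ _)⟩
  obtain ⟨u, hu, -⟩ := exists_solution_of_critChain hp hf hC hR hα' hj fun w v h => by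
    obtain ⟨t, ht, htR⟩ := H α hα' (hα.2.trans_le (min_le_left _ _)) w v h
    exact ⟨t, ht.restrict hjk, (ht.mono hjk le_rfl).trans_lt htR⟩
  exact ⟨u, hu⟩

end Solutions

/-! ### Proof of the three statements -/

theorem theorem1p2
    (N : ℕ) (hN : 1 ≤ N) (p : ℝ) (hp : 1 < p)
    (g : ℝ → ℝ) (hg_cont : ContinuousOn g (Ici 0)) (hg_diff : ContDiffOn ℝ 1 g (Ioi 0))
    -- the condition at zero
    (hg_zero : ∃ l : ℝ, l ≤ 1 ∧ Tendsto (fun s => g s / s ^ (p - 1)) (𝓝[>] 0) (𝓝 l))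
    -- the condition on the intersection with the power
    (hg_lt : ∀ s : ℝ, 0 < s → s < 1 → g s - s ^ (p - 1) < 0)
    (hg_eq : g 1 - (1 : ℝ) ^ (p - 1) = 0)
    (hg_gt : ∀ s : ℝ, 1 < s → 0 < g s - s ^ (p - 1))
    -- the condition at one, with constant in `[0, ∞]`
    (C₁ : ENNReal)
    (hg_one : Tendsto
      (fun s : ℝ => (((g s - s ^ (p - 1)) / (|s - 1| ^ (p - 2) * (s - 1)) : ℝ) : EReal))
      (𝓝[≠] 1) (𝓝 (C₁ : EReal))) :
    -- part (i)
    (∀ R : ℝ, 0 < R → ∀ k : ℕ, 1 ≤ k → radialEigenvalue N p R (k + 1) < (C₁ : EReal) →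
      ∃ u : ℕ → ℝ → ℝ,
        (∀ j ∈ Icc 1 k,
          IsNonconstantRadialSolution N p R g (u j) ∧ HasExactlyZeros R (u j) j) ∧
        (∀ i ∈ Icc 1 k, ∀ j ∈ Icc 1 k, i ≠ j → ¬ EqOn (u i) (u j) (Icc 0 R))) ∧
    -- part (ii)
    (C₁ = ⊤ → ∀ R : ℝ, 0 < R →
      ∃ u : ℕ → ℝ → ℝ,
        (∀ j : ℕ, 1 ≤ j →
          IsNonconstantRadialSolution N p R g (u j) ∧ HasExactlyZeros R (u j) j) ∧
        (∀ i j : ℕ, 1 ≤ i → 1 ≤ j → i ≠ j → ¬ EqOn (u i) (u j) (Icc 0 R))) ∧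
    -- part (iii)
    (C₁ = 0 → ∀ k : ℕ, 1 ≤ k → ∃ Rstar : ℝ, 0 < Rstar ∧ ∀ R : ℝ, Rstar < R →
      ∃ u : ℕ → Bool → ℝ → ℝ,
        (∀ j ∈ Icc 1 k, ∀ a : Bool,
          IsNonconstantRadialSolution N p R g (u j a) ∧ HasExactlyZeros R (u j a) j) ∧
        (∀ i ∈ Icc 1 k, ∀ j ∈ Icc 1 k, ∀ a b : Bool, (i, a) ≠ (j, b) →
          ¬ EqOn (u i a) (u j b) (Icc 0 R))) := by

  obtain ⟨n, rfl⟩ : ∃ n, N = n + 1 := ⟨N - 1, by omega⟩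
  have ha : 0 < p - 1 := by linarith
  obtain ⟨l, -, hl⟩ := hg_zero
  have hf : Restoring (centered (p - 1) g) := restoring_centered ha hg_cont hg_diff
    (map_zero_of_tendsto_div ha hg_cont hl) hg_lt hg_gt
  obtain ⟨C, hC⟩ := exists_neg_centered_le ha hg_cont hl
  refine ⟨fun R hR k hk hlam => ?_, fun htop R hR => ?_, fun hzero k hk => ?_⟩
  -- An infimum below C₁ already provides an eigenvalue μ < C₁ with at least k + 1 eigenvalues up to
  -- it; the infimum need not be attained.
  · obtain ⟨-, ⟨μ, ⟨-, hμk⟩, rfl⟩, hμC⟩ := sInf_lt_iff.1 hlam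
    obtain ⟨ν, hμν, hνC⟩ := EReal.lt_iff_exists_real_btwn.1 hμC
    have hsub : {ν : ℝ | IsRadialEigenvalue (n + 1) p R ν ∧ ν ≤ μ} ⊆
        {ν | (∃ x X, RadialEigen n (p - 1) R ν x X) ∧ ν ≤ μ} := fun ν hν =>
      ⟨hν.1.exists_radialEigen hp hR, hν.2⟩
    obtain ⟨κ, hκ, x, X, hx, hz⟩ :=
      RadialEigen.exists_hasZeros ha hR k μ (hμk.trans (encard_le_encard hsub))
    have hfast := hf.exists_critChain_of_eigen ha hR hx hk hz
      (hκ.trans_lt (EReal.coe_lt_coe_iff.1 hμν)) (exists_le_mul_centered hp hg_one hνC)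
    have hex : ∀ j ∈ Icc 1 k, ∃ u,
        IsNonconstantRadialSolution (n + 1) p R g u ∧ HasExactlyZeros R u j := fun j hj =>
      exists_solution_of_near_zero hp hf hC hR hj.1 hj.2 hfast
    choose! u hu using hex
    exact ⟨u, hu, fun i hi j hj hij h => hij ((hu i hi).2.eq_of_eqOn (hu j hj).2 h)⟩
  · have hex : ∀ j : ℕ, 1 ≤ j → ∃ u,
        IsNonconstantRadialSolution (n + 1) p R g u ∧ HasExactlyZeros R u j := fun j hj =>
      exists_solution_of_near_zero hp hf hC hR hj le_rfl
        (hf.exists_critChain_of_fast ha (fun K => exists_le_mul_centered hp hg_one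
          (by rw [htop]; exact EReal.coe_lt_top K)) hR j)
    choose! u hu using hex
    exact ⟨u, hu, fun i j hi hj hij h => hij ((hu i hi).2.eq_of_eqOn (hu j hj).2 h)⟩
  · obtain ⟨α, hα, H⟩ := hf.exists_critChain (n := n) ha hC k
    obtain ⟨w, v, hwv⟩ := hf.exists_trajectory (n := n) ha hα
    obtain ⟨t, ht⟩ := H w v hwv
    -- One fixed trajectory has k critical points on the half line. For R beyond the last of them it
    -- is fast for every j ≤ k.
    refine ⟨max (t k) 1, lt_max_of_lt_right one_pos, fun R hR => ?_⟩
    have hR0 : 0 < R := one_pos.trans ((le_max_right _ _).trans_lt hR)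
    have hfast : ∀ j ≤ k, ∀ w v, Trajectory n (p - 1) (centered (p - 1) g) α w v →
        ∃ t, CritChain v j t ∧ t j < R := fun j hj w' v' h => by
      have hv : EqOn v v' (Ici 0) := fun r hr =>
        (hf.unique ha (hwv.radialSol r) (h.radialSol r) hα hwv.w_zero h.w_zero).2 ⟨hr, le_rfl⟩
      refine ⟨t, ⟨ht.zero, fun i hi => ht.lt_succ i (hi.trans_le hj), fun i hi => ?_⟩,
        (ht.mono hj le_rfl).trans_lt ((le_max_left _ _).trans_lt hR)⟩
      rw [← hv (ht.nonneg (hi.trans hj)), ht.v_eq i (hi.trans hj)]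
    have hsmall : ∀ ε > 0, ∃ δ > 0, ∀ s ∈ Ioo (-δ) 0,
        -centered (p - 1) g s ≤ ε * |s| ^ (p - 1) := fun ε hε =>
      exists_neg_centered_le_mul hp hg_one (by
        rw [hzero, EReal.coe_ennreal_zero]; exact EReal.coe_pos.2 hε)
    have hex : ∀ j ∈ Icc 1 k, ∀ b : Bool, ∃ u,
        (IsNonconstantRadialSolution (n + 1) p R g u ∧ HasExactlyZeros R u j) ∧
          (b = true → u 0 < 1 - α) ∧ (b = false → 1 - α < u 0) := fun j hj b => by
      cases b
      · obtain ⟨u, hu, hu0⟩ :=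
          exists_solution_of_critChain_of_small hp hf hsmall hR0 hα hj.1 (hfast j hj.2)
        exact ⟨u, hu, by simp, fun _ => hu0⟩
      · obtain ⟨u, hu, hu0⟩ := exists_solution_of_critChain hp hf hC hR0 hα hj.1 (hfast j hj.2)
        exact ⟨u, hu, fun _ => hu0, by simp⟩
    choose! u hu using hex
    refine ⟨u, fun j hj b => (hu j hj b).1, fun i hi j hj a b hne h => ?_⟩
    -- Solutions with different j differ in their number of zeros. For equal j the initial values
    -- lie strictly on opposite sides of 1 - α.
    obtain rfl := (hu i hi a).1.2.eq_of_eqOn (hu j hj b).1.2 h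
    have h0 := h (left_mem_Icc.2 hR0.le)
    have hA := (hu i hi a).2
    have hB := (hu i hi b).2
    cases a <;> cases b
    · exact hne rfl
    · linarith [hA.2 rfl, hB.1 rfl]
    · linarith [hA.1 rfl, hB.2 rfl]
    · exact hne rfl
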